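/- **Theorem 3.1.** Let $Q=(Q_0,Q_1,s,t)$ be a finite quiver (finitely many vertices and arrows; loops and parallel arrows are allowed), let $\mathbb F_q$ be a finite field and let $\alpha\ge 1$ be an integer. For a field $K$ put $\mathcal O_{\alpha,K}:=K[t]/(t^\alpha)$. *Notation.* Let $\mathcal V=\prod_{n\ge1}\mathbb Q$ be the ring of counting functions, with Adams operators $\psi_m\big((a_n)_{n\ge1}\big)=(a_{mn})_{n\ge 1}$ for $m\ge1$, extended to $\mathcal V[[t_i,\ i\in Q_0]]$ by $\psi_m\big(\sum_{\mathbf r} f_{\mathbf r}t^{\mathbf r}\big)=\sum_{\mathbf r}\psi_m(f_{\mathbf r})t^{m\mathbf r}$. For a power series $f$ with zero constant coefficient, let $\mathrm{Exp}_{q,t}(f)=\exp\big(\sum_{m\ge1}\psi_m(f)/m\big)$. Write $q$ also for the counting function $(q^n)_{n\ge1}$. Let $\langle\mathbf d,\mathbf e\rangle=\sum_{i\in Q_0}d_ie_i-\sum_{a\in Q_1}d_{s(a)}e_{t(a)}\in\mathbb Z$ be the Euler form of $Q$. For $\mathbf r\in\mathbb N^{Q_0}$, define the following elements of $\mathcal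 V$. - $\sharp\mathrm{GL}(\mathbf r,\mathcal O_\alpha)$ has $n$-th entry $\prod_{i\in Q_0}\#\mathrm{GL}(r_i,\mathcal O_{\alpha,\mathbb F_{q^n}})$. - $\sharp\mu_{Q,\mathbf r,\alpha}^{-1}(0)$ has as $n$-th entry the number of families $(x_a,y_a)_{a\in Q_1}$, where $x_a$ is an $r_{t(a)}\times r_{s(a)}$ matrix and $y_a$ is an $r_{s(a)}\times r_{t(a)}$ matrix over $\mathcal O_{\alpha,\mathbb F_{q^n}}$, such that $\sum_{t(a)=i}x_ay_a-\sum_{s(a)=i}y_ax_a=0$ for every $i\in Q_0$. - $A_{Q,\mathbf r,\alpha}$ has as $n$-th entry the number of isomorphism classes of representations $M$ of $Q$ over $\mathcal O_{\alpha,\mathbb F_{q^n}}$ that are locally free of rank vector $\mathbf r$ (that is, each module $M_i$ is free of rank $r_i$) and absolutely indecomposable (that is, $M\otimes_{\mathbb F_{q^n}}\overline{\mathbb F}_q$ is nonzero and is not a direct sum of two nonzero subrepresentations). *Claim.* In $\mathcal V[[t_i,\ i\in Q_0]]$, $$\sum_{\mathbf r\in\mathbb N^{Q_0}}\frac{\sharp\mu_{Q,\mathbf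 r,\alpha}^{-1}(0)}{\sharp\mathrm{GL}(\mathbf r,\mathcal O_\alpha)}\cdot q^{\alpha\langle\mathbf r,\mathbf r\rangle}\,t^{\mathbf r}=\mathrm{Exp}_{q,t}\left(\sum_{\mathbf r\in\mathbb N^{Q_0}\setminus\{0\}}\frac{A_{Q,\mathbf r,\alpha}}{1-q^{-1}}\cdot t^{\mathbf r}\right).$$ -/

import Mathlib

open scoped TensorProduct Polynomial

noncomputable section

universe u v w

/-- The ring of truncated polynomials `K[t]/(t^α)`. -/
abbrev TruncPoly (K : Type u) [Field K] (α : ℕ) : Type u :=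
  K[X] ⧸ Ideal.span {(Polynomial.X : K[X]) ^ α}

/-! ### Representations of quivers over a commutative ring -/

/-- A representation of the quiver `V` over `R`: an `R`-module for each vertex and an `R`-linear
map for each arrow. -/
structure QuiverRep (V : Type v) [Quiver.{w} V] (R : Type u) [CommRing R] where
  /-- the module at a vertex -/
  obj : V → Type u
  [addCommGroup : ∀ i, AddCommGroup (obj i)]
  [module : ∀ i, Module R (obj i)]
  /-- the linear map attached to an arrow -/
  map : ∀ {i j : V}, (i ⟶ j) → (obj i →ₗ[R] obj j)

attribute [instance] QuiverRep.addCommGroup QuiverRep.module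

namespace QuiverRep

variable {V : Type v} [Quiver.{w} V] {R : Type u} [CommRing R]

/-- Two representations are isomorphic if there are linear isomorphisms between the modules at all
vertices which commute with the linear maps of all arrows. -/
def IsIso (M N : QuiverRep V R) : Prop :=
  ∃ φ : ∀ i, M.obj i ≃ₗ[R] N.obj i,
    ∀ (i j : V) (a : i ⟶ j) (x : M.obj i), φ j (M.map a x) = N.map a (φ i x)

theorem IsIso.refl (M : QuiverRep V R) : M.IsIso M :=
  ⟨fun _ => LinearEquiv.refl R _, fun _ _ _ _ => rfl⟩

theorem IsIso.symm {M N : QuiverRep V R} (h : M.IsIso N) : N.IsIso M := by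
  obtain ⟨φ, hφ⟩ := h
  refine ⟨fun i => (φ i).symm, fun i j a x => ?_⟩
  rw [LinearEquiv.symm_apply_eq, hφ, LinearEquiv.apply_symm_apply]

theorem IsIso.trans {M N P : QuiverRep V R} (h : M.IsIso N) (h' : N.IsIso P) : M.IsIso P := by
  obtain ⟨φ, hφ⟩ := h
  obtain ⟨ψ, hψ⟩ := h'
  exact ⟨fun i => (φ i).trans (ψ i), fun i j a x => by
    rw [LinearEquiv.trans_apply, LinearEquiv.trans_apply, hφ, hψ]⟩

variable (V R) in
/-- Isomorphism of representations as an equivalence relation. -/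
def isoSetoid : Setoid (QuiverRep V R) where
  r := IsIso
  iseqv := ⟨IsIso.refl, IsIso.symm, IsIso.trans⟩

/-- A representation is locally free (of finite rank) if the modules at all vertices are free and
finitely generated. -/
def IsLocallyFree (M : QuiverRep V R) : Prop :=
  ∀ i, Module.Free R (M.obj i) ∧ Module.Finite R (M.obj i)

/-- The rank vector. -/
def rank (M : QuiverRep V R) : V → ℕ := fun i => Module.finrank R (M.obj i)

/-- A family of submodules is a subrepresentation if it is stable under the maps of all arrows. -/
def IsSubrep (M : QuiverRep V R) (N : ∀ i, Submodule R (M.obj i)) : Prop :=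
  ∀ (i j : V) (a : i ⟶ j), ∀ x ∈ N i, M.map a x ∈ N j

/-- A representation is indecomposable if it is nonzero and is not the direct sum of two nonzero
subrepresentations. -/
def IsIndecomposable (M : QuiverRep V R) : Prop :=
  (∃ i, Nontrivial (M.obj i)) ∧
    ∀ N P : ∀ i, Submodule R (M.obj i), M.IsSubrep N → M.IsSubrep P →
      (∀ i, IsCompl (N i) (P i)) → (∀ i, N i = ⊥) ∨ (∀ i, P i = ⊥)

/-- Extension of scalars along `R → S`. -/
def baseChange (M : QuiverRep V R) (S : Type u) [CommRing S] [Algebra R S] : QuiverRep V S where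
  obj i := S ⊗[R] M.obj i
  map a := (M.map a).baseChange S

/-- Let `R` be an algebra over a field `K`. A representation `M` over `R` is absolutely
indecomposable if its base change `K̄ ⊗_K M = (R ⊗_K K̄) ⊗_R M`, a representation over
`R ⊗_K K̄`, is indecomposable. -/
def IsAbsIndecomposable (K : Type u) [Field K] [Algebra K R] (M : QuiverRep V R) : Prop :=
  (M.baseChange (R ⊗[K] AlgebraicClosure K)).IsIndecomposable

variable (V) in
/-- The number of isomorphism classes of absolutely indecomposable, locally free representations
over `K[t]/(t^α)` of rank vector `r`. -/
def absIndecCount (K : Type u) [Field K] (α : ℕ) (r : V → ℕ) : ℕ :=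
  Set.ncard (Quotient.mk (isoSetoid V (TruncPoly K α)) ''
    {M | M.IsLocallyFree ∧ M.rank = r ∧ M.IsAbsIndecomposable K})

end QuiverRep

/-! ### The moment map -/

section MomentMap

variable {V : Type v} [Fintype V] [Quiver.{w} V] [∀ i j : V, Fintype (i ⟶ j)]

/-- The space of representations of the quiver with modules `R^(r i)`: a matrix
`R^(r i) → R^(r j)` for every arrow `i ⟶ j`. -/
abbrev RepSpace (r : V → ℕ) (R : Type u) : Type (max u v w) :=
  ∀ i j : V, (i ⟶ j) → Matrix (Fin (r j)) (Fin (r i)) R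

/-- The space of representations of the opposite quiver: a matrix `R^(r j) → R^(r i)` for every
arrow `i ⟶ j`. -/
abbrev OpRepSpace (r : V → ℕ) (R : Type u) : Type (max u v w) :=
  ∀ i j : V, (i ⟶ j) → Matrix (Fin (r i)) (Fin (r j)) R

/-- The moment map on representations `(x, y)` of the double quiver; its component at the vertex
`i` is `∑_{t(a) = i} x_a y_a - ∑_{s(a) = i} y_a x_a`. -/
def momentMap (r : V → ℕ) (R : Type u) [CommRing R] (z : RepSpace r R × OpRepSpace r R) (i : V) :
    Matrix (Fin (r i)) (Fin (r i)) R :=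
  ∑ j : V, ∑ a : j ⟶ i, z.1 j i a * z.2 j i a - ∑ j : V, ∑ a : i ⟶ j, z.2 i j a * z.1 i j a

/-- The Euler form `⟨d, e⟩ = ∑_i d_i e_i - ∑_{a : i → j} d_i e_j`. -/
def eulerForm (d e : V → ℤ) : ℤ :=
  ∑ i, d i * e i - ∑ i, ∑ j, ∑ _a : i ⟶ j, d i * e j

end MomentMap

/-! ### Counting functions and the plethystic exponential -/

/-- The ring of counting functions `∏_{n ≥ 1} ℚ`. -/
abbrev CountingFn : Type := ℕ+ → ℚ

/-- The Adams operator `ψ_m (a_n)_n = (a_{mn})_n` on counting functions. -/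
def CountingFn.adams (m : ℕ+) : CountingFn →+* CountingFn where
  toFun a n := a (m * n)
  map_one' := rfl
  map_mul' _ _ := rfl
  map_zero' := rfl
  map_add' _ _ := rfl

/-- The Adams operator `ψ_m (∑ f_r t^r) = ∑ ψ_m(f_r) t^(m r)` on power series. -/
def adamsSeries {V : Type v} (m : ℕ+) (f : MvPowerSeries V CountingFn) :
    MvPowerSeries V CountingFn :=
  MvPowerSeries.expand (m : ℕ) m.ne_zero (MvPowerSeries.map (CountingFn.adams m) f)

/-- The plethystic exponential `Exp(f) = exp (∑_{m ≥ 1} ψ_m(f) / m)` of a power series `f` with zero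
constant coefficient. The coefficients of the infinite sum are then finite sums. -/
def plethysticExp {V : Type v} (f : MvPowerSeries V CountingFn) : MvPowerSeries V CountingFn :=
  PowerSeries.subst
    (fun r => ∑ᶠ m : ℕ+, (m : ℚ)⁻¹ • MvPowerSeries.coeff r (adamsSeries m f) :
      MvPowerSeries V CountingFn)
    (PowerSeries.exp ℚ)

section Counts

variable (F : Type u) [Field F] [Finite F] (p : ℕ) [Fact p.Prime] [CharP F p]

/-- The counting function `q = (q^n)_n`, where `q` is the cardinality of `F`. -/
def countQ : CountingFn := fun n => (Nat.card F : ℚ) ^ (n : ℕ)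

/-- For a finite field `F` of characteristic `p`, the ring `F_n[t]/(t^α)` over the extension
`F_n` of `F` of degree `n`. -/
abbrev ExtTruncPoly (α : ℕ) (n : ℕ+) : Type := TruncPoly (FiniteField.Extension F p n) α

variable {V : Type v}

/-- The counting function of the zero fibre of the moment map over `F[t]/(t^α)`. -/
def countMomentZero [Fintype V] [Quiver.{w} V] [∀ i j : V, Fintype (i ⟶ j)]
    (α : ℕ) (r : V → ℕ) : CountingFn :=
  fun n => (Nat.card {z : RepSpace r (ExtTruncPoly F p α n) × OpRepSpace r (ExtTruncPoly F p α n) //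
    momentMap r (ExtTruncPoly F p α n) z = 0} : ℚ)

/-- The counting function of the group `∏_i GL(r i, F[t]/(t^α))`. -/
def countGL (α : ℕ) (r : V → ℕ) : CountingFn :=
  fun n => (Nat.card (∀ i, GL (Fin (r i)) (ExtTruncPoly F p α n)) : ℚ)

/-- The counting function of absolutely indecomposable, locally free representations over
`F[t]/(t^α)` of rank vector `r`, up to isomorphism. -/
def countAbsIndec [Quiver.{w} V] (α : ℕ) (r : V → ℕ) : CountingFn :=
  fun n => (QuiverRep.absIndecCount V (FiniteField.Extension F p n) α r : ℚ)

end Counts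

end

/-! ### Finite monoids, retracts and splitting off indecomposables -/

section

open CategoryTheory CategoryTheory.Limits

/-! Evaluate both sides at n and put k = F_{q^n}, R = k[t]/(t^α). For a fixed representation x, the
trace pairing composed with the top-coefficient form on R turns the moment map equation into the
condition that y annihilates the image of the infinitesimal gauge action g ↦ gx − xg, whose kernel
is End(M_x). Hence the fibre over x has |Rep|·|End M_x|/|∏ Mat_{r_i}(R)| points
(`card_momentMap_fibre_mul`). Since |Rep|/|∏ Mat_{r_i}(R)| = |k|^{−α⟨r,r⟩}, orbit counting turns the
coefficient on the left into the sum of |End M|/|Aut M| over isomorphism classes of locally free M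
of rank r (`LFRep.finsum_card_end_div`, `LFRep.card_momentMap_zero_div`).

Locally free representations form a Krull–Schmidt category with finite Hom sets. The ratio
|End|/|Aut| is multiplicative over isotypic parts, because an endomorphism of a biproduct of coprime
objects is invertible exactly when its diagonal blocks are (`Coprime.endAutRatio_biprod`). For I^n
it equals ∏_{j ≤ n} (1 − q_I^{−j})⁻¹, where q_I = |k|^{d_I} is the order of the residue field of End
I. By Euler's identity the left side is therefore the product over indecomposables I of exp(∑_j
t^{j·rank I} / (j(1 − q_I^{−j}))).

The exponents are matched by descent. Over an extension K/k of degree m, each I with d_I ∣ m splits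
into d_I pairwise non-isomorphic absolutely indecomposable objects of rank (rank I)/d_I, and every
absolutely indecomposable object arises from exactly one such I
(`ScalarExtension.ncard_isAbsIndec`). No Galois action is needed: the summands come from lifting the
idempotents of K ⊗ (residue field), and their ranks agree because K acts on each restriction I^a,
which bounds a from below, while the values of a have a known sum. Substituting m = j·d_I converts
the exponent above into ∑_m ψ_m(·)/m (`GradedMultiset.sum_range_degree_eq`).

No infinite product or logarithm is formed. Both sides satisfy deg(r)·f_r = ∑_{a+b=r} G_a f_b with
the same G, namely the exponent weighted by degree, and this recursion together with f_0 = 1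
determines f (`eq_of_degree_mul_eq_sum`). -/

/-- Some positive power of an element of a finite monoid is idempotent. -/
theorem exists_pow_isIdempotentElem {M : Type*} [Monoid M] [Finite M] (f : M) :
    ∃ n, 0 < n ∧ IsIdempotentElem (f ^ n) := by
  obtain ⟨a, b, hab, h⟩ := Finite.exists_ne_map_eq_of_infinite (fun n : ℕ => f ^ n)
  wlog hlt : a < b generalizing a b
  · exact this b a hab.symm h.symm (by omega)
  obtain ⟨p, rfl⟩ := Nat.exists_eq_add_of_lt hlt
  have key : ∀ n, a ≤ n → f ^ (n + (p + 1)) = f ^ n := by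
    intro n hn
    obtain ⟨c, rfl⟩ := Nat.exists_eq_add_of_le hn
    have h' : f ^ (a + (p + 1)) = f ^ a := h.symm
    rw [show a + c + (p + 1) = (a + (p + 1)) + c by omega, pow_add, h', ← pow_add]
  have key2 : ∀ j n, a ≤ n → f ^ (n + j * (p + 1)) = f ^ n := by
    intro j
    induction j with
    | zero => simp
    | succ j ih =>
      intro n hn
      rw [show n + (j + 1) * (p + 1) = (n + j * (p + 1)) + (p + 1) by ring,
        key _ (by omega), ih n hn]
  -- The exponent is a multiple of the period `p + 1` and is at least the preperiod `a`.
  refine ⟨(a + 1) * (p + 1), by positivity, ?_⟩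
  rw [IsIdempotentElem, ← pow_add]
  exact key2 _ _ (by nlinarith)

namespace KrullSchmidt

section Retracts

variable {C : Type*} [Category C]

/-- `Y` is a retract of `X`. -/
def IsRetract (Y X : C) : Prop := ∃ (i : Y ⟶ X) (r : X ⟶ Y), i ≫ r = 𝟙 Y

theorem IsRetract.trans {X Y Z : C} (h : IsRetract X Y) (h' : IsRetract Y Z) : IsRetract X Z := by
  obtain ⟨i, r, h⟩ := h
  obtain ⟨i', r', h'⟩ := h'
  exact ⟨i ≫ i', r' ≫ r, by rw [Category.assoc, reassoc_of% h', h]⟩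

theorem IsRetract.of_iso {X Y : C} (e : X ≅ Y) : IsRetract X Y := ⟨e.hom, e.inv, by simp⟩

theorem IsRetract.map {D : Type*} [Category D] (F : C ⥤ D) {X Y : C} (h : IsRetract X Y) :
    IsRetract (F.obj X) (F.obj Y) := by
  obtain ⟨i, r, h⟩ := h
  exact ⟨F.map i, F.map r, by rw [← F.map_comp, h, F.map_id]⟩

end Retracts

variable {C : Type*} [Category C] [Preadditive C]

/-- An object is indecomposable if it is nonzero and its only idempotent endomorphisms are `0` and
the identity. -/
def IsIndec (X : C) : Prop := 𝟙 X ≠ 0 ∧ ∀ e : X ⟶ X, e ≫ e = e → e = 0 ∨ e = 𝟙 X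

theorem IsIndec.of_iso {X Y : C} (e : X ≅ Y) (h : IsIndec X) : IsIndec Y := by
  refine ⟨fun h0 => h.1 ?_, fun f hf => ?_⟩
  · rw [← e.hom_inv_id, ← Category.id_comp e.inv, h0, zero_comp, comp_zero]
  · rcases h.2 (e.hom ≫ f ≫ e.inv) (by simp [reassoc_of% hf]) with h1 | h1
    · left
      have := congrArg (fun g => e.inv ≫ g ≫ e.hom) h1
      simpa using this
    · right
      have := congrArg (fun g => e.inv ≫ g ≫ e.hom) h1
      simpa using this

theorem isIso_id_sub_of_isNilpotent {X : C} (f : X ⟶ X) (h : IsNilpotent (show End X from f)) :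
    IsIso (𝟙 X - f) :=
  (isUnit_iff_isIso _).1 h.isUnit_one_sub

/-- The idempotent `r ≫ i` of `X` cannot vanish, since `𝟙 Y` factors through it; so it is the
identity. -/
theorem IsIndec.nonempty_iso_of_isRetract {X Y : C} (hX : IsIndec X) (hY : IsIndec Y)
    (h : IsRetract Y X) : Nonempty (Y ≅ X) := by
  obtain ⟨i, r, hir⟩ := h
  rcases hX.2 (r ≫ i) (by rw [Category.assoc, reassoc_of% hir]) with h1 | h1
  · exfalso
    apply hY.1
    calc 𝟙 Y = (i ≫ r) ≫ (i ≫ r) := by rw [hir, Category.comp_id]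
      _ = 0 := by rw [Category.assoc, reassoc_of% h1, zero_comp, comp_zero]
  · exact ⟨⟨i, r, hir, h1⟩⟩

section Biproducts

variable [HasBinaryBiproducts C]

theorem isRetract_biprod_left (X Y : C) : IsRetract X (X ⊞ Y) := ⟨biprod.inl, biprod.fst, by simp⟩

/-- A retract in an idempotent complete category has a complement. -/
theorem IsRetract.exists_iso_biprod [IsIdempotentComplete C] {X Y : C} {i : Y ⟶ X} {r : X ⟶ Y}
    (h : i ≫ r = 𝟙 Y) : ∃ (Z : C) (e : X ≅ Y ⊞ Z), e.hom ≫ biprod.fst = r ∧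
      biprod.inl ≫ e.inv = i := by
  -- The complement is obtained by splitting the complementary idempotent.
  obtain ⟨Z, j, s, hjs, hsj⟩ := IsIdempotentComplete.idempotents_split X (𝟙 X - r ≫ i) (by
    simp [Preadditive.sub_comp, Preadditive.comp_sub, reassoc_of% h])
  have h1 : i ≫ s = 0 := by
    have : i ≫ s ≫ j ≫ s = 0 := by
      rw [reassoc_of% hsj]
      simp [Preadditive.sub_comp, Preadditive.comp_sub, reassoc_of% h]
    simpa [hjs] using this
  have h2 : j ≫ r = 0 := by
    have : (j ≫ s) ≫ j ≫ r = 0 := by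
      rw [Category.assoc, reassoc_of% hsj]
      simp [Preadditive.sub_comp, h]
    simpa [hjs] using this
  refine ⟨Z, ⟨biprod.lift r s, biprod.desc i j, ?_, ?_⟩, by simp, by simp⟩
  · rw [biprod.lift_desc, hsj]; abel
  · ext <;> simp [h, h1, h2, hjs]

end Biproducts

section Finite

variable [∀ X Y : C, Finite (X ⟶ Y)]

instance (X : C) : Finite (End X) := inferInstanceAs (Finite (X ⟶ X))

/-- Fitting's lemma in finite form: some power of `f` is idempotent, hence `0` or the identity. In
particular `End X` is local. -/
theorem IsIndec.isIso_or_isNilpotent {X : C} (h : IsIndec X) (f : X ⟶ X) :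
    IsIso f ∨ IsNilpotent (show End X from f) := by
  obtain ⟨n, hn, he⟩ := exists_pow_isIdempotentElem (show End X from f)
  rcases h.2 ((show End X from f) ^ n) he with h1 | h1
  · exact Or.inr ⟨n, h1⟩
  · left
    have : IsUnit ((show End X from f) ^ n) := by
      rw [h1]; exact isUnit_one
    exact (isUnit_iff_isIso _).1 ((isUnit_pow_iff hn.ne').1 this)

theorem IsIndec.isIso_of_add {X : C} (h : IsIndec X) (f g : X ⟶ X) (hfg : f + g = 𝟙 X) :
    IsIso f ∨ IsIso g := by
  rcases h.isIso_or_isNilpotent f with h1 | h1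
  · exact Or.inl h1
  · right
    rw [← eq_sub_iff_add_eq'] at hfg
    rw [hfg]
    exact isIso_id_sub_of_isNilpotent f h1

theorem IsIndec.exists_isIso_of_sum {X : C} (h : IsIndec X) {ι : Type*} (s : Finset ι)
    (f : ι → (X ⟶ X)) (hf : IsIso (∑ i ∈ s, f i)) : ∃ i ∈ s, IsIso (f i) := by
  classical
  induction s using Finset.induction_on with
  | empty =>
    exfalso
    rw [Finset.sum_empty] at hf
    apply h.1
    rw [← IsIso.hom_inv_id (0 : X ⟶ X), zero_comp]
  | insert a s ha ih =>
    rw [Finset.sum_insert ha] at hf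
    have h1 : f a ≫ inv (f a + ∑ i ∈ s, f i) + (∑ i ∈ s, f i) ≫ inv (f a + ∑ i ∈ s, f i) = 𝟙 X := by
      rw [← Preadditive.add_comp, IsIso.hom_inv_id]
    rcases h.isIso_of_add _ _ h1 with h2 | h2
    · exact ⟨a, by simp, IsIso.of_isIso_comp_right _ (inv (f a + ∑ i ∈ s, f i))⟩
    · obtain ⟨i, hi, hi'⟩ := ih (IsIso.of_isIso_comp_right _ (inv (f a + ∑ i ∈ s, f i)))
      exact ⟨i, by simp [hi], hi'⟩

/-- An indecomposable retract of `X` is a retract of one of the objects through which a finite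
decomposition of the identity of `X` factors. -/
theorem IsIndec.isRetract_of_sum {X Y : C} (h : IsIndec Y) (hYX : IsRetract Y X) {ι : Type*}
    (s : Finset ι) (Z : ι → C) (p : ∀ j, X ⟶ Z j) (u : ∀ j, Z j ⟶ X)
    (hs : ∑ j ∈ s, p j ≫ u j = 𝟙 X) : ∃ j ∈ s, IsRetract Y (Z j) := by
  obtain ⟨i, r, hir⟩ := hYX
  -- The identity of `Y` becomes a sum of endomorphisms factoring through the `Z j`; as `End Y` is
  -- local, one of them is invertible.
  have h1 : ∑ j ∈ s, (i ≫ p j) ≫ (u j ≫ r) = 𝟙 Y := by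
    have : ∑ j ∈ s, (i ≫ p j) ≫ (u j ≫ r) = i ≫ (∑ j ∈ s, p j ≫ u j) ≫ r := by
      rw [Preadditive.sum_comp, Preadditive.comp_sum]
      simp
    rw [this, hs, Category.id_comp, hir]
  obtain ⟨j, hj, hj'⟩ := h.exists_isIso_of_sum s _ (by rw [h1]; infer_instance)
  exact ⟨j, hj, i ≫ p j, (u j ≫ r) ≫ inv ((i ≫ p j) ≫ (u j ≫ r)), by
    rw [← Category.assoc, IsIso.hom_inv_id]⟩

variable [HasBinaryBiproducts C]

theorem IsIndec.isRetract_biprod {X Y Z : C} (h : IsIndec Y) (hY : IsRetract Y (X ⊞ Z)) :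
    IsRetract Y X ∨ IsRetract Y Z := by
  obtain ⟨i, r, hir⟩ := hY
  have h1 : (i ≫ biprod.fst) ≫ (biprod.inl ≫ r) + (i ≫ biprod.snd) ≫ (biprod.inr ≫ r) = 𝟙 Y := by
    have : (i ≫ biprod.fst) ≫ (biprod.inl ≫ r) + (i ≫ biprod.snd) ≫ (biprod.inr ≫ r) =
      i ≫ (biprod.fst ≫ biprod.inl + biprod.snd ≫ biprod.inr : X ⊞ Z ⟶ X ⊞ Z) ≫ r := by
        simp only [Preadditive.add_comp, Preadditive.comp_add, Category.assoc]
    rw [this, biprod.total, Category.id_comp, hir]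
  rcases h.isIso_of_add _ _ h1 with h2 | h2
  · exact Or.inl ⟨i ≫ biprod.fst, (biprod.inl ≫ r) ≫ inv ((i ≫ biprod.fst) ≫ (biprod.inl ≫ r)), by
      rw [← Category.assoc, IsIso.hom_inv_id]⟩
  · exact Or.inr ⟨i ≫ biprod.snd, (biprod.inr ≫ r) ≫ inv ((i ≫ biprod.snd) ≫ (biprod.inr ≫ r)), by
      rw [← Category.assoc, IsIso.hom_inv_id]⟩

/-- Block-diagonal endomorphisms already number |End X|·|End Y|, and |End X| ≥ 2. The order of the
endomorphism ring thus serves as the induction measure for decompositions. -/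
theorem card_hom_biprod_lt {X Y : C} (hX : 𝟙 X ≠ 0) :
    Nat.card (Y ⟶ Y) < Nat.card (X ⊞ Y ⟶ X ⊞ Y) := by
  let φ : (X ⟶ X) × (Y ⟶ Y) → (X ⊞ Y ⟶ X ⊞ Y) := fun f => biprod.map f.1 f.2
  have hφ : Function.Injective φ := by
    rintro ⟨f, g⟩ ⟨f', g'⟩ h
    have h1 := congrArg (fun z => biprod.inl ≫ z ≫ biprod.fst) h
    have h2 := congrArg (fun z => biprod.inr ≫ z ≫ biprod.snd) h
    simp only [φ, biprod.inl_map_assoc, biprod.inl_fst, biprod.inr_map_assoc, biprod.inr_snd,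
      Category.comp_id] at h1 h2
    rw [h1, h2]
  have h3 := Nat.card_le_card_of_injective φ hφ
  rw [Nat.card_prod] at h3
  have h4 : 1 < Nat.card (X ⟶ X) := by
    rw [Finite.one_lt_card_iff_nontrivial]
    exact ⟨𝟙 X, 0, hX⟩
  have h5 : 0 < Nat.card (Y ⟶ Y) := Nat.card_pos
  nlinarith

variable [IsIdempotentComplete C]

/-- Induction over finite biproducts of indecomposable objects. -/
theorem biprod_induction {P : C → Prop} (hiso : ∀ X Y : C, (X ≅ Y) → P X → P Y)
    (hzero : ∀ X : C, 𝟙 X = 0 → P X)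
    (hadd : ∀ I X : C, IsIndec I → P X → P (I ⊞ X)) (X : C) : P X := by
  induction hn : Nat.card (X ⟶ X) using Nat.strong_induction_on generalizing X with
  | _ n ih =>
  subst hn
  by_cases h0 : 𝟙 X = 0
  · exact hzero X h0
  -- It suffices to split off one indecomposable summand, since the complement has fewer
  -- endomorphisms.
  suffices H : ∃ I Z : C, IsIndec I ∧ Nonempty (X ≅ I ⊞ Z) by
    obtain ⟨I, Z, hI, ⟨e⟩⟩ := H
    refine hiso _ _ e.symm (hadd I Z hI (ih _ ?_ Z rfl))
    calc Nat.card (Z ⟶ Z) < Nat.card (I ⊞ Z ⟶ I ⊞ Z) := card_hom_biprod_lt hI.1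
      _ = Nat.card (X ⟶ X) := Nat.card_congr (Iso.homCongr e.symm e.symm)
  clear ih
  induction hn : Nat.card (X ⟶ X) using Nat.strong_induction_on generalizing X with
  | _ n ih =>
  subst hn
  by_cases hX : IsIndec X
  · obtain ⟨Z, e, -⟩ := IsRetract.exists_iso_biprod (X := X) (Y := X) (i := 𝟙 X) (r := 𝟙 X) (by simp)
    exact ⟨X, Z, hX, ⟨e⟩⟩
  · simp only [IsIndec, not_and, not_forall, not_or] at hX
    obtain ⟨e, he, he0, he1⟩ := hX h0
    obtain ⟨Y, i, r, hir, hri⟩ := IsIdempotentComplete.idempotents_split X e he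
    obtain ⟨Z, φ, hφ1, hφ2⟩ := IsRetract.exists_iso_biprod hir
    -- As `e` is neither `0` nor the identity, both summands are nonzero. Hence `Y` has fewer
    -- endomorphisms than `X`, and an indecomposable summand of `Y` is one of `X`.
    have hY : 𝟙 Y ≠ 0 := fun h => he0 (by rw [← hri, ← Category.comp_id r, h]; simp)
    have hZ : 𝟙 Z ≠ 0 := fun h => he1 (by
      rw [← hri, ← hφ1, ← hφ2, Category.assoc, ← Category.assoc biprod.fst]
      have : (biprod.fst ≫ biprod.inl : Y ⊞ Z ⟶ Y ⊞ Z) = 𝟙 _ := by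
        rw [← biprod.total, left_eq_add, ← Category.id_comp biprod.inr, h]
        simp
      rw [this]; simp)
    have hlt : Nat.card (Y ⟶ Y) < Nat.card (X ⟶ X) := by
      calc Nat.card (Y ⟶ Y) < Nat.card (Z ⊞ Y ⟶ Z ⊞ Y) := card_hom_biprod_lt hZ
        _ = Nat.card (X ⟶ X) := by
          have ψ := φ ≪≫ biprod.braiding Y Z
          exact Nat.card_congr (Iso.homCongr ψ.symm ψ.symm)
    obtain ⟨I, W, hI, ⟨ψ⟩⟩ := ih _ hlt Y hY rfl
    obtain ⟨W', ψ', -⟩ := IsRetract.exists_iso_biprod (X := X) (Y := I)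
      (i := (biprod.inl ≫ ψ.inv) ≫ i) (r := r ≫ ψ.hom ≫ biprod.fst) (by
        simp [reassoc_of% hir])
    exact ⟨I, W', hI, ⟨ψ'⟩⟩

theorem exists_isIndec_isRetract {X : C} (hX : 𝟙 X ≠ 0) : ∃ I : C, IsIndec I ∧ IsRetract I X := by
  refine biprod_induction (P := fun X : C => 𝟙 X ≠ 0 → ∃ I : C, IsIndec I ∧ IsRetract I X)
    ?_ ?_ ?_ X hX
  · intro X Y e h hY
    obtain ⟨I, hI, hI'⟩ := h (fun h0 => hY (by
      rw [← e.inv_hom_id, ← Category.id_comp e.hom, h0, zero_comp, comp_zero]))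
    exact ⟨I, hI, hI'.trans (IsRetract.of_iso e)⟩
  · intro X h h'
    exact absurd h h'
  · intro I X hI _ _
    exact ⟨I, hI, isRetract_biprod_left I X⟩

end Finite

end KrullSchmidt

end

/-! ### Krull–Schmidt uniqueness and the ratio |End|/|Aut| -/

section

open CategoryTheory CategoryTheory.Limits

namespace KrullSchmidt

section

variable {C : Type*} [Category C]

theorem card_isIso_congr {X Y X' Y' : C} (e : X ≅ X') (e' : Y ≅ Y') :
    Nat.card {f : X ⟶ Y // IsIso f} = Nat.card {f : X' ⟶ Y' // IsIso f} :=
  Nat.card_congr ((Iso.homCongr e e').subtypeEquiv fun f => by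
    simp only [Iso.homCongr_apply]
    constructor
    · intro h; infer_instance
    · intro h
      have h1 : IsIso (f ≫ e'.hom) := IsIso.of_isIso_comp_left e.inv _
      exact IsIso.of_isIso_comp_right f e'.hom)

end

variable {C : Type*} [Category C] [Preadditive C]

/-- Two objects are coprime if they have no common indecomposable retract. -/
def Coprime (A N : C) : Prop := ∀ I : C, IsIndec I → IsRetract I A → ¬ IsRetract I N

theorem Coprime.symm {A N : C} (h : Coprime A N) : Coprime N A := fun I hI h1 h2 => h I hI h2 h1

/-- The ratio of the numbers of endomorphisms and of automorphisms. -/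
noncomputable def endAutRatio (X : C) : ℚ :=
  (Nat.card (X ⟶ X) : ℚ) / Nat.card {f : X ⟶ X // IsIso f}

omit [Preadditive C] in
theorem endAutRatio_congr {X Y : C} (e : X ≅ Y) : endAutRatio X = endAutRatio Y := by
  rw [endAutRatio, endAutRatio, card_isIso_congr e e, Nat.card_congr (Iso.homCongr e e)]

section Finite

variable [∀ X Y : C, Finite (X ⟶ Y)] [IsIdempotentComplete C] [HasBinaryBiproducts C]

/-- Otherwise an idempotent power of `u ≫ v` has a nonzero image. An indecomposable retract of that
image is a retract of `N`, and also of `A`, because the power factors through `A`. -/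
theorem Coprime.isNilpotent {A N : C} (h : Coprime A N) (u : N ⟶ A) (v : A ⟶ N) :
    IsNilpotent (show End N from u ≫ v) := by
  obtain ⟨n, hn, he⟩ := exists_pow_isIdempotentElem (show End N from u ≫ v)
  refine ⟨n, ?_⟩
  by_contra h0
  obtain ⟨Y, i, r, hir, hri⟩ := IsIdempotentComplete.idempotents_split N
    ((show End N from u ≫ v) ^ n) he
  have hY : 𝟙 Y ≠ 0 := fun h1 => h0 (by rw [← hri, ← Category.id_comp i, h1]; simp)
  obtain ⟨I, hI, hIY⟩ := exists_isIndec_isRetract hY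
  refine h I hI (hIY.trans ?_) (hIY.trans ⟨i, r, hir⟩)
  obtain ⟨m, rfl⟩ := Nat.exists_eq_succ_of_ne_zero hn.ne'
  have h2 : (show End N from u ≫ v) ^ (m + 1) =
      u ≫ v ≫ (show N ⟶ N from (show End N from u ≫ v) ^ m) := by
    rw [pow_succ, End.mul_def]; exact Category.assoc _ _ _
  refine ⟨i ≫ u, v ≫ (show N ⟶ N from (show End N from u ≫ v) ^ m) ≫ r, ?_⟩
  calc _ = i ≫ (u ≫ v ≫ (show N ⟶ N from (show End N from u ≫ v) ^ m)) ≫ r := by simp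
    _ = i ≫ (r ≫ i) ≫ r := by rw [← h2, ← hri]
    _ = 𝟙 Y := by simp [hir]

theorem Coprime.isIso_id_sub {A N : C} (h : Coprime A N) (u : N ⟶ A) (v : A ⟶ N) :
    IsIso (𝟙 N - u ≫ v) :=
  isIso_id_sub_of_isNilpotent _ (h.isNilpotent u v)

/-- Multiply the block of `f` by the corresponding block of its inverse: in either order the product
differs from the identity by a map factoring through a coprime object, which is nilpotent. -/
theorem Coprime.isIso_fst_fst {A N A' N' : C} (h₁ : Coprime A N') (h₂ : Coprime A' N)
    (f : A ⊞ N ⟶ A' ⊞ N') [IsIso f] : IsIso (biprod.inl ≫ f ≫ biprod.fst) := by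
  have e1 : (biprod.inl ≫ f ≫ biprod.fst) ≫ (biprod.inl ≫ inv f ≫ biprod.fst) =
      𝟙 A - (biprod.inl ≫ f ≫ biprod.snd) ≫ (biprod.inr ≫ inv f ≫ biprod.fst) := by
    rw [eq_sub_iff_add_eq]
    calc _ = biprod.inl ≫ f ≫ (biprod.fst ≫ biprod.inl + biprod.snd ≫ biprod.inr) ≫
          inv f ≫ biprod.fst := by
          simp only [Preadditive.add_comp, Preadditive.comp_add, Category.assoc]
      _ = 𝟙 A := by simp
  have e2 : (biprod.inl ≫ inv f ≫ biprod.fst) ≫ (biprod.inl ≫ f ≫ biprod.fst) =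
      𝟙 A' - (biprod.inl ≫ inv f ≫ biprod.snd) ≫ (biprod.inr ≫ f ≫ biprod.fst) := by
    rw [eq_sub_iff_add_eq]
    calc _ = biprod.inl ≫ inv f ≫ (biprod.fst ≫ biprod.inl + biprod.snd ≫ biprod.inr) ≫
          f ≫ biprod.fst := by
          simp only [Preadditive.add_comp, Preadditive.comp_add, Category.assoc]
      _ = 𝟙 A' := by simp
  have i1 : IsIso ((biprod.inl ≫ f ≫ biprod.fst) ≫ (biprod.inl ≫ inv f ≫ biprod.fst)) := by
    rw [e1]; exact h₁.symm.isIso_id_sub _ _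
  have i2 : IsIso ((biprod.inl ≫ inv f ≫ biprod.fst) ≫ (biprod.inl ≫ f ≫ biprod.fst)) := by
    rw [e2]; exact h₂.symm.isIso_id_sub _ _
  have hs : IsSplitMono (biprod.inl ≫ f ≫ biprod.fst) :=
    ⟨⟨⟨(biprod.inl ≫ inv f ≫ biprod.fst) ≫
      inv ((biprod.inl ≫ f ≫ biprod.fst) ≫ (biprod.inl ≫ inv f ≫ biprod.fst)), by
        rw [← Category.assoc]
        exact IsIso.hom_inv_id
          ((biprod.inl ≫ f ≫ biprod.fst) ≫ (biprod.inl ≫ inv f ≫ biprod.fst))⟩⟩⟩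
  have he : Epi (biprod.inl ≫ f ≫ biprod.fst) :=
    epi_of_epi (biprod.inl ≫ inv f ≫ biprod.fst) _
  exact isIso_of_epi_of_isSplitMono _

theorem Coprime.isIso_snd_snd {A N A' N' : C} (h₁ : Coprime A N') (h₂ : Coprime A' N)
    (f : A ⊞ N ⟶ A' ⊞ N') [IsIso f] : IsIso (biprod.inr ≫ f ≫ biprod.snd) := by
  have := Coprime.isIso_fst_fst h₂.symm h₁.symm
    ((biprod.braiding N A).hom ≫ f ≫ (biprod.braiding A' N').hom)
  have e : biprod.inl ≫ biprod.lift biprod.snd biprod.fst = (biprod.inr : N ⟶ A ⊞ N) := by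
    ext <;> simp
  simpa [reassoc_of% e] using this

/-- Gaussian elimination: `f` is a product of a lower unipotent, a diagonal and an upper unipotent
matrix, with diagonal entries `a` and the Schur complement of `a`. -/
theorem Coprime.isIso_of_diagonal {A N A' N' : C} (h : Coprime A' N)
    (f : A ⊞ N ⟶ A' ⊞ N') (h₁ : IsIso (biprod.inl ≫ f ≫ biprod.fst))
    (h₂ : IsIso (biprod.inr ≫ f ≫ biprod.snd)) : IsIso f := by
  set a := biprod.inl ≫ f ≫ biprod.fst with ha
  set b := biprod.inl ≫ f ≫ biprod.snd with hb
  set c := biprod.inr ≫ f ≫ biprod.fst with hc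
  set d := biprod.inr ≫ f ≫ biprod.snd with hd
  have hf : f = Biprod.ofComponents a b c d := by simp [ha, hb, hc, hd]
  -- After extracting `d`, the correction to `𝟙 N` factors as `N ⟶ A' ⟶ N`, so coprimality makes it
  -- nilpotent.
  have hs : IsIso (d - c ≫ inv a ≫ b) := by
    have e : d - c ≫ inv a ≫ b = (𝟙 N - c ≫ (inv a ≫ b ≫ inv d)) ≫ d := by
      simp [Preadditive.sub_comp]
    have := h.isIso_id_sub c (inv a ≫ b ≫ inv d)
    rw [e]; infer_instance
  have l1 : biprod.inl ≫ Biprod.ofComponents (𝟙 A) (0 : A ⟶ N) (c ≫ inv a) (𝟙 N) =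
    biprod.inl := by simp
  have l2 : biprod.inr ≫ Biprod.ofComponents (𝟙 A) (0 : A ⟶ N) (c ≫ inv a) (𝟙 N) =
    (c ≫ inv a) ≫ biprod.inl + biprod.inr := by simp
  have e2 : f = Biprod.ofComponents (𝟙 A) (0 : A ⟶ N) (c ≫ inv a) (𝟙 N) ≫
      biprod.map a (d - c ≫ inv a ≫ b) ≫ (Biprod.unipotentUpper (inv a ≫ b)).hom := by
    rw [hf]
    ext <;> simp [reassoc_of% l1, reassoc_of% l2]
  have : IsIso (Biprod.ofComponents (𝟙 A) (0 : A ⟶ N) (c ≫ inv a) (𝟙 N)) :=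
    (Biprod.unipotentLower (X₁ := A) (X₂ := N) (c ≫ inv a)).isIso_hom
  have : IsIso (biprod.map a (d - c ≫ inv a ≫ b)) :=
    (biprod.mapIso (asIso a) (asIso (d - c ≫ inv a ≫ b))).isIso_hom
  rw [e2]
  infer_instance

theorem Coprime.isIso_iff {A N : C} (h : Coprime A N) (f : A ⊞ N ⟶ A ⊞ N) :
    IsIso f ↔ IsIso (biprod.inl ≫ f ≫ biprod.fst) ∧ IsIso (biprod.inr ≫ f ≫ biprod.snd) :=
  ⟨fun _ => ⟨h.isIso_fst_fst h f, h.isIso_snd_snd h f⟩, fun h' => h.isIso_of_diagonal f h'.1 h'.2⟩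

/-- The off-diagonal blocks are unconstrained both for endomorphisms and for automorphisms, so their
number cancels in the ratio. -/
theorem Coprime.endAutRatio_biprod {A N : C} (h : Coprime A N) :
    endAutRatio (A ⊞ N) = endAutRatio A * endAutRatio N := by
  let φ : (A ⊞ N ⟶ A ⊞ N) ≃ ((A ⟶ A) × (N ⟶ N)) × ((A ⟶ N) × (N ⟶ A)) :=
    { toFun := fun f => ((biprod.inl ≫ f ≫ biprod.fst, biprod.inr ≫ f ≫ biprod.snd),
        (biprod.inl ≫ f ≫ biprod.snd, biprod.inr ≫ f ≫ biprod.fst))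
      invFun := fun x => Biprod.ofComponents x.1.1 x.2.1 x.2.2 x.1.2
      left_inv := fun f => by simp
      right_inv := fun x => by simp }
  let ψ : {f : A ⊞ N ⟶ A ⊞ N // IsIso f} ≃
      ({f : A ⟶ A // IsIso f} × {f : N ⟶ N // IsIso f}) × ((A ⟶ N) × (N ⟶ A)) :=
    { toFun := fun f => ((⟨_, ((h.isIso_iff f.1).1 f.2).1⟩, ⟨_, ((h.isIso_iff f.1).1 f.2).2⟩),
        (φ f.1).2)
      invFun := fun x => ⟨φ.symm ((x.1.1.1, x.1.2.1), x.2), (h.isIso_iff _).2 (by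
        have h1 := x.1.1.2
        have h2 := x.1.2.2
        constructor <;> simpa [φ])⟩
      left_inv := fun f => Subtype.ext (φ.left_inv f.1)
      right_inv := fun x => by simp [φ] }
  have h1 : (Nat.card (A ⟶ N) : ℚ) ≠ 0 := by exact_mod_cast Nat.card_pos.ne'
  have h2 : (Nat.card (N ⟶ A) : ℚ) ≠ 0 := by exact_mod_cast Nat.card_pos.ne'
  rw [endAutRatio, endAutRatio, endAutRatio, Nat.card_congr φ, Nat.card_congr ψ]
  simp only [Nat.card_prod, Nat.cast_mul]
  field_simp

end Finite

section IsoClass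

variable (C) in
/-- The type of isomorphism classes of objects. -/
abbrev IsoClass := Quotient (isIsomorphicSetoid C)

variable [HasFiniteBiproducts C] [HasBinaryBiproducts C]

/-- The isomorphism class of an object. -/
abbrev isoClass (X : C) : IsoClass C := Quotient.mk _ X

omit [Preadditive C] [HasFiniteBiproducts C] [HasBinaryBiproducts C] in
theorem isoClass_eq_iff {X Y : C} : isoClass X = isoClass Y ↔ Nonempty (X ≅ Y) := Quotient.eq

noncomputable instance : Add (IsoClass C) where
  add := Quotient.map₂ (fun X Y => X ⊞ Y) fun _ _ ⟨e⟩ _ _ ⟨e'⟩ => ⟨biprod.mapIso e e'⟩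

open ZeroObject in
noncomputable instance : Zero (IsoClass C) where
  zero := isoClass 0

/-- Isomorphism classes form a commutative monoid under biproduct. -/
noncomputable instance : AddCommMonoid (IsoClass C) where
  add_assoc := by
    rintro ⟨X⟩ ⟨Y⟩ ⟨Z⟩
    exact Quotient.sound ⟨biprod.associator X Y Z⟩
  zero_add := by
    rintro ⟨X⟩
    exact Quotient.sound ⟨(isoZeroBiprod (isZero_zero C)).symm⟩
  add_zero := by
    rintro ⟨X⟩
    exact Quotient.sound ⟨(isoBiprodZero (isZero_zero C)).symm⟩
  add_comm := by
    rintro ⟨X⟩ ⟨Y⟩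
    exact Quotient.sound ⟨biprod.braiding X Y⟩
  nsmul := nsmulRec

omit [HasFiniteBiproducts C] in
theorem isoClass_biprod (X Y : C) : isoClass (X ⊞ Y) = isoClass X + isoClass Y := rfl

omit [HasBinaryBiproducts C] in
theorem isoClass_eq_zero {X : C} : isoClass X = 0 ↔ 𝟙 X = 0 := by
  rw [← IsZero.iff_id_eq_zero]
  constructor
  · intro h
    obtain ⟨e⟩ := isoClass_eq_iff.1 h
    exact (isZero_zero C).of_iso e
  · intro h
    exact Quotient.sound ⟨h.iso (isZero_zero C)⟩

theorem isoClass_biproduct_fin : ∀ (n : ℕ) (f : Fin n → C),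
    isoClass (⨁ f) = ∑ i, isoClass (f i) := by
  intro n
  induction n with
  | zero =>
    intro f
    rw [Finset.univ_eq_empty, Finset.sum_empty, isoClass_eq_zero]
    ext i
    exact i.elim0
  | succ n ih =>
    intro f
    rw [Fin.sum_univ_succ, ← ih, ← isoClass_biprod]
    refine Quotient.sound ⟨⟨biprod.lift (biproduct.π f 0)
      (biproduct.lift fun i => biproduct.π f i.succ), biprod.desc (biproduct.ι f 0)
      (biproduct.desc fun i => biproduct.ι f i.succ), ?_, ?_⟩⟩
    · rw [biprod.lift_desc, biproduct.lift_desc, ← biproduct.total, Fin.sum_univ_succ]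
    · have h0 : ∀ i : Fin n, biproduct.ι f 0 ≫ biproduct.π f i.succ = 0 := fun i =>
        biproduct.ι_π_ne _ (Fin.succ_ne_zero i).symm
      have h1 : ∀ i : Fin n, biproduct.ι f i.succ ≫ biproduct.π f 0 = 0 := fun i =>
        biproduct.ι_π_ne _ (Fin.succ_ne_zero i)
      ext i j
      · simp
      · simp [h0]
      · simp [h1]
      · rename_i j
        by_cases h : i = j
        · subst h; simp
        · simp [biproduct.ι_π_ne _ h, biproduct.ι_π_ne f (fun h' => h (Fin.succ_injective _ h'))]

variable (C) in
/-- The type of isomorphism classes of indecomposable objects. -/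
abbrev IndecClass := {c : IsoClass C // ∃ I : C, IsIndec I ∧ isoClass I = c}

/-- The class with given multiplicities of the indecomposables. -/
noncomputable def sumClass : (IndecClass C →₀ ℕ) →+ IsoClass C :=
  Finsupp.liftAddHom fun I => (multiplesHom (IsoClass C)) I.1

theorem sumClass_single (I : IndecClass C) (n : ℕ) :
    sumClass (Finsupp.single I n) = n • I.1 := by
  simp [sumClass]

/-- The relation of being a retract, for isomorphism classes. -/
def ClassRetract (c d : IsoClass C) : Prop :=
  ∃ X Y : C, isoClass X = c ∧ isoClass Y = d ∧ IsRetract X Y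

omit [Preadditive C] [HasFiniteBiproducts C] [HasBinaryBiproducts C] in
theorem classRetract_iff {X Y : C} :
    ClassRetract (isoClass X) (isoClass Y) ↔ IsRetract X Y := by
  constructor
  · rintro ⟨X', Y', hX, hY, h⟩
    obtain ⟨e⟩ := isoClass_eq_iff.1 hX
    obtain ⟨e'⟩ := isoClass_eq_iff.1 hY
    exact ((IsRetract.of_iso e.symm).trans h).trans (IsRetract.of_iso e')
  · intro h
    exact ⟨X, Y, rfl, rfl, h⟩

variable [∀ X Y : C, Finite (X ⟶ Y)]

/-- An indecomposable retract of a biproduct is a retract of one of the summands, and between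
indecomposables a retract is an isomorphism. -/
theorem mem_support_of_classRetract (I : IndecClass C) (m : IndecClass C →₀ ℕ)
    (h : ClassRetract I.1 (sumClass m)) : I ∈ m.support := by
  obtain ⟨c, I, hI, rfl⟩ := I
  induction m using Finsupp.induction_linear with
  | zero =>
    obtain ⟨X, Y, hX, hY, i, r, hir⟩ := h
    exfalso
    rw [map_zero, isoClass_eq_zero] at hY
    obtain ⟨e⟩ := isoClass_eq_iff.1 hX
    apply (hI.of_iso e.symm).1
    rw [← hir, ← Category.comp_id i, hY]
    simp
  | add f g hf hg =>
    rw [map_add] at h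
    induction hf' : sumClass f using Quotient.inductionOn with | _ X
    induction hg' : sumClass g using Quotient.inductionOn with | _ Y
    rw [hf', hg'] at h
    rw [hf'] at hf
    rw [hg'] at hg
    rw [Finsupp.mem_support_iff, Finsupp.add_apply]
    rcases hI.isRetract_biprod (classRetract_iff.1 h) with h1 | h1
    · have := hf (classRetract_iff.2 h1)
      rw [Finsupp.mem_support_iff] at this
      omega
    · have := hg (classRetract_iff.2 h1)
      rw [Finsupp.mem_support_iff] at this
      omega
  | single J n =>
    obtain ⟨c, J, hJ, rfl⟩ := J
    rw [sumClass_single] at h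
    have key : ∀ n : ℕ, ClassRetract (isoClass I) (n • isoClass J) → n ≠ 0 ∧ Nonempty (I ≅ J) := by
      intro n
      induction n with
      | zero =>
        rintro ⟨X, Y, hX, hY, i, r, hir⟩
        exfalso
        rw [zero_smul, isoClass_eq_zero] at hY
        obtain ⟨e⟩ := isoClass_eq_iff.1 hX
        apply (hI.of_iso e.symm).1
        rw [← hir, ← Category.comp_id i, hY]
        simp
      | succ n ih =>
        intro h
        refine ⟨by omega, ?_⟩
        rw [succ_nsmul] at h
        induction hf' : n • isoClass J using Quotient.inductionOn with | _ X
        rw [hf'] at h ih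
        rcases hI.isRetract_biprod (classRetract_iff.1 h) with h1 | h1
        · exact (ih (classRetract_iff.2 h1)).2
        · exact hJ.nonempty_iso_of_isRetract hI h1
    obtain ⟨hn, ⟨e⟩⟩ := key n h
    have : (⟨isoClass I, I, hI, rfl⟩ : IndecClass C) = ⟨isoClass J, J, hJ, rfl⟩ :=
      Subtype.ext (Quotient.sound ⟨e⟩)
    rw [this, Finsupp.support_single _ hn]
    simp

theorem coprime_of_disjoint_support {X Y : C} {m m' : IndecClass C →₀ ℕ}
    (hX : isoClass X = sumClass m) (hY : isoClass Y = sumClass m')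
    (h : Disjoint m.support m'.support) : Coprime X Y := by
  intro I hI h1 h2
  exact Finset.disjoint_left.1 h
    (mem_support_of_classRetract ⟨isoClass I, I, hI, rfl⟩ _ (by
      rw [← hX]; exact classRetract_iff.2 h1))
    (mem_support_of_classRetract ⟨isoClass I, I, hI, rfl⟩ _ (by
      rw [← hY]; exact classRetract_iff.2 h2))

/-- The multiplicity is read off from |Hom(I, I^n)| = |End I|^n, as |End I| ≥ 2. -/
theorem nsmul_isoClass_injective {I : C} (hI : IsIndec I) {n n' : ℕ}
    (h : n • isoClass I = n' • isoClass I) : n = n' := by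
  have key : ∀ n : ℕ, ∀ X : C, isoClass X = n • isoClass I →
      Nat.card (I ⟶ X) = Nat.card (I ⟶ I) ^ n := by
    intro n
    induction n with
    | zero =>
      intro X hX
      rw [zero_smul, isoClass_eq_zero] at hX
      rw [pow_zero, Nat.card_eq_one_iff_unique]
      refine ⟨⟨fun f g => ?_⟩, ⟨0⟩⟩
      rw [← Category.comp_id f, ← Category.comp_id g, hX]
      simp
    | succ n ih =>
      intro X hX
      induction hf : n • isoClass I using Quotient.inductionOn with | _ Y
      rw [succ_nsmul, hf] at hX
      obtain ⟨e⟩ := isoClass_eq_iff.1 (hX.trans (isoClass_biprod Y I).symm)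
      let φ : (I ⟶ X) ≃ (I ⟶ Y) × (I ⟶ I) :=
        { toFun := fun f => (f ≫ e.hom ≫ biprod.fst, f ≫ e.hom ≫ biprod.snd)
          invFun := fun x => biprod.lift x.1 x.2 ≫ e.inv
          left_inv := fun f => by
            rw [← cancel_mono e.hom]
            ext <;> simp
          right_inv := fun x => by simp }
      rw [Nat.card_congr φ, Nat.card_prod, ih Y hf.symm, pow_succ]
  induction hX : n • isoClass I using Quotient.inductionOn with | _ X
  have h1 := (key n X hX.symm).symm.trans (key n' X (hX.symm.trans h))
  refine Nat.pow_right_injective (a := Nat.card (I ⟶ I)) ?_ h1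
  rw [Nat.succ_le_iff, Finite.one_lt_card_iff_nontrivial]
  exact ⟨𝟙 I, 0, hI.1⟩

variable [IsIdempotentComplete C]

theorem sumClass_surjective : Function.Surjective (sumClass (C := C)) := by
  intro x
  induction x using Quotient.inductionOn with | _ X
  refine biprod_induction (P := fun X : C => ∃ m, sumClass m = isoClass X) ?_ ?_ ?_ X
  · rintro X Y e ⟨m, hm⟩
    exact ⟨m, hm.trans (isoClass_eq_iff.2 ⟨e⟩)⟩
  · intro X hX
    exact ⟨0, by rw [map_zero, isoClass_eq_zero.2 hX]⟩
  · rintro I X hI ⟨m, hm⟩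
    refine ⟨Finsupp.single ⟨isoClass I, I, hI, rfl⟩ 1 + m, ?_⟩
    rw [map_add, hm, sumClass_single, one_smul]
    rfl

/-- Uniqueness in Krull–Schmidt, by peeling off the `J`-isotypic part. Two decompositions give an
isomorphism `A ⊞ N ≅ A' ⊞ N'` with `A`, `A'` powers of `J` and `N`, `N'` free of `J`; coprimality
makes its diagonal blocks isomorphisms. -/
theorem sumClass_injective : Function.Injective (sumClass (C := C)) := by
  intro m
  induction m using Finsupp.induction with
  | zero =>
    intro m' h
    rw [map_zero] at h
    symm
    rw [← Finsupp.support_eq_empty, Finset.eq_empty_iff_forall_notMem]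
    intro J hJ
    have h1 : m' = Finsupp.single J 1 + (m' - Finsupp.single J 1) := by
      rw [add_tsub_cancel_of_le]
      rw [Finsupp.single_le_iff]
      rw [Finsupp.mem_support_iff] at hJ
      omega
    rw [h1, map_add, sumClass_single, one_smul] at h
    obtain ⟨c, I, hI, rfl⟩ := J
    induction hY : sumClass (m' - Finsupp.single ⟨isoClass I, I, hI, rfl⟩ 1) using
      Quotient.inductionOn with | _ Y
    rw [hY] at h
    have h2 : isoClass (I ⊞ Y) = 0 := h.symm
    rw [isoClass_eq_zero] at h2
    apply hI.1
    have : 𝟙 I = biprod.inl ≫ 𝟙 (I ⊞ Y) ≫ biprod.fst := by simp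
    rw [this, h2]
    simp
  | single_add J n m hJ hn ih =>
    intro m' h
    have hm' := Finsupp.single_add_erase J m'
    rw [← hm'] at h
    rw [map_add, map_add, sumClass_single, sumClass_single] at h
    induction hN : sumClass m using Quotient.inductionOn with | _ N
    induction hN' : sumClass (m'.erase J) using Quotient.inductionOn with | _ N'
    induction hA : n • J.1 using Quotient.inductionOn with | _ A
    induction hA' : m' J • J.1 using Quotient.inductionOn with | _ A'
    rw [hN, hN', hA, hA'] at h
    obtain ⟨e⟩ := isoClass_eq_iff.1 ((isoClass_biprod A N).trans
      (h.trans (isoClass_biprod A' N').symm))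
    have c1 : Coprime A N' := coprime_of_disjoint_support (m := Finsupp.single J n)
      (by rw [sumClass_single, hA]) hN'.symm (by
        refine Finset.disjoint_of_subset_left Finsupp.support_single_subset ?_
        simp)
    have c2 : Coprime A' N := coprime_of_disjoint_support (m := Finsupp.single J (m' J))
      (by rw [sumClass_single, hA']) hN.symm (by
        refine Finset.disjoint_of_subset_left Finsupp.support_single_subset ?_
        simpa using hJ)
    have i1 : IsIso (biprod.inl ≫ e.hom ≫ biprod.fst) := c1.isIso_fst_fst c2 e.hom
    have i2 : IsIso (biprod.inr ≫ e.hom ≫ biprod.snd) := c1.isIso_snd_snd c2 e.hom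
    have hn' : n = m' J := by
      obtain ⟨c, I, hI, rfl⟩ := J
      apply nsmul_isoClass_injective hI
      exact hA.trans ((isoClass_eq_iff.2 ⟨asIso (biprod.inl ≫ e.hom ≫ biprod.fst)⟩).trans hA'.symm)
    have hm : m = m'.erase J := ih (hN.trans
      ((isoClass_eq_iff.2 ⟨asIso (biprod.inr ≫ e.hom ≫ biprod.snd)⟩).trans hN'.symm))
    rw [hn', hm, hm']

/-- The ratio of the numbers of endomorphisms and of automorphisms, as a function of the
isomorphism class. -/
noncomputable def classRatio : IsoClass C → ℚ :=
  Quotient.lift endAutRatio fun _ _ ⟨e⟩ => endAutRatio_congr e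

/-- Distinct indecomposables have coprime isotypic parts, so the ratio is multiplicative when these
are added one at a time. -/
theorem classRatio_sumClass (m : IndecClass C →₀ ℕ) :
    classRatio (sumClass m) = m.prod fun I n => classRatio (n • I.1) := by
  induction m using Finsupp.induction with
  | zero =>
    rw [map_zero, Finsupp.prod_zero_index]
    induction hN : (0 : IsoClass C) using Quotient.inductionOn with | _ N
    have h := isoClass_eq_zero.1 hN.symm
    have hs : ∀ f : N ⟶ N, f = 𝟙 N := fun f => by
      rw [← Category.comp_id f, h, comp_zero]
    change endAutRatio N = 1
    have : Unique (N ⟶ N) := ⟨⟨𝟙 N⟩, hs⟩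
    have : Unique {f : N ⟶ N // IsIso f} :=
      ⟨⟨𝟙 N, inferInstance⟩, fun f => Subtype.ext (Subsingleton.elim _ _)⟩
    simp [endAutRatio]
  | single_add J n m hJ hn ih =>
    have hd : Disjoint (Finsupp.single J n).support m.support := by
      refine Finset.disjoint_of_subset_left Finsupp.support_single_subset ?_
      simpa using hJ
    rw [Finsupp.prod_add_index_of_disjoint hd, ← ih, map_add, sumClass_single]
    have h1 : (Finsupp.single J n).prod (fun I n => classRatio (n • I.1)) =
        classRatio (n • J.1) := by
      rw [Finsupp.prod, Finsupp.support_single _ hn, Finset.prod_singleton]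
      simp
    rw [h1]
    induction hN : sumClass m using Quotient.inductionOn with | _ N
    induction hA : n • J.1 using Quotient.inductionOn with | _ A
    have c : Coprime A N := coprime_of_disjoint_support (m := Finsupp.single J n)
      (by rw [sumClass_single, hA]) hN.symm hd
    exact c.endAutRatio_biprod

end IsoClass

end KrullSchmidt

end

/-! ### Matrices over finite local rings -/

section

open CategoryTheory CategoryTheory.Limits

section FiniteLocalRing

theorem mul_right_isUnit_of_isUnit_mul {E : Type*} [Ring E] [Finite E] {a b : E}
    (h : IsUnit (a * b)) : IsUnit b := by
  obtain ⟨u, hu⟩ := h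
  have h1 : (↑u⁻¹ * a) * b = 1 := by rw [mul_assoc, ← hu, Units.inv_mul]
  exact IsUnit.of_mul_eq_one_right _ h1

/-- In a nontrivial finite ring all of whose elements are units or nilpotent, the Jacobson radical
consists of the nilpotent elements. -/
theorem mem_jacobson_iff_isNilpotent {E : Type*} [Ring E] [Finite E] [Nontrivial E]
    (hE : ∀ x : E, IsUnit x ∨ IsNilpotent x) (x : E) :
    x ∈ Ring.jacobson E ↔ IsNilpotent x := by
  rw [← Ideal.jacobson_bot, Ideal.mem_jacobson_iff]
  constructor
  · intro h
    refine (hE x).resolve_left ?_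
    rintro ⟨u, rfl⟩
    -- With this multiplier the criterion `z * y * x + z - 1 = 0` reads `-1 = 0`.
    obtain ⟨z, hz⟩ := h (-↑u⁻¹)
    simp at hz
  · intro h y
    have h1 : ¬ IsUnit (y * x) := fun h1 => by
      have h2 := mul_right_isUnit_of_isUnit_mul h1
      obtain ⟨n, hn⟩ := h
      have := h2.pow n
      rw [hn] at this
      exact not_isUnit_zero this
    have h2 := ((hE (y * x)).resolve_left h1).isUnit_one_add
    obtain ⟨u, hu⟩ := h2
    refine ⟨↑u⁻¹, ?_⟩
    rw [Ideal.mem_bot, sub_eq_zero, mul_assoc]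
    calc _ = ↑u⁻¹ * (1 + y * x) := by rw [mul_add, mul_one, add_comm]
      _ = 1 := by rw [← hu, Units.inv_mul]

/-- The non-units are exactly the elements of the Jacobson radical, so the quotient is a finite
domain; it is commutative by Wedderburn's theorem. -/
theorem isField_quotient_jacobson {E : Type*} [Ring E] [Finite E] [Nontrivial E]
    (hE : ∀ x : E, IsUnit x ∨ IsNilpotent x) : IsField (E ⧸ Ring.jacobson E) := by
  have : Finite (E ⧸ Ring.jacobson E) := Quotient.finite _
  have : Nontrivial (E ⧸ Ring.jacobson E) := by
    refine ⟨1, 0, fun h => ?_⟩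
    rw [← map_one (Ideal.Quotient.mk (Ring.jacobson E)), Ideal.Quotient.eq_zero_iff_mem,
      mem_jacobson_iff_isNilpotent hE] at h
    exact not_isNilpotent_one h
  have : NoZeroDivisors (E ⧸ Ring.jacobson E) := by
    refine ⟨fun {a b} hab => ?_⟩
    obtain ⟨a, rfl⟩ := Ideal.Quotient.mk_surjective a
    obtain ⟨b, rfl⟩ := Ideal.Quotient.mk_surjective b
    rw [← map_mul, Ideal.Quotient.eq_zero_iff_mem] at hab
    rw [Ideal.Quotient.eq_zero_iff_mem, Ideal.Quotient.eq_zero_iff_mem]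
    rcases hE a with ⟨u, rfl⟩ | ha
    · right
      have := Ideal.mul_mem_left (Ring.jacobson E) ↑u⁻¹ hab
      rwa [Units.inv_mul_cancel_left] at this
    · left
      exact (mem_jacobson_iff_isNilpotent hE a).2 ha
  have : IsDomain (E ⧸ Ring.jacobson E) := NoZeroDivisors.to_isDomain _
  exact Finite.isDomain_to_isField _

theorem isNilpotent_ringJacobson (E : Type*) [Ring E] [Finite E] :
    IsNilpotent (Ring.jacobson E) := by
  rw [← Ideal.jacobson_bot]
  exact IsArtinianRing.isNilpotent_jacobson_bot

/-- A matrix over a finite ring which is invertible modulo a nilpotent kernel is invertible. -/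
theorem Matrix.isUnit_map_iff_of_isNilpotent_ker {E F : Type*} [Ring E] [Finite E] [Ring F]
    {n : Type*} [Fintype n] [DecidableEq n] (π : E →+* F) (hπ : Function.Surjective π)
    (hker : IsNilpotent (RingHom.ker π)) (M : Matrix n n E) :
    IsUnit (π.mapMatrix M) ↔ IsUnit M := by
  refine ⟨fun h => ?_, fun h => h.map _⟩
  obtain ⟨N, hN⟩ := h.exists_right_inv
  have hs : Function.Surjective (π.mapMatrix : Matrix n n E →+* Matrix n n F) := fun A =>
    ⟨A.map (Function.surjInv hπ), by
      ext i j
      simp [Function.surjInv_eq hπ]⟩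
  obtain ⟨N, rfl⟩ := hs N
  -- `P` has entries in the kernel, so the entries of `P ^ k` lie in its `k`-th power. Hence `P` is
  -- nilpotent and `M * N = 1 - P` is a unit.
  set P := 1 - M * N with hP
  have hPk : ∀ k i j, (P ^ k) i j ∈ RingHom.ker π ^ k := by
    intro k
    induction k with
    | zero =>
      intro i j
      have e : RingHom.ker π ^ 0 = ⊤ := by rw [Submodule.pow_zero, Ideal.one_eq_top]
      rw [e]
      exact Submodule.mem_top
    | succ k ih =>
      intro i j
      have e : RingHom.ker π ^ (k + 1) = RingHom.ker π ^ k * RingHom.ker π := Submodule.pow_succ _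
      rw [e, pow_succ P, Matrix.mul_apply]
      refine Submodule.sum_mem _ fun l _ => Ideal.mul_mem_mul (ih i l) ?_
      have : π.mapMatrix P = 0 := by rw [hP, map_sub, map_mul, hN, map_one, sub_self]
      exact congrFun (congrFun this l) j
  obtain ⟨k, hk⟩ := hker
  have hPn : IsNilpotent P := ⟨k, by
    ext i j
    have := hPk k i j
    rw [hk] at this
    simpa using this⟩
  have h1 : IsUnit (M * N) := by
    have := hPn.isUnit_one_sub
    rwa [hP, sub_sub_cancel] at this
  obtain ⟨u, hu⟩ := h1
  -- A right inverse suffices because the matrix ring is finite.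
  exact IsUnit.of_mul_eq_one (N * (↑u⁻¹ : Matrix n n E)) (by
    rw [← mul_assoc, ← hu, Units.mul_inv])

/-- Preimages of a set under a surjective homomorphism of finite groups. -/
theorem AddMonoidHom.card_preimage_mul {A B : Type*} [AddGroup A] [AddGroup B] [Finite A]
    (f : A →+ B) (hf : Function.Surjective f) (P : B → Prop) :
    Nat.card {a // P (f a)} * Nat.card B = Nat.card {b // P b} * Nat.card A := by
  have key : ∀ Q : B → Prop, Nat.card {a // Q (f a)} = Nat.card {b // Q b} * Nat.card f.ker := by
    intro Q
    rw [← Nat.card_prod]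
    refine Nat.card_congr
      { toFun := fun a => (⟨f a.1, a.2⟩, ⟨a.1 - Function.surjInv hf (f a.1), by
          rw [AddMonoidHom.mem_ker, map_sub, Function.surjInv_eq hf, sub_self]⟩)
        invFun := fun x => ⟨x.2.1 + Function.surjInv hf x.1.1, by
          rw [map_add, Function.surjInv_eq hf, (AddMonoidHom.mem_ker).1 x.2.2, zero_add]
          exact x.1.2⟩
        left_inv := fun a => by simp
        right_inv := fun x => ?_ }
    obtain ⟨⟨b, hb⟩, ⟨a, ha⟩⟩ := x
    rw [AddMonoidHom.mem_ker] at ha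
    simp [ha, Function.surjInv_eq hf]
  have h1 := key P
  have h2 : Nat.card A = Nat.card B * Nat.card f.ker := by
    have := key fun _ => True
    rwa [Nat.card_congr (Equiv.subtypeUnivEquiv (fun _ => trivial)),
      Nat.card_congr (Equiv.subtypeUnivEquiv (fun _ => trivial))] at this
  rw [h1, h2]; ring

/-- The product `∏_{j = 1}^n (1 - x^j)⁻¹`. -/
def qPochhammerInv (x : ℚ) (n : ℕ) : ℚ := ∏ j ∈ Finset.range n, (1 - x ^ (j + 1))⁻¹

/-- Divide each factor of |GL_n(F)| = ∏_{i<n} (q^n − q^i) by q^n; reversing the order of the factors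
turns the exponents n − i into 1, …, n. -/
theorem card_matrix_div_card_units_field (F : Type*) [Field F] [Finite F] (n : ℕ) :
    (Nat.card (Matrix (Fin n) (Fin n) F) : ℚ) /
      Nat.card {M : Matrix (Fin n) (Fin n) F // IsUnit M} =
      qPochhammerInv (Nat.card F : ℚ)⁻¹ n := by
  have := Fintype.ofFinite F
  have h1 : Nat.card {M : Matrix (Fin n) (Fin n) F // IsUnit M} =
      ∏ i : Fin n, (Nat.card F ^ n - Nat.card F ^ (i : ℕ)) := by
    rw [Nat.card_eq_fintype_card (α := F), ← Matrix.card_GL_field]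
    exact Nat.card_congr
      { toFun := fun M => M.2.unit
        invFun := fun u => ⟨u, u.isUnit⟩
        left_inv := fun _ => rfl
        right_inv := fun _ => Units.ext rfl }
  have h2 : Nat.card (Matrix (Fin n) (Fin n) F) = (Nat.card F ^ n) ^ n := by
    change Nat.card (Fin n → Fin n → F) = _
    simp
  have hq : 1 < Nat.card F := Finite.one_lt_card
  rw [h1, h2, qPochhammerInv, Finset.prod_range fun j => (1 - (Nat.card F : ℚ)⁻¹ ^ (j + 1))⁻¹]
  set q := Nat.card F
  have hq0 : (q : ℚ) ≠ 0 := by positivity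
  rw [Nat.cast_prod, Nat.cast_pow]
  have h3 : ((q ^ n : ℕ) : ℚ) ^ n = ∏ _i : Fin n, (q : ℚ) ^ n := by simp
  rw [h3, ← Finset.prod_div_distrib, ← Equiv.prod_comp Fin.revPerm]
  refine Finset.prod_congr rfl fun i _ => ?_
  have h4 : (Fin.revPerm i : ℕ) = n - (i + 1) := by simp
  rw [h4, Nat.cast_sub (Nat.pow_le_pow_right (by omega) (by omega))]
  have h5 : (q : ℚ) ^ n = q ^ (n - (i + 1)) * q ^ ((i : ℕ) + 1) := by
    rw [← pow_add]; congr 1; omega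
  push_cast
  have h6 : (q : ℚ) ^ ((i : ℕ) + 1) ≠ 0 := by positivity
  have h7 : (q : ℚ) ^ (n - ((i : ℕ) + 1)) ≠ 0 := by positivity
  have h8 : (1 : ℚ) < (q : ℚ) ^ ((i : ℕ) + 1) := one_lt_pow₀ (by exact_mod_cast hq) (by omega)
  rw [h5, inv_pow]
  have h9 : (q : ℚ) ^ ((i : ℕ) + 1) - 1 ≠ 0 := by linarith
  have h10 : (q : ℚ) ^ (n - ((i : ℕ) + 1)) * q ^ ((i : ℕ) + 1) - q ^ (n - ((i : ℕ) + 1)) =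
    q ^ (n - ((i : ℕ) + 1)) * (q ^ ((i : ℕ) + 1) - 1) := by ring
  have h11 : 1 - ((q : ℚ) ^ ((i : ℕ) + 1))⁻¹ = (q ^ ((i : ℕ) + 1) - 1) / q ^ ((i : ℕ) + 1) := by
    field_simp
  rw [h10, h11, inv_div, mul_div_mul_left _ _ h7]

/-- Reduction modulo the Jacobson radical has fibres of constant size on matrices and detects
invertibility, so the ratio can be computed over the residue field. -/
theorem card_matrix_div_card_units {E : Type*} [Ring E] [Finite E] [Nontrivial E]
    (hE : ∀ x : E, IsUnit x ∨ IsNilpotent x) (n : ℕ) :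
    (Nat.card (Matrix (Fin n) (Fin n) E) : ℚ) /
      Nat.card {M : Matrix (Fin n) (Fin n) E // IsUnit M} =
      qPochhammerInv (Nat.card (E ⧸ Ring.jacobson E) : ℚ)⁻¹ n := by
  let : Field (E ⧸ Ring.jacobson E) := (isField_quotient_jacobson hE).toField
  have : Finite (E ⧸ Ring.jacobson E) := Quotient.finite _
  rw [← card_matrix_div_card_units_field]
  have h1 := AddMonoidHom.card_preimage_mul
    ((Ideal.Quotient.mk (Ring.jacobson E)).mapMatrix (m := Fin n)).toAddMonoidHom (fun A =>
      ⟨A.map (Function.surjInv Ideal.Quotient.mk_surjective), by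
        ext i j
        simp [Function.surjInv_eq Ideal.Quotient.mk_surjective]⟩) (fun M => IsUnit M)
  have h2 : ∀ M : Matrix (Fin n) (Fin n) E,
      IsUnit (((Ideal.Quotient.mk (Ring.jacobson E)).mapMatrix (m := Fin n)).toAddMonoidHom M) ↔
        IsUnit M := fun M =>
    Matrix.isUnit_map_iff_of_isNilpotent_ker _ Ideal.Quotient.mk_surjective (by
      rw [Ideal.mk_ker]; exact isNilpotent_ringJacobson E) M
  rw [Nat.card_congr (Equiv.subtypeEquivRight h2)] at h1
  have h3 : 0 < Nat.card {M : Matrix (Fin n) (Fin n) E // IsUnit M} := by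
    have : Nonempty {M : Matrix (Fin n) (Fin n) E // IsUnit M} := ⟨⟨1, isUnit_one⟩⟩
    exact Nat.card_pos
  have h4 : 0 < Nat.card {M : Matrix (Fin n) (Fin n) (E ⧸ Ring.jacobson E) // IsUnit M} := by
    have : Nonempty {M : Matrix (Fin n) (Fin n) (E ⧸ Ring.jacobson E) // IsUnit M} :=
      ⟨⟨1, isUnit_one⟩⟩
    exact Nat.card_pos
  rw [div_eq_div_iff (by positivity) (by positivity)]
  have h5 := congrArg (Nat.cast (R := ℚ)) h1
  push_cast at h5
  linarith

end FiniteLocalRing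

namespace KrullSchmidt

variable {C : Type*} [Category C] [Preadditive C]

theorem IsIndec.nontrivial {X : C} (h : IsIndec X) : Nontrivial (End X) := ⟨𝟙 X, 0, h.1⟩

theorem IsIndec.isUnit_or_isNilpotent [∀ X Y : C, Finite (X ⟶ Y)] {X : C} (h : IsIndec X)
    (x : End X) : IsUnit x ∨ IsNilpotent x :=
  (h.isIso_or_isNilpotent x).imp_left fun h => (isUnit_iff_isIso _).2 h

variable [HasFiniteBiproducts C]

/-- Endomorphisms of `X^n` as matrices. -/
noncomputable def endBiproductEquiv (X : C) (n : ℕ) :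
    End (⨁ fun _ : Fin n => X) ≃+* (Matrix (Fin n) (Fin n) (End X)) where
  -- The indices are transposed because multiplication in `End` is composition in the reverse of
  -- diagrammatic order.
  toFun f := Matrix.of fun i j => biproduct.components f j i
  invFun M := biproduct.matrix fun i j => M j i
  left_inv f := biproduct.components_matrix f
  right_inv M := by
    ext i j
    exact biproduct.matrix_components _ _ _
  map_add' f g := by
    ext i j
    exact (congrArg (fun z => biproduct.ι (fun _ : Fin n => X) j ≫ z)
      (Preadditive.add_comp _ _ _ f g (biproduct.π (fun _ : Fin n => X) i))).trans
      (Preadditive.comp_add _ _ _ _ _ _)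
  map_mul' f g := by
    ext i j
    change biproduct.ι (fun _ : Fin n => X) j ≫ (g ≫ f) ≫ biproduct.π (fun _ : Fin n => X) i =
      Finset.univ.sum fun l =>
        (biproduct.ι (fun _ : Fin n => X) j ≫ g ≫ biproduct.π (fun _ : Fin n => X) l) ≫
          (biproduct.ι (fun _ : Fin n => X) l ≫ f ≫ biproduct.π (fun _ : Fin n => X) i)
    have h : (g ≫ f : (⨁ fun _ : Fin n => X) ⟶ _) =
        ∑ l, g ≫ biproduct.π (fun _ : Fin n => X) l ≫ biproduct.ι (fun _ : Fin n => X) l ≫ f := by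
      rw [← Preadditive.comp_sum]
      simp_rw [← Category.assoc]
      rw [← Preadditive.sum_comp, biproduct.total, Category.id_comp]
    rw [h, Preadditive.sum_comp, Preadditive.comp_sum]
    simp only [Category.assoc]

variable [HasBinaryBiproducts C] [∀ X Y : C, Finite (X ⟶ Y)]

theorem IsIndec.classRatio_nsmul {X : C} (h : IsIndec X) (n : ℕ) :
    classRatio (n • isoClass X) =
      qPochhammerInv (Nat.card (End X ⧸ Ring.jacobson (End X)) : ℚ)⁻¹ n := by
  have := h.nontrivial
  rw [← card_matrix_div_card_units h.isUnit_or_isNilpotent]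
  have h1 : n • isoClass X = isoClass (⨁ fun _ : Fin n => X) := by
    rw [isoClass_biproduct_fin]; simp
  rw [h1]
  change endAutRatio _ = _
  rw [endAutRatio]
  congr 2
  · exact Nat.card_congr (endBiproductEquiv X n).toEquiv
  · refine Nat.card_congr ((endBiproductEquiv X n).toEquiv.subtypeEquiv fun f => ?_)
    rw [← isUnit_iff_isIso]
    exact (MulEquiv.isUnit_map (endBiproductEquiv X n)).symm

end KrullSchmidt

end

/-! ### Euler's q-series and weighted counts of multisets -/

section

theorem qPochhammerInv_zero (x : ℚ) : qPochhammerInv x 0 = 1 := by simp [qPochhammerInv]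

theorem qPochhammerInv_succ_mul {x : ℚ} {n : ℕ} (hx : x ^ (n + 1) ≠ 1) :
    qPochhammerInv x (n + 1) * (1 - x ^ (n + 1)) = qPochhammerInv x n := by
  have : 1 - x ^ (n + 1) ≠ 0 := sub_ne_zero.2 hx.symm
  rw [qPochhammerInv, qPochhammerInv, Finset.prod_range_succ, mul_assoc, inv_mul_cancel₀ this,
    mul_one]

/-- Writing P_n for `qPochhammerInv x n`, the sum telescopes: x^(n+1) P_(n+1) = P_(n+1) − P_n. -/
theorem sum_pow_mul_qPochhammerInv {x : ℚ} (hx : ∀ n, x ^ (n + 1) ≠ 1) (n : ℕ) :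
    ∑ i ∈ Finset.range (n + 1), x ^ i * qPochhammerInv x i = qPochhammerInv x n := by
  induction n with
  | zero => simp
  | succ n ih =>
    rw [Finset.sum_range_succ, ih, ← qPochhammerInv_succ_mul (hx n)]
    ring

/-- The logarithmic derivative of `∑ n, qPochhammerInv x n * t ^ n`. -/
theorem nat_mul_qPochhammerInv {x : ℚ} (hx : ∀ n, x ^ (n + 1) ≠ 1) (n : ℕ) :
    n * qPochhammerInv x n =
      ∑ j ∈ Finset.range n, (1 - x ^ (j + 1))⁻¹ * qPochhammerInv x (n - (j + 1)) := by
  induction n with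
  | zero => simp
  | succ n ih =>
    have h0 : ∀ n, 1 - x ^ (n + 1) ≠ 0 := fun n => sub_ne_zero.2 (hx n).symm
    -- This rests on 1 − x^(n+1) = (1 − x^(n−j)) + x^(n−j)(1 − x^(j+1)). The first part lowers the
    -- index of the product by one; the second cancels the inverse factor.
    have key : ∀ j ∈ Finset.range n,
        (1 - x ^ (n + 1)) * ((1 - x ^ (j + 1))⁻¹ * qPochhammerInv x (n + 1 - (j + 1))) =
        (1 - x ^ (j + 1))⁻¹ * qPochhammerInv x (n - (j + 1)) +
          x ^ (n - j) * qPochhammerInv x (n - j) := by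
      intro j hj
      rw [Finset.mem_range] at hj
      obtain ⟨c, rfl⟩ := Nat.exists_eq_add_of_lt hj
      rw [show j + c + 1 + 1 - (j + 1) = c + 1 by omega, show j + c + 1 - (j + 1) = c by omega,
        show j + c + 1 - j = c + 1 by omega, ← qPochhammerInv_succ_mul (hx c)]
      have := h0 j
      field_simp
      ring
    have h1 : (1 - x ^ (n + 1)) * ∑ j ∈ Finset.range (n + 1),
        (1 - x ^ (j + 1))⁻¹ * qPochhammerInv x (n + 1 - (j + 1)) =
        (n + 1) * qPochhammerInv x n := by
      rw [Finset.sum_range_succ, mul_add, Finset.mul_sum, Finset.sum_congr rfl key,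
        Finset.sum_add_distrib, ← ih, Nat.sub_self, ← mul_assoc, mul_inv_cancel₀ (h0 n)]
      -- The summand `j = n`, split off above, provides the constant term missing from the
      -- telescoping sum.
      have h2 := sum_pow_mul_qPochhammerInv hx n
      rw [Finset.sum_range_succ', ← Finset.sum_range_reflect] at h2
      have h3 : ∀ j ∈ Finset.range n, x ^ (n - 1 - j + 1) * qPochhammerInv x (n - 1 - j + 1) =
          x ^ (n - j) * qPochhammerInv x (n - j) := by
        intro j hj
        rw [Finset.mem_range] at hj
        rw [show n - 1 - j + 1 = n - j by omega]
      rw [Finset.sum_congr rfl h3, pow_zero] at h2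
      linarith
    rw [← qPochhammerInv_succ_mul (hx n), mul_comm] at h1
    apply mul_right_cancel₀ (h0 n)
    rw [Nat.cast_succ, mul_assoc]
    exact h1.symm

namespace GradedMultiset

variable {V : Type*} {ι : Type*} (ρ : ι → (V →₀ ℕ))

/-- The total rank of a multiset of ranked elements. -/
noncomputable def totalRank : (ι →₀ ℕ) →+ (V →₀ ℕ) :=
  Finsupp.liftAddHom fun I => (multiplesHom (V →₀ ℕ)) (ρ I)

theorem totalRank_single (I : ι) (n : ℕ) : totalRank ρ (Finsupp.single I n) = n • ρ I := by
  simp [totalRank]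

theorem totalRank_eq_sum (m : ι →₀ ℕ) : totalRank ρ m = ∑ I ∈ m.support, m I • ρ I := by
  simp [totalRank, Finsupp.sum]

variable {ρ}

theorem smul_le_totalRank (m : ι →₀ ℕ) (I : ι) : m I • ρ I ≤ totalRank ρ m := by
  classical
  by_cases hI : I ∈ m.support
  · rw [totalRank_eq_sum]
    exact Finset.single_le_sum (f := fun I => m I • ρ I) (fun _ _ => zero_le) hI
  · rw [Finsupp.notMem_support_iff] at hI
    simp [hI]

theorem degree_pos (hρ : ∀ I, ρ I ≠ 0) (I : ι) : 0 < (ρ I).degree := by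
  rw [Nat.pos_iff_ne_zero, Ne, Finsupp.degree_eq_zero_iff]
  exact hρ I

/-- Each element has degree at least one, so no multiplicity exceeds the total degree. This bound
makes the sums below finite. -/
theorem le_degree_totalRank (hρ : ∀ I, ρ I ≠ 0) (m : ι →₀ ℕ) (I : ι) :
    m I ≤ (totalRank ρ m).degree := by
  have h1 := Finsupp.degree_mono (smul_le_totalRank (ρ := ρ) m I)
  rw [map_nsmul, smul_eq_mul] at h1
  have := degree_pos hρ I
  nlinarith

theorem le_totalRank_of_mem_support {m : ι →₀ ℕ} {I : ι} (h : I ∈ m.support) :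
    ρ I ≤ totalRank ρ m := by
  refine le_trans ?_ (smul_le_totalRank m I)
  rw [Finsupp.mem_support_iff] at h
  exact le_self_nsmul zero_le (by omega)

theorem finite_setOf_le [Finite V] (hfin : ∀ r, {I | ρ I = r}.Finite) (r : V →₀ ℕ) :
    {I | ρ I ≤ r}.Finite := by
  classical
  have : {I | ρ I ≤ r} = ⋃ s ∈ Set.Iic r, {I | ρ I = s} := by
    ext I; simp
  rw [this]
  exact (Set.finite_Iic r).biUnion fun s _ => hfin s

/-- Such multisets are supported on the finitely many elements of rank at most `r`, with
multiplicities bounded by the degree of `r`. -/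
theorem finite_setOf_totalRank [Finite V] (hρ : ∀ I, ρ I ≠ 0) (hfin : ∀ r, {I | ρ I = r}.Finite)
    (r : V →₀ ℕ) : {m | totalRank ρ m = r}.Finite := by
  classical
  let S := (finite_setOf_le hfin r).toFinset
  refine Set.Finite.subset (Set.finite_Iic (∑ I ∈ S, Finsupp.single I r.degree)) ?_
  rintro m rfl
  rw [Set.mem_Iic]
  intro I
  by_cases hI : I ∈ m.support
  · have hIS : I ∈ S := by
      simp only [S, Set.Finite.mem_toFinset, Set.mem_ofPred_eq]
      exact le_totalRank_of_mem_support hI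
    rw [Finsupp.finsetSum_apply]
    calc m I ≤ (totalRank ρ m).degree := le_degree_totalRank hρ m I
      _ = Finsupp.single I (totalRank ρ m).degree I := by simp
      _ ≤ _ := Finset.single_le_sum (f := fun J => Finsupp.single J (totalRank ρ m).degree I)
        (fun _ _ => zero_le) hIS
  · rw [Finsupp.notMem_support_iff] at hI
    rw [hI]; exact zero_le

variable (ρ) in
/-- The weighted count of multisets of total rank `r`. -/
noncomputable def weightedCount (x : ι → ℚ) (r : V →₀ ℕ) : ℚ :=
  ∑ᶠ m ∈ {m | totalRank ρ m = r}, m.prod fun I n => qPochhammerInv (x I) n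

theorem weightedCount_zero (hρ : ∀ I, ρ I ≠ 0) (x : ι → ℚ) : weightedCount ρ x 0 = 1 := by
  have : {m | totalRank ρ m = 0} = {0} := by
    ext m
    simp only [Set.mem_ofPred_eq, Set.mem_singleton_iff]
    constructor
    · intro h
      ext I
      have := le_degree_totalRank hρ m I
      rw [h] at this
      simpa using this
    · rintro rfl; simp
  rw [weightedCount, this, finsum_mem_singleton, Finsupp.prod_zero_index]

theorem prod_qPochhammerInv_eq (x : ι → ℚ) (m : ι →₀ ℕ) (I : ι) :
    (m.prod fun I n => qPochhammerInv (x I) n) =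
      qPochhammerInv (x I) (m I) * (m.erase I).prod fun I n => qPochhammerInv (x I) n :=
  (Finsupp.mul_prod_erase' m I (fun I n => qPochhammerInv (x I) n) fun _ =>
    qPochhammerInv_zero _).symm

/-- The one-variable logarithmic derivative, applied to the factor of `I` alone; the `j`-th term
corresponds to removing `j + 1` copies of `I`. -/
theorem mul_prod_qPochhammerInv {x : ι → ℚ} (hx : ∀ I n, x I ^ (n + 1) ≠ 1) (m : ι →₀ ℕ) (I : ι) :
    m I * (m.prod fun I n => qPochhammerInv (x I) n) =
      ∑ j ∈ Finset.range (m I), (1 - x I ^ (j + 1))⁻¹ *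
        (m - Finsupp.single I (j + 1)).prod fun I n => qPochhammerInv (x I) n := by
  classical
  rw [prod_qPochhammerInv_eq x m I, ← mul_assoc, nat_mul_qPochhammerInv (hx I), Finset.sum_mul]
  refine Finset.sum_congr rfl fun j _ => ?_
  rw [prod_qPochhammerInv_eq x (m - Finsupp.single I (j + 1)) I, mul_assoc]
  have h1 : (m - Finsupp.single I (j + 1)) I = m I - (j + 1) := by
    rw [Finsupp.tsub_apply, Finsupp.single_eq_same]
  have h2 : (m - Finsupp.single I (j + 1)).erase I = m.erase I := by
    ext J
    by_cases h : J = I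
    · subst h; simp
    · rw [Finsupp.erase_ne h, Finsupp.erase_ne h, Finsupp.tsub_apply,
        Finsupp.single_eq_of_ne h, tsub_zero]
  rw [h1, h2]

/-- Removing `j + 1` copies of `I` is a bijection from the multisets of total rank `r` with more
than `j` copies of `I` to those of total rank `r - (j + 1) • ρ I`. The range `r.degree` bounds all
multiplicities uniformly. -/
theorem sum_mul_prod_qPochhammerInv [Finite V] (hρ : ∀ I, ρ I ≠ 0)
    (hfin : ∀ r, {I | ρ I = r}.Finite)
    {x : ι → ℚ} (hx : ∀ I n, x I ^ (n + 1) ≠ 1) (r : V →₀ ℕ) (I : ι) :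
    ∑ m ∈ (finite_setOf_totalRank hρ hfin r).toFinset,
      m I * (m.prod fun I n => qPochhammerInv (x I) n) =
    ∑ j ∈ Finset.range r.degree, (1 - x I ^ (j + 1))⁻¹ *
      if (j + 1) • ρ I ≤ r then weightedCount ρ x (r - (j + 1) • ρ I) else 0 := by
  classical
  have h1 : ∀ m ∈ (finite_setOf_totalRank hρ hfin r).toFinset,
      m I * (m.prod fun I n => qPochhammerInv (x I) n) =
      ∑ j ∈ Finset.range r.degree, if j < m I then (1 - x I ^ (j + 1))⁻¹ *
        (m - Finsupp.single I (j + 1)).prod fun I n => qPochhammerInv (x I) n else 0 := by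
    intro m hm
    simp only [Set.Finite.mem_toFinset, Set.mem_ofPred_eq] at hm
    subst hm
    rw [mul_prod_qPochhammerInv hx, ← Finset.sum_filter]
    refine Finset.sum_congr ?_ fun _ _ => rfl
    ext j
    have := le_degree_totalRank hρ m I
    simp only [Finset.mem_range, Finset.mem_filter]
    omega
  rw [Finset.sum_congr rfl h1, Finset.sum_comm]
  refine Finset.sum_congr rfl fun j _ => ?_
  rw [← Finset.sum_filter, ← Finset.mul_sum]
  congr 1
  split_ifs with hle
  · rw [weightedCount, finsum_mem_eq_finite_toFinset_sum _ (finite_setOf_totalRank hρ hfin _)]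
    refine Finset.sum_nbij' (fun m => m - Finsupp.single I (j + 1))
      (fun m => m + Finsupp.single I (j + 1)) ?_ ?_ ?_ ?_ ?_
    · intro m hm
      simp only [Finset.mem_filter, Set.Finite.mem_toFinset, Set.mem_ofPred_eq] at hm ⊢
      have h2 : Finsupp.single I (j + 1) ≤ m := by
        rw [Finsupp.single_le_iff]; omega
      rw [← hm.1, ← totalRank_single ρ I (j + 1)]
      conv_rhs => rw [← tsub_add_cancel_of_le h2]
      rw [map_add, add_tsub_cancel_right]
    · intro m hm
      simp only [Finset.mem_filter, Set.Finite.mem_toFinset, Set.mem_ofPred_eq] at hm ⊢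
      refine ⟨?_, by rw [Finsupp.add_apply, Finsupp.single_eq_same]; omega⟩
      rw [map_add, totalRank_single, hm, tsub_add_cancel_of_le hle]
    · intro m hm
      simp only [Finset.mem_filter] at hm
      apply tsub_add_cancel_of_le
      rw [Finsupp.single_le_iff]; omega
    · intro m _
      exact add_tsub_cancel_right _ _
    · intro m _
      rfl
  · refine Finset.sum_eq_zero fun m hm => ?_
    exfalso
    simp only [Finset.mem_filter, Set.Finite.mem_toFinset, Set.mem_ofPred_eq] at hm
    apply hle
    rw [← hm.1]
    exact le_trans (nsmul_le_nsmul_left zero_le (by omega)) (smul_le_totalRank m I)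

/-- The recursion satisfied by the weighted count of multisets. -/
theorem degree_mul_weightedCount [Finite V] [DecidableEq V] (hρ : ∀ I, ρ I ≠ 0)
    (hfin : ∀ r, {I | ρ I = r}.Finite)
    {x : ι → ℚ} (hx : ∀ I n, x I ^ (n + 1) ≠ 1) (r : V →₀ ℕ) :
    r.degree * weightedCount ρ x r = ∑ p ∈ Finset.HasAntidiagonal.antidiagonal r,
      (∑ j ∈ Finset.range p.1.degree, ∑ᶠ I ∈ {I | (j + 1) • ρ I = p.1},
        (ρ I).degree * (1 - x I ^ (j + 1))⁻¹) * weightedCount ρ x p.2 := by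
  classical
  set S := (finite_setOf_le hfin r).toFinset with hS
  have h1 : ∀ m ∈ (finite_setOf_totalRank hρ hfin r).toFinset,
      r.degree * (m.prod fun I n => qPochhammerInv (x I) n) =
      ∑ I ∈ S, (ρ I).degree * (m I * m.prod fun I n => qPochhammerInv (x I) n) := by
    intro m hm
    simp only [Set.Finite.mem_toFinset, Set.mem_ofPred_eq] at hm
    -- The degree of the total rank distributes over the elements of the multiset, which reduces the
    -- recursion to one element at a time.
    have h2 : r.degree = ∑ I ∈ S, (ρ I).degree * m I := by
      rw [← hm, totalRank_eq_sum, map_sum]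
      simp only [map_nsmul, smul_eq_mul]
      simp_rw [mul_comm (m _)]
      refine Finset.sum_subset ?_ ?_
      · intro I hI
        simp only [hS, Set.Finite.mem_toFinset, Set.mem_ofPred_eq]
        rw [← hm]
        exact le_totalRank_of_mem_support hI
      · intro I _ hI
        rw [Finsupp.notMem_support_iff] at hI
        rw [hI, mul_zero]
    rw [h2]
    push_cast
    rw [Finset.sum_mul]
    simp_rw [mul_assoc]
  -- The index ranges are enlarged to ones independent of `p`; the added indices never satisfy `(j +
  -- 1) • ρ I = p.1`.
  have h3 : ∀ p ∈ Finset.HasAntidiagonal.antidiagonal r,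
      (∑ j ∈ Finset.range p.1.degree, ∑ᶠ I ∈ {I | (j + 1) • ρ I = p.1},
        (ρ I).degree * (1 - x I ^ (j + 1))⁻¹) * weightedCount ρ x p.2 =
      ∑ I ∈ S, ∑ j ∈ Finset.range r.degree, if (j + 1) • ρ I = p.1 then
        (ρ I).degree * (1 - x I ^ (j + 1))⁻¹ * weightedCount ρ x p.2 else 0 := by
    intro p hp
    rw [Finset.HasAntidiagonal.mem_antidiagonal] at hp
    have hle : p.1 ≤ r := by rw [← hp]; exact le_self_add
    rw [Finset.sum_comm, Finset.sum_mul]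
    refine (Finset.sum_congr rfl fun j _ => ?_).trans (Finset.sum_subset (fun j hj => ?_) ?_)
    · have h4 : {I | (j + 1) • ρ I = p.1} = ↑(S.filter fun I => (j + 1) • ρ I = p.1) := by
        ext I
        simp only [hS, Set.mem_ofPred_eq, Finset.coe_filter, Set.Finite.mem_toFinset]
        refine ⟨fun h => ⟨?_, h⟩, fun h => h.2⟩
        refine le_trans ?_ hle
        rw [← h]
        exact le_self_nsmul zero_le (by omega)
      rw [h4, finsum_mem_coe_finset, Finset.sum_mul, Finset.sum_filter]
    · have := Finsupp.degree_mono hle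
      rw [Finset.mem_range] at hj ⊢
      omega
    · intro j _ hj
      refine Finset.sum_eq_zero fun I _ => if_neg fun h => hj ?_
      rw [Finset.mem_range, ← h, map_nsmul, smul_eq_mul]
      have := degree_pos hρ I
      nlinarith
  rw [Finset.sum_congr rfl h3, Finset.sum_comm]
  conv_lhs =>
    rw [weightedCount, finsum_mem_eq_finite_toFinset_sum _ (finite_setOf_totalRank hρ hfin _),
      Finset.mul_sum, Finset.sum_congr rfl h1, Finset.sum_comm]
  refine Finset.sum_congr rfl fun I _ => ?_
  rw [← Finset.mul_sum, sum_mul_prod_qPochhammerInv hρ hfin hx, Finset.mul_sum, Finset.sum_comm]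
  refine Finset.sum_congr rfl fun j _ => ?_
  split_ifs with hle
  · rw [Finset.sum_eq_single ((j + 1) • ρ I, r - (j + 1) • ρ I), if_pos rfl, mul_assoc]
    · rintro ⟨a, b⟩ hp hne
      rw [if_neg]
      rintro rfl
      rw [Finset.HasAntidiagonal.mem_antidiagonal] at hp
      apply hne
      rw [← hp]
      simp
    · intro h
      exfalso
      apply h
      rw [Finset.HasAntidiagonal.mem_antidiagonal, add_tsub_cancel_of_le hle]
  · rw [mul_zero, mul_zero]
    symm
    refine Finset.sum_eq_zero fun p hp => if_neg fun h => hle ?_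
    rw [Finset.HasAntidiagonal.mem_antidiagonal] at hp
    rw [h, ← hp]
    exact le_self_add

end GradedMultiset

end

/-! ### Exponentials of power series through their differential equation -/

section

namespace MvPowerSeries

variable {V S : Type*} [CommRing S]

/-- The Euler derivation `∑ i, t_i ∂/∂t_i`. -/
noncomputable def euler (f : MvPowerSeries V S) : MvPowerSeries V S := fun r => (r.degree : S) * coeff r f

theorem coeff_euler (f : MvPowerSeries V S) (r : V →₀ ℕ) :
    coeff r (euler f) = (r.degree : S) * coeff r f := rfl

theorem euler_mul (f g : MvPowerSeries V S) : euler (f * g) = euler f * g + f * euler g := by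
  classical
  ext r
  rw [coeff_euler, map_add, coeff_mul, coeff_mul, coeff_mul, Finset.mul_sum,
    ← Finset.sum_add_distrib]
  refine Finset.sum_congr rfl fun p hp => ?_
  rw [Finset.HasAntidiagonal.mem_antidiagonal] at hp
  rw [coeff_euler, coeff_euler, ← hp, map_add, Nat.cast_add]
  ring

theorem euler_pow_succ (f : MvPowerSeries V S) (d : ℕ) :
    euler (f ^ (d + 1)) = (d + 1 : ℕ) • (euler f * f ^ d) := by
  induction d with
  | zero => simp
  | succ d ih =>
    rw [pow_succ, euler_mul, ih, succ_nsmul _ (d + 1), smul_mul_assoc]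
    congr 1
    · rw [pow_succ]; ring_nf
    · ring

variable [Algebra ℚ S]

/-- Since `g` has no constant term, `g ^ d` starts in degree `d`, so any truncation beyond the
degree of `r` computes the coefficient. -/
theorem coeff_subst_exp {g : MvPowerSeries V S} (hg : constantCoeff g = 0) (r : V →₀ ℕ) {N : ℕ}
    (hN : r.degree < N) : coeff r (PowerSeries.subst g (PowerSeries.exp ℚ)) =
      ∑ d ∈ Finset.range N, (1 / (d.factorial : ℚ)) • coeff r (g ^ d) := by
  rw [PowerSeries.coeff_subst (PowerSeries.HasSubst.of_constantCoeff_zero hg),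
    finsum_eq_sum_of_support_subset (s := Finset.range N)]
  · simp [PowerSeries.coeff_exp]
  · intro d hd
    rw [Finset.coe_range, Set.mem_Iio]
    by_contra h
    apply hd
    simp only
    rw [coeff_eq_zero_of_constantCoeff_nilpotent (m := 1) (by rw [hg, pow_one]) (by omega),
      smul_zero]

/-- The exponential of a power series satisfies the differential equation of the exponential. -/
theorem degree_mul_coeff_subst_exp [DecidableEq V] {g : MvPowerSeries V S}
    (hg : constantCoeff g = 0) (r : V →₀ ℕ) :
    (r.degree : S) * coeff r (PowerSeries.subst g (PowerSeries.exp ℚ)) =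
      ∑ p ∈ Finset.HasAntidiagonal.antidiagonal r, ((p.1.degree : S) * coeff p.1 g) *
        coeff p.2 (PowerSeries.subst g (PowerSeries.exp ℚ)) := by
  -- One extra term is kept: differentiation lowers the power of `g` by one, and the remaining
  -- `r.degree + 1` terms must still suffice for `exp`.
  rw [coeff_subst_exp hg r (N := r.degree + 1 + 1) (by omega), Finset.sum_range_succ']
  have h0 : (r.degree : S) * ((1 / ((Nat.factorial 0 : ℕ) : ℚ)) • coeff r (g ^ 0)) = 0 := by
    classical
    rw [pow_zero, coeff_one]
    split_ifs with h
    · subst h; simp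
    · simp
  rw [mul_add, h0, add_zero, Finset.mul_sum]
  have h1 : ∀ d ∈ Finset.range (r.degree + 1),
      (r.degree : S) * ((1 / ((d + 1).factorial : ℚ)) • coeff r (g ^ (d + 1))) =
      ∑ p ∈ Finset.HasAntidiagonal.antidiagonal r, ((p.1.degree : S) * coeff p.1 g) *
        ((1 / (d.factorial : ℚ)) • coeff p.2 (g ^ d)) := by
    intro d _
    rw [mul_smul_comm, ← coeff_euler, euler_pow_succ, map_nsmul, coeff_mul,
      ← Nat.cast_smul_eq_nsmul ℚ, smul_smul, Finset.smul_sum]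
    refine Finset.sum_congr rfl fun p _ => ?_
    rw [coeff_euler, mul_smul_comm]
    congr 1
    rw [Nat.factorial_succ]
    have : (d.factorial : ℚ) ≠ 0 := by positivity
    push_cast
    field_simp
  rw [Finset.sum_congr rfl h1, Finset.sum_comm]
  refine Finset.sum_congr rfl fun p hp => ?_
  rw [← Finset.mul_sum]
  congr 1
  rw [Finset.HasAntidiagonal.mem_antidiagonal] at hp
  have : p.2.degree < r.degree + 1 := by
    rw [← hp, map_add]; omega
  rw [coeff_subst_exp hg p.2 this]

theorem coeff_zero_subst_exp {g : MvPowerSeries V S} (hg : constantCoeff g = 0) :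
    coeff 0 (PowerSeries.subst g (PowerSeries.exp ℚ)) = 1 := by
  rw [coeff_subst_exp hg 0 (N := 1) (by simp)]
  simp

end MvPowerSeries

/-- Uniqueness of the solution of the differential equation of the exponential. -/
theorem eq_of_degree_mul_eq_sum {V : Type*} [DecidableEq V] {f h G : (V →₀ ℕ) → ℚ}
    (hG : G 0 = 0) (h0 : f 0 = h 0)
    (hf : ∀ r, (r.degree : ℚ) * f r =
      ∑ p ∈ Finset.HasAntidiagonal.antidiagonal r, G p.1 * f p.2)
    (hh : ∀ r, (r.degree : ℚ) * h r =
      ∑ p ∈ Finset.HasAntidiagonal.antidiagonal r, G p.1 * h p.2) (r : V →₀ ℕ) : f r = h r := by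
  induction hn : r.degree using Nat.strong_induction_on generalizing r with
  | _ n ih =>
  subst hn
  by_cases hr : r = 0
  · rw [hr, h0]
  have hd : (r.degree : ℚ) ≠ 0 := by
    rw [Nat.cast_ne_zero, Ne, Finsupp.degree_eq_zero_iff]
    exact hr
  apply mul_left_cancel₀ hd
  rw [hf, hh]
  refine Finset.sum_congr rfl fun p hp => ?_
  rw [Finset.HasAntidiagonal.mem_antidiagonal] at hp
  -- As `G 0 = 0`, only pairs whose second component has smaller degree contribute.
  by_cases hp1 : p.1 = 0
  · rw [hp1, hG, zero_mul, zero_mul]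
  · rw [ih p.2.degree _ p.2 rfl]
    have : p.1.degree ≠ 0 := by rwa [Ne, Finsupp.degree_eq_zero_iff]
    rw [← hp, map_add]
    omega

/-- The coefficients of the exponent in the plethystic exponential. -/
theorem coeff_adamsSeries_sum {V : Type*} (f : MvPowerSeries V CountingFn)
    (hf : MvPowerSeries.constantCoeff f = 0) (r : V →₀ ℕ) (n : ℕ+) :
    (∑ᶠ m : ℕ+, (m : ℚ)⁻¹ • MvPowerSeries.coeff r (adamsSeries m f)) n =
      ∑ j ∈ Finset.range r.degree, ∑ᶠ s ∈ {s | (j + 1) • s = r},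
        ((j : ℚ) + 1)⁻¹ * MvPowerSeries.coeff s f (j.succPNat * n) := by
  classical
  have h1 : ∀ m : ℕ+, ∀ s, (m : ℕ) • s = r → MvPowerSeries.coeff r (adamsSeries m f) n =
      MvPowerSeries.coeff s f (m * n) := by
    rintro m s rfl
    rw [adamsSeries, MvPowerSeries.coeff_expand_smul]
    rfl
  have h2 : ∀ m : ℕ+, (¬ ∃ s, (m : ℕ) • s = r) →
      MvPowerSeries.coeff r (adamsSeries m f) = 0 := by
    intro m h
    have : ∃ i, ¬ (m : ℕ) ∣ r i := by
      by_contra! h'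
      choose c hc using h'
      apply h
      refine ⟨Finsupp.onFinset r.support c fun i hi => ?_, ?_⟩
      · rw [Finsupp.mem_support_iff, hc i]
        exact mul_ne_zero m.ne_zero hi
      · ext i
        rw [Finsupp.smul_apply, Finsupp.onFinset_apply, smul_eq_mul, ← hc i]
    obtain ⟨i, hi⟩ := this
    exact MvPowerSeries.coeff_expand_of_not_dvd _ _ _ hi
  have h3 : ∀ m : ℕ+, r.degree < m → MvPowerSeries.coeff r (adamsSeries m f) = 0 := by
    intro m hm
    by_cases h : ∃ s, (m : ℕ) • s = r
    · obtain ⟨s, hs⟩ := h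
      -- Beyond the degree of `r` only `s = 0` could contribute, and there `f` vanishes. This makes
      -- the infinite sum finite, also for `r = 0`.
      have : s = 0 := by
        rw [← Finsupp.degree_eq_zero_iff]
        rw [← hs, map_nsmul, smul_eq_mul] at hm
        by_contra h0
        have : 0 < s.degree := by omega
        nlinarith
      subst this
      funext k
      rw [← hs, adamsSeries, MvPowerSeries.coeff_expand_smul]
      change MvPowerSeries.coeff 0 f (m * k) = 0
      rw [MvPowerSeries.coeff_zero_eq_constantCoeff_apply, hf]
      rfl
    · exact h2 m h
  rw [finsum_eq_sum_of_support_subset (s := (Finset.range r.degree).image Nat.succPNat)]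
  · rw [Finset.sum_apply, Finset.sum_image (fun _ _ _ _ h => Nat.succPNat_injective h)]
    refine Finset.sum_congr rfl fun j _ => ?_
    rw [Pi.smul_apply, smul_eq_mul, Nat.succPNat_coe, Nat.cast_succ]
    -- Division by `j + 1` is unique when possible, so the inner sum has at most one term.
    by_cases h : ∃ s, (j + 1) • s = r
    · obtain ⟨s, hs⟩ := h
      have : {s | (j + 1) • s = r} = {s} := by
        ext s'
        simp only [Set.mem_ofPred_eq, Set.mem_singleton_iff]
        refine ⟨fun h' => ?_, fun h' => h' ▸ hs⟩
        rw [← hs] at h'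
        ext i
        have := DFunLike.congr_fun h' i
        simpa using this
      rw [this, finsum_mem_singleton, h1 j.succPNat s hs]
    · have : {s | (j + 1) • s = r} = ∅ := by
        ext s
        simp only [Set.mem_ofPred_eq, Set.mem_empty_iff_false, iff_false]
        exact fun h' => h ⟨s, h'⟩
      rw [this, finsum_mem_empty, h2 j.succPNat h]
      simp
  · intro m hm
    rw [Finset.coe_image, Set.mem_image]
    refine ⟨m.natPred, ?_, by simp⟩
    rw [Finset.coe_range, Set.mem_Iio]
    by_contra h
    apply hm
    simp only
    rw [h3 m (by have := m.natPred_add_one; omega), smul_zero]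

end

/-! ### Idempotents and residue fields after tensoring with a field -/

section

namespace ResidueTensor

variable {k K E D : Type*} [Field k] [Field K] [Algebra k K] [Ring E] [Algebra k E]
  [Field D] [Algebra k D]

variable (K) in
/-- The base change of a residue map. -/
noncomputable def mapResidue (π : E →ₐ[k] D) : K ⊗[k] E →ₐ[K] K ⊗[k] D :=
  Algebra.TensorProduct.map (AlgHom.id K K) π

theorem mapResidue_surjective {π : E →ₐ[k] D} (hπ : Function.Surjective π) :
    Function.Surjective (mapResidue K π) := fun x => by
  obtain ⟨y, hy⟩ := LinearMap.lTensor_surjective K (g := π.toLinearMap) hπ x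
  exact ⟨y, hy⟩

/-- The kernel of the base change of a residue map with nilpotent kernel is a nil ideal. -/
theorem isNilpotent_of_mapResidue_eq_zero {π : E →ₐ[k] D} (hπ : Function.Surjective π)
    (hker : IsNilpotent (RingHom.ker π)) {x : K ⊗[k] E} (hx : mapResidue K π x = 0) :
    IsNilpotent x := by
  -- `P n` is the `K`-span of the `n`-th power of the kernel. Right exactness of the tensor product
  -- places `x` in `P 1`, and then `x ^ n` lies in `P n`, which is eventually zero.
  let P : ℕ → Submodule K (K ⊗[k] E) := fun n =>
    Submodule.span K ((fun f : E => (1 : K) ⊗ₜ[k] f) '' ((RingHom.ker π ^ n : Ideal E) : Set E))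
  have h1 : x ∈ P 1 := by
    have hx' : x ∈ LinearMap.ker (LinearMap.lTensor K π.toLinearMap) := hx
    rw [(lTensor_exact K (LinearMap.exact_subtype_ker_map π.toLinearMap) hπ).linearMap_ker_eq]
      at hx'
    obtain ⟨y, rfl⟩ := hx'
    induction y using TensorProduct.induction_on with
    | zero => rw [map_zero]; exact Submodule.zero_mem _
    | add y z hy hz =>
      rw [map_add]
      refine Submodule.add_mem _ (hy ?_) (hz ?_)
      · exact (lTensor_exact K (LinearMap.exact_subtype_ker_map π.toLinearMap) hπ).apply_apply_eq_zero y
      · exact (lTensor_exact K (LinearMap.exact_subtype_ker_map π.toLinearMap) hπ).apply_apply_eq_zero z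
    | tmul c f =>
      rw [LinearMap.lTensor_tmul]
      have : c ⊗ₜ[k] ((LinearMap.ker π.toLinearMap).subtype f) =
          c • ((1 : K) ⊗ₜ[k] (f : E)) := by
        rw [TensorProduct.smul_tmul', smul_eq_mul, mul_one]; rfl
      rw [this]
      refine Submodule.smul_mem _ _ (Submodule.subset_span ⟨f, ?_, rfl⟩)
      have e : RingHom.ker π ^ 1 = RingHom.ker π := Submodule.pow_one _
      rw [e]
      exact f.2
  have h2 : ∀ n, x ^ (n + 1) ∈ P (n + 1) := by
    intro n
    induction n with
    | zero => rwa [zero_add, pow_one]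
    | succ n ih =>
      rw [pow_succ]
      have := Submodule.mul_mem_mul ih h1
      rw [Submodule.span_mul_span] at this
      refine Submodule.span_mono ?_ this
      rintro _ ⟨_, ⟨a, ha, rfl⟩, _, ⟨b, hb, rfl⟩, rfl⟩
      refine ⟨a * b, ?_, ?_⟩
      · have e : RingHom.ker π ^ (n + 1 + 1) = RingHom.ker π ^ (n + 1) * RingHom.ker π :=
          Submodule.pow_succ _
        have e1 : RingHom.ker π ^ 1 = RingHom.ker π := Submodule.pow_one _
        rw [e]
        rw [e1] at hb
        exact Ideal.mul_mem_mul ha hb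
      · simp
  obtain ⟨n, hn⟩ := hker
  refine ⟨n + 1, ?_⟩
  have h3 := h2 n
  have e : (RingHom.ker π ^ (n + 1) : Ideal E) = ⊥ := by
    have e : RingHom.ker π ^ (n + 1) = RingHom.ker π ^ n * RingHom.ker π :=
      Submodule.pow_succ _
    rw [e, hn]
    exact Submodule.bot_mul _
  simp only [P] at h3
  rw [e] at h3
  simpa using h3

/-- The joint evaluation map `K ⊗ D → K^(Hom(D, K))`. -/
noncomputable def evalHoms (k K D : Type*) [Field k] [Field K] [Algebra k K] [Field D]
    [Algebra k D] : K ⊗[k] D →ₐ[K] ((D →ₐ[k] K) → K) :=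
  AlgHom.pi fun τ => Algebra.TensorProduct.lift (AlgHom.id K K) τ fun _ _ => Commute.all _ _

theorem evalHoms_tmul (c : K) (x : D) (τ : D →ₐ[k] K) :
    evalHoms k K D (c ⊗ₜ x) τ = c * τ x := by
  simp [evalHoms]

variable [Finite k] [Finite K] [Finite D]

-- A functional vanishing on the image would be a linear relation between distinct embeddings of `D`
-- into `K`, contradicting Dedekind's independence of characters.
omit [Finite k] [Finite K] in
theorem evalHoms_surjective : Function.Surjective (evalHoms k K D) := by
  have : FiniteDimensional k D := Module.Finite.of_finite
  have := Fintype.ofFinite (D →ₐ[k] K)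
  rw [← AlgHom.coe_toLinearMap, ← LinearMap.range_eq_top]
  by_contra hne
  obtain ⟨f, hf, hle⟩ := Submodule.exists_le_ker_of_lt_top _ (lt_top_iff_ne_top.2 hne)
  have hli := linearIndependent_algHom_toLinearMap k D K
  rw [Fintype.linearIndependent_iff] at hli
  apply hf
  classical
  refine LinearMap.pi_ext' fun τ => LinearMap.ext_ring ?_
  refine hli (fun τ => f (Pi.single τ 1)) ?_ τ
  ext x
  have h1 : f (evalHoms k K D (1 ⊗ₜ x)) = 0 := hle ⟨1 ⊗ₜ x, rfl⟩
  rw [LinearMap.zero_apply, ← h1, LinearMap.sum_apply, LinearMap.pi_apply_eq_sum_univ f]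
  refine Finset.sum_congr rfl fun τ _ => ?_
  rw [evalHoms_tmul, one_mul, LinearMap.smul_apply, smul_eq_mul, smul_eq_mul, mul_comm]
  have h2 : (Pi.single τ 1 : (D →ₐ[k] K) → K) = fun σ => if τ = σ then 1 else 0 := by
    ext σ
    simp [Pi.single_apply, eq_comm]
  rw [h2]
  rfl

-- When its degree divides that of `K`, the finite field `D` has as many embeddings into `K` as its
-- degree. Source and target then have equal dimension, and surjectivity gives injectivity.
omit [Finite k] in
theorem evalHoms_injective (hd : Module.finrank k D ∣ Module.finrank k K) :
    Function.Injective (evalHoms k K D) := by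
  have : FiniteDimensional k D := Module.Finite.of_finite
  have h : Module.finrank K (K ⊗[k] D) = Module.finrank K ((D →ₐ[k] K) → K) := by
    rw [Module.finrank_baseChange, Module.finrank_fintype_fun_eq_card,
      FiniteField.card_algHom_of_finrank_dvd hd]
  exact (LinearMap.injective_iff_surjective_of_finrank_eq_finrank
    (f := (evalHoms k K D).toLinearMap) h).2 evalHoms_surjective

omit [Finite k] in
/-- If the degree of the residue field of `E` divides the degree of `K`, then there are complete
orthogonal idempotents in `K ⊗ E`, one for every embedding of the residue field into `K`. -/
theorem exists_idempotents {π : E →ₐ[k] D} (hπ : Function.Surjective π)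
    (hker : IsNilpotent (RingHom.ker π)) {d : ℕ} (hDd : Module.finrank k D = d)
    (hd : d ∣ Module.finrank k K) :
    ∃ (e : Fin d → K ⊗[k] E)
      (χ : Fin d → (K ⊗[k] E →ₐ[K] K)),
      CompleteOrthogonalIdempotents e ∧ (∀ i j, χ i (e j) = if i = j then 1 else 0) ∧
      ∀ x, (∀ i, χ i x = 0) → IsNilpotent x := by
  subst hDd
  have : FiniteDimensional k D := Module.Finite.of_finite
  have hcard : Fintype.card (D →ₐ[k] K) = Module.finrank k D :=
    FiniteField.card_algHom_of_finrank_dvd hd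
  let φ : Fin (Module.finrank k D) ≃ (D →ₐ[k] K) := (Fintype.equivFinOfCardEq hcard).symm
  classical
  let f : K ⊗[k] E →+* ((D →ₐ[k] K) → K) :=
    ((evalHoms k K D).comp (mapResidue K π)).toRingHom
  have hf : Function.Surjective f := evalHoms_surjective.comp (mapResidue_surjective hπ)
  have hnil : ∀ x ∈ RingHom.ker f, IsNilpotent x := by
    intro x hx
    refine isNilpotent_of_mapResidue_eq_zero hπ hker (evalHoms_injective hd ?_)
    rw [map_zero]
    exact hx
  -- Complete orthogonal idempotents lift along a surjection with nil kernel.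
  obtain ⟨e, he, hfe⟩ := CompleteOrthogonalIdempotents.lift_of_isNilpotent_ker f hnil
    (CompleteOrthogonalIdempotents.single fun _ : D →ₐ[k] K => K) (fun i => hf _)
  refine ⟨e ∘ φ, fun i => (Pi.evalAlgHom K (fun _ : D →ₐ[k] K => K) (φ i)).comp
    ((evalHoms k K D).comp (mapResidue K π)), ?_, ?_, ?_⟩
  · exact (CompleteOrthogonalIdempotents.equiv φ).2 he
  · intro i j
    have : f (e (φ j)) (φ i) = _ := congrFun (congrFun hfe (φ j)) (φ i)
    refine Eq.trans this ?_
    simp [Pi.single_apply]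
  · intro x hx
    refine hnil x (funext fun τ => ?_)
    have := hx (φ.symm τ)
    rw [AlgHom.comp_apply, Pi.evalAlgHom_apply, Equiv.apply_symm_apply] at this
    exact this

omit [Finite k] [Finite K] [Finite D] in
/-- If a nonzero corner of `K ⊗ E` has residue field `K`, then the residue field of `E` embeds
into `K`. -/
theorem nonempty_algHom_of_corner {π : E →ₐ[k] D} (hπ : Function.Surjective π)
    (hker : IsNilpotent (RingHom.ker π)) {e : K ⊗[k] E} (he : IsIdempotentElem e) (he0 : e ≠ 0)
    (hcorner : ∀ x, ∃ c : K, IsNilpotent (e * x * e - c • e)) : Nonempty (D →ₐ[k] K) := by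
  set ε := mapResidue K π e with hε
  have hε0 : ε ≠ 0 := by
    intro h
    obtain ⟨n, hn⟩ := isNilpotent_of_mapResidue_eq_zero hπ hker (hε ▸ h)
    have h1 : e ^ (n + 1) = 0 := by rw [pow_succ, hn, zero_mul]
    rw [he.pow_succ_eq] at h1
    exact he0 h1
  have hε' : ¬ IsUnit (1 - ε) := by
    intro hu
    have h1 : (1 - ε) * ε = 0 := by
      rw [sub_mul, one_mul, hε, ← map_mul, he.eq, sub_self]
    exact hε0 (hu.mul_right_eq_zero.1 h1)
  -- Modulo a maximal ideal containing `1 - ε` the idempotent becomes `1`, so the quotient is a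
  -- residue field of the corner. By hypothesis this is `K`, and `D` maps to it.
  obtain ⟨m, hm, hεm⟩ := exists_max_ideal_of_mem_nonunits hε'
  let : Field ((K ⊗[k] D) ⧸ m) := Ideal.Quotient.field m
  have hε1 : Ideal.Quotient.mk m ε = 1 := by
    have : Ideal.Quotient.mk m (1 - ε) = 0 := Ideal.Quotient.eq_zero_iff_mem.2 hεm
    rw [map_sub, map_one, sub_eq_zero] at this
    exact this.symm
  have hsurj : Function.Surjective (algebraMap K ((K ⊗[k] D) ⧸ m)) := by
    intro y
    obtain ⟨y, rfl⟩ := Ideal.Quotient.mk_surjective y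
    obtain ⟨x, rfl⟩ := mapResidue_surjective (K := K) hπ y
    obtain ⟨c, hc⟩ := hcorner x
    refine ⟨c, ?_⟩
    have h1 := (hc.map (mapResidue K π)).map (Ideal.Quotient.mk m)
    rw [map_sub, map_mul, map_mul, map_smul, ← hε, map_sub, map_mul, map_mul, hε1, one_mul,
      mul_one, Algebra.smul_def, map_mul, hε1, mul_one] at h1
    have h2 := h1.eq_zero
    rw [sub_eq_zero] at h2
    rw [h2]; rfl
  let ψ : K ≃ₐ[K] ((K ⊗[k] D) ⧸ m) := AlgEquiv.ofBijective (Algebra.ofId K _)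
    ⟨(algebraMap K ((K ⊗[k] D) ⧸ m)).injective, hsurj⟩
  exact ⟨((ψ.symm.toAlgHom.comp (Ideal.Quotient.mkₐ K m)).restrictScalars k).comp
    Algebra.TensorProduct.includeRight⟩

end ResidueTensor

end

/-! ### Scalar extension between Krull–Schmidt categories -/

section

open CategoryTheory CategoryTheory.Limits

namespace KrullSchmidt

section Misc

universe w₁

variable {C : Type*} [Category.{w₁} C] [Preadditive C]

-- The map `f ↦ r ≫ f ≫ i` identifies `End Y` with a corner of `End X`. Comparing powers transfers
-- nilpotency in both directions.
omit [Preadditive C] in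
theorem retract_pow {X Y : C} {i : Y ⟶ X} {r : X ⟶ Y} (h : i ≫ r = 𝟙 Y) (f : End Y) (n : ℕ) :
    i ≫ (show X ⟶ X from (show End X from r ≫ f ≫ i) ^ n) ≫ r = f ^ n := by
  induction n with
  | zero =>
    rw [pow_zero, pow_zero]
    exact (congrArg (fun z => i ≫ z) (Category.id_comp r)).trans h
  | succ n ih =>
    rw [pow_succ, pow_succ, ← ih]
    change i ≫ ((r ≫ f ≫ i) ≫ (show X ⟶ X from (show End X from r ≫ f ≫ i) ^ n)) ≫ r =
      f ≫ i ≫ (show X ⟶ X from (show End X from r ≫ f ≫ i) ^ n) ≫ r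
    simp only [Category.assoc, reassoc_of% h]

theorem isNilpotent_of_retract {X Y : C} {i : Y ⟶ X} {r : X ⟶ Y} (h : i ≫ r = 𝟙 Y) (f : End Y)
    (hf : IsNilpotent (show End X from r ≫ f ≫ i)) : IsNilpotent f := by
  obtain ⟨n, hn⟩ := hf
  refine ⟨n, ?_⟩
  rw [← retract_pow h, hn]
  change i ≫ (0 : X ⟶ X) ≫ r = (0 : Y ⟶ Y)
  simp

theorem isNilpotent_retract {X Y : C} {i : Y ⟶ X} {r : X ⟶ Y} (h : i ≫ r = 𝟙 Y) (f : End Y)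
    (hf : IsNilpotent f) : IsNilpotent (show End X from r ≫ f ≫ i) := by
  obtain ⟨n, hn⟩ := hf
  have key : ∀ n, (show End X from r ≫ f ≫ i) ^ (n + 1) =
      r ≫ (show Y ⟶ Y from f ^ (n + 1)) ≫ i := by
    intro n
    induction n with
    | zero => simp
    | succ n ih =>
      rw [pow_succ, ih, pow_succ f (n + 1)]
      change (r ≫ f ≫ i) ≫ r ≫ (show Y ⟶ Y from f ^ (n + 1)) ≫ i =
        r ≫ (f ≫ (show Y ⟶ Y from f ^ (n + 1))) ≫ i
      simp only [Category.assoc, reassoc_of% h]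
  refine ⟨n + 1, ?_⟩
  rw [key, pow_succ, hn, zero_mul]
  change r ≫ (0 : Y ⟶ Y) ≫ i = (0 : X ⟶ X)
  simp

/-- An object over a field all of whose endomorphisms are sums of scalars and nilpotents. -/
def IsAbsIndec (K : Type*) [Field K] [Linear K C] (L : C) : Prop :=
  𝟙 L ≠ 0 ∧ ∀ f : L ⟶ L, ∃ c : K, IsNilpotent (show End L from f - c • 𝟙 L)

/-- An idempotent that is a scalar plus a nilpotent is either nilpotent, hence zero, or a unit,
hence the identity. -/
theorem IsAbsIndec.isIndec {K : Type*} [Field K] [Linear K C] {L : C} (h : IsAbsIndec K L) :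
    IsIndec L := by
  refine ⟨h.1, fun e he => ?_⟩
  obtain ⟨c, hc⟩ := h.2 e
  have he' : IsIdempotentElem (show End L from e) := he
  by_cases h0 : c = 0
  · left
    rw [h0, zero_smul, sub_zero] at hc
    obtain ⟨n, hn⟩ := hc
    have h1 : (show End L from e) ^ (n + 1) = 0 := by rw [pow_succ, hn, zero_mul]
    rw [he'.pow_succ_eq] at h1
    exact h1
  · right
    have h1 : IsUnit (show End L from e) := by
      have h2 : IsUnit (algebraMap K (End L) c) := (IsUnit.mk0 c h0).map _
      have h3 : (show End L from e) = algebraMap K (End L) c + (show End L from e - c • 𝟙 L) := by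
        rw [Algebra.algebraMap_eq_smul_one]
        exact (add_sub_cancel (c • 𝟙 L) e).symm
      rw [h3]
      exact hc.isUnit_add_left_of_commute h2 (Algebra.commutes c _).symm
    have h4 : (show End L from e) * (show End L from e) = (show End L from e) * 1 := by
      rw [he'.eq, mul_one]
    exact h1.mul_left_cancel h4

/-- The degree of the residue field of the endomorphism ring. -/
noncomputable def residueDegree (k : Type*) [Field k] [Linear k C] (X : C) : ℕ :=
  Module.finrank k (End X ⧸ Ring.jacobson (End X))

variable [∀ X Y : C, Finite (X ⟶ Y)]

theorem card_residue (k : Type*) [Field k] [Finite k] [Linear k C] (X : C) :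
    Nat.card (End X ⧸ Ring.jacobson (End X)) = Nat.card k ^ residueDegree k X := by
  have : Finite (End X ⧸ Ring.jacobson (End X)) := Quotient.finite _
  exact Module.natCard_eq_pow_finrank

theorem IsIndec.exists_residue (k : Type*) [Field k] [Finite k] [Linear k C] {X : C}
    (h : IsIndec X) :
    ∃ (D : Type w₁) (_ : Field D) (_ : Algebra k D) (_ : Finite D) (π : End X →ₐ[k] D),
      Function.Surjective π ∧ IsNilpotent (RingHom.ker π) ∧
      Module.finrank k D = residueDegree k X ∧ Nat.card D = Nat.card k ^ residueDegree k X := by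
  have := h.nontrivial
  have hfin : Finite (End X ⧸ Ring.jacobson (End X)) := Quotient.finite _
  refine ⟨End X ⧸ Ring.jacobson (End X),
    (isField_quotient_jacobson h.isUnit_or_isNilpotent).toField, inferInstance, hfin,
    Ideal.Quotient.mkₐ k _, Ideal.Quotient.mk_surjective, ?_, rfl, card_residue k X⟩
  have h1 : RingHom.ker (Ideal.Quotient.mkₐ k (Ring.jacobson (End X))) = Ring.jacobson (End X) :=
    Ideal.mk_ker
  have h2 := isNilpotent_ringJacobson (End X)
  rw [← h1] at h2
  exact h2

/-- The decomposition need not be presented as a biproduct, so this applies to the image of a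
biproduct under an additive functor. -/
theorem IsIndec.isRetract_of_add {Y W X Z : C} (h : IsIndec Y) (hY : IsRetract Y W)
    (p : W ⟶ X) (u : X ⟶ W) (p' : W ⟶ Z) (u' : Z ⟶ W) (hpu : p ≫ u + p' ≫ u' = 𝟙 W) :
    IsRetract Y X ∨ IsRetract Y Z := by
  obtain ⟨i, r, hir⟩ := hY
  have h1 : (i ≫ p) ≫ (u ≫ r) + (i ≫ p') ≫ (u' ≫ r) = 𝟙 Y := by
    have : (i ≫ p) ≫ (u ≫ r) + (i ≫ p') ≫ (u' ≫ r) = i ≫ (p ≫ u + p' ≫ u') ≫ r := by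
      simp only [Preadditive.add_comp, Preadditive.comp_add, Category.assoc]
    rw [this, hpu, Category.id_comp, hir]
  rcases h.isIso_of_add _ _ h1 with h2 | h2
  · exact Or.inl ⟨i ≫ p, (u ≫ r) ≫ inv ((i ≫ p) ≫ (u ≫ r)), by
      rw [← Category.assoc, IsIso.hom_inv_id]⟩
  · exact Or.inr ⟨i ≫ p', (u' ≫ r) ≫ inv ((i ≫ p') ≫ (u' ≫ r)), by
      rw [← Category.assoc, IsIso.hom_inv_id]⟩

variable [HasFiniteBiproducts C] [HasBinaryBiproducts C]

omit [∀ X Y : C, Finite (X ⟶ Y)] in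
theorem classRetract_sumClass {m : IndecClass C →₀ ℕ} {I : IndecClass C} (h : I ∈ m.support) :
    ClassRetract I.1 (sumClass m) := by
  have h1 : m = Finsupp.single I 1 + (m - Finsupp.single I 1) := by
    rw [add_tsub_cancel_of_le]
    rw [Finsupp.single_le_iff]
    rw [Finsupp.mem_support_iff] at h
    omega
  rw [h1, map_add, sumClass_single, one_smul]
  induction I.1 using Quotient.inductionOn with | _ X
  induction sumClass (m - Finsupp.single I 1) using Quotient.inductionOn with | _ Y
  exact classRetract_iff.2 (isRetract_biprod_left X Y)

variable [IsIdempotentComplete C]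

/-- An object all of whose indecomposable retracts are isomorphic to `I` is a power of `I`. -/
theorem exists_eq_nsmul {I X : C} (hI : IsIndec I)
    (h : ∀ J : C, IsIndec J → IsRetract J X → Nonempty (J ≅ I)) :
    ∃ a : ℕ, isoClass X = a • isoClass I := by
  obtain ⟨m, hm⟩ := sumClass_surjective (isoClass X)
  refine ⟨m ⟨isoClass I, I, hI, rfl⟩, ?_⟩
  have : m = Finsupp.single ⟨isoClass I, I, hI, rfl⟩ (m ⟨isoClass I, I, hI, rfl⟩) := by
    rw [← Finsupp.support_subset_singleton]
    rintro ⟨c, J, hJ, rfl⟩ hJm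
    rw [Finset.mem_singleton]
    have h1 := classRetract_sumClass hJm
    rw [hm] at h1
    exact Subtype.ext (isoClass_eq_iff.2 (h J hJ (classRetract_iff.1 h1)))
  rw [← hm]
  conv_lhs => rw [this]
  exact sumClass_single _ _

end Misc

/-- A representation of a finite field `K` on a power of an object bounds the order of `K`. -/
theorem card_le_of_ringHom_matrix {K D : Type*} [Field K] [Field D] [Finite D] {a : ℕ}
    (ha : a ≠ 0) (φ : K →+* Matrix (Fin a) (Fin a) D) : Nat.card K ≤ Nat.card D ^ a := by
  -- Nonzero elements of `K` act invertibly, so the orbit map of a nonzero vector is injective.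
  have h1 : Function.Injective fun c : K => (φ c).mulVec (Pi.single ⟨0, by omega⟩ 1) := by
    intro c c' h
    by_contra hne
    have h2 : (φ (c - c')).mulVec (Pi.single ⟨0, by omega⟩ 1) = 0 := by
      rw [map_sub, Matrix.sub_mulVec, sub_eq_zero]
      exact h
    have h3 := congrArg (φ (c - c')⁻¹).mulVec h2
    rw [Matrix.mulVec_mulVec, ← map_mul, inv_mul_cancel₀ (sub_ne_zero.2 hne), map_one,
      Matrix.one_mulVec, Matrix.mulVec_zero] at h3
    have h4 := congrFun h3 ⟨0, by omega⟩
    rw [Pi.single_eq_same] at h4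
    exact one_ne_zero h4
  calc Nat.card K ≤ Nat.card (Fin a → D) := Nat.card_le_card_of_injective _ h1
    _ = Nat.card D ^ a := by rw [Nat.card_fun, Nat.card_fin]

variable {k K : Type*} [Field k] [Field K] [Algebra k K]
  {C : Type*} [Category C] [Preadditive C] [Linear k C]
  {C' : Type*} [Category C'] [Preadditive C'] [Linear K C']
  [HasFiniteBiproducts C] [HasBinaryBiproducts C]
  [HasFiniteBiproducts C'] [HasBinaryBiproducts C']

variable (k K C C') in
/-- Extension and restriction of scalars between linear categories over fields `k ⊆ K`, together
with compatible rank functions. -/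
structure ScalarExtension (V : Type*) where
  /-- extension of scalars -/
  ext : C ⥤ C'
  /-- restriction of scalars -/
  res : C' ⥤ C
  [ext_additive : ext.Additive]
  [res_additive : res.Additive]
  /-- the endomorphism ring of an extension of scalars -/
  endEquiv : ∀ X : C, K ⊗[k] End X ≃ₐ[K] End (ext.obj X)
  exists_res_ext : ∀ X : C, ∃ (p : Fin (Module.finrank k K) → (res.obj (ext.obj X) ⟶ X))
    (u : Fin (Module.finrank k K) → (X ⟶ res.obj (ext.obj X))),
    ∑ j, p j ≫ u j = 𝟙 (res.obj (ext.obj X))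
  -- For representations this reflects the separability of `K` over `k`.
  isRetract_ext_res : ∀ L : C', IsRetract L (ext.obj (res.obj L))
  /-- the rank -/
  rank : IsoClass C →+ (V →₀ ℕ)
  /-- the rank over the extension -/
  rank' : IsoClass C' →+ (V →₀ ℕ)
  rank_eq_zero : ∀ X, rank X = 0 → X = 0
  rank_ext : ∀ X, rank' (isoClass (ext.obj X)) = rank (isoClass X)
  rank_res : ∀ L, rank (isoClass (res.obj L)) = Module.finrank k K • rank' (isoClass L)

namespace ScalarExtension

variable {V : Type*} (S : ScalarExtension k K C C' V)

attribute [instance] ScalarExtension.ext_additive ScalarExtension.res_additive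

theorem rank_ne_zero {I : C} (hI : 𝟙 I ≠ 0) : S.rank (isoClass I) ≠ 0 := fun h =>
  hI (isoClass_eq_zero.1 (S.rank_eq_zero _ h))

theorem res_ne_zero {L : C'} (hL : 𝟙 L ≠ 0) : 𝟙 (S.res.obj L) ≠ 0 := by
  intro h
  apply hL
  obtain ⟨i, r, hir⟩ := S.isRetract_ext_res L
  rw [← hir, ← Category.comp_id i, ← S.ext.map_id, h, S.ext.map_zero, comp_zero, zero_comp]

variable [∀ X Y : C, Finite (X ⟶ Y)] [IsIdempotentComplete C]

-- The identity of the restricted extension of `I` decomposes through copies of `I`, so any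
-- indecomposable retract is a retract of `I` itself.
omit [IsIdempotentComplete C] in
theorem nonempty_iso_of_isRetract_res_ext {I J : C} (hI : IsIndec I) (hJ : IsIndec J)
    (h : IsRetract J (S.res.obj (S.ext.obj I))) : Nonempty (J ≅ I) := by
  obtain ⟨p, u, hpu⟩ := S.exists_res_ext I
  obtain ⟨j, -, hj⟩ := hJ.isRetract_of_sum h Finset.univ (fun _ => I) p u hpu
  exact hI.nonempty_iso_of_isRetract hJ hj

/-- An object of `C'` is a retract of the extension of at most one indecomposable object. -/
theorem nonempty_iso_of_isRetract_ext {I I' : C} (hI : IsIndec I) (hI' : IsIndec I') {L : C'}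
    (hL : 𝟙 L ≠ 0) (h : IsRetract L (S.ext.obj I)) (h' : IsRetract L (S.ext.obj I')) :
    Nonempty (I ≅ I') := by
  -- An indecomposable retract of the restriction of `L` must be isomorphic to both `I` and `I'`.
  obtain ⟨J, hJ, hJL⟩ := exists_isIndec_isRetract (S.res_ne_zero hL)
  obtain ⟨e⟩ := S.nonempty_iso_of_isRetract_res_ext hI hJ (hJL.trans (h.map S.res))
  obtain ⟨e'⟩ := S.nonempty_iso_of_isRetract_res_ext hI' hJ (hJL.trans (h'.map S.res))
  exact ⟨e.symm ≪≫ e'⟩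

variable [∀ X Y : C', Finite (X ⟶ Y)]

theorem exists_isIndec_isRetract_ext_of_isRetract {L : C'} (hL : IsIndec L) (X : C)
    (h : IsRetract L (S.ext.obj X)) : ∃ I : C, IsIndec I ∧ IsRetract L (S.ext.obj I) := by
  refine biprod_induction (P := fun X => IsRetract L (S.ext.obj X) →
    ∃ I : C, IsIndec I ∧ IsRetract L (S.ext.obj I)) ?_ ?_ ?_ X h
  · intro X Y e hX hY
    exact hX (hY.trans (IsRetract.of_iso (S.ext.mapIso e.symm)))
  · rintro X hX ⟨i, r, hir⟩
    exfalso
    apply hL.1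
    rw [← hir, ← Category.comp_id i, ← S.ext.map_id, hX, S.ext.map_zero, comp_zero, zero_comp]
  · intro I X hI hX h
    rcases hL.isRetract_of_add h (S.ext.map biprod.fst) (S.ext.map biprod.inl)
      (S.ext.map biprod.snd) (S.ext.map biprod.inr) (by
        rw [← S.ext.map_comp, ← S.ext.map_comp, ← S.ext.map_add, biprod.total, S.ext.map_id])
      with h | h
    · exact ⟨I, hI, h⟩
    · exact hX h

/-- An indecomposable object of `C'` is a retract of the extension of an indecomposable object. -/
theorem exists_isIndec_isRetract_ext {L : C'} (hL : IsIndec L) :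
    ∃ I : C, IsIndec I ∧ IsRetract L (S.ext.obj I) :=
  S.exists_isIndec_isRetract_ext_of_isRetract hL _ (S.isRetract_ext_res L)

variable [Finite k] [Finite K]

-- The corner of `K ⊗ End I` cut out by `L` is `End L`, which has residue field `K`. Hence the
-- residue field of `I` embeds into `K`, and for finite fields this means divisibility of degrees.
omit [IsIdempotentComplete C] [∀ X Y : C', Finite (X ⟶ Y)] in
theorem residueDegree_dvd {I : C} (hI : IsIndec I) {L : C'} (hL : IsAbsIndec K L)
    (h : IsRetract L (S.ext.obj I)) : residueDegree k I ∣ Module.finrank k K := by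
  obtain ⟨D, hF, hA, hfin, π, hπ, hker, hdeg, hcard⟩ := hI.exists_residue k
  obtain ⟨i, r, hir⟩ := h
  rw [← hdeg, ← FiniteField.nonempty_algHom_iff_finrank_dvd]
  set Φ := S.endEquiv I with hΦ
  let ε : End (S.ext.obj I) := r ≫ i
  have hε : IsIdempotentElem ε := by
    change (r ≫ i) ≫ (r ≫ i) = r ≫ i
    rw [Category.assoc, reassoc_of% hir]
  refine ResidueTensor.nonempty_algHom_of_corner (K := K) hπ hker (e := Φ.symm ε)
    (hε.map Φ.symm) ?_ ?_
  · intro h0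
    rw [map_eq_zero_iff _ Φ.symm.injective] at h0
    apply hL.1
    have h1 : r ≫ i = 0 := h0
    calc 𝟙 L = (i ≫ r) ≫ (i ≫ r) := by rw [hir, Category.comp_id]
      _ = 0 := by rw [Category.assoc, reassoc_of% h1, zero_comp, comp_zero]
  · intro x
    obtain ⟨c, hc⟩ := hL.2 (i ≫ (show S.ext.obj I ⟶ S.ext.obj I from Φ x) ≫ r)
    refine ⟨c, ?_⟩
    have h1 := isNilpotent_retract hir _ hc
    have h2 := h1.map Φ.symm
    refine (congrArg IsNilpotent (Φ.injective ?_)).mpr h2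
    rw [AlgEquiv.apply_symm_apply, map_sub, map_mul, map_mul, map_smul,
      AlgEquiv.apply_symm_apply]
    change (r ≫ i) ≫ (show S.ext.obj I ⟶ S.ext.obj I from Φ x) ≫ (r ≫ i) - c • (r ≫ i) =
      r ≫ (i ≫ (show S.ext.obj I ⟶ S.ext.obj I from Φ x) ≫ r - c • 𝟙 L) ≫ i
    simp [Preadditive.sub_comp, Preadditive.comp_sub]

-- `K` acts on the restriction of `L`, a power of `I`, and therefore on `D^a` for the residue field
-- `D` of `I`. This forces |K| ≤ |D|^a.
omit [IsIdempotentComplete C] [∀ X Y : C', Finite (X ⟶ Y)] in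
theorem finrank_le {I : C} (hI : IsIndec I) {L : C'} (hL : 𝟙 L ≠ 0) {a : ℕ}
    (ha : isoClass (S.res.obj L) = a • isoClass I) :
    a ≠ 0 ∧ Module.finrank k K ≤ residueDegree k I * a := by
  have ha0 : a ≠ 0 := by
    rintro rfl
    rw [zero_smul, isoClass_eq_zero] at ha
    exact S.res_ne_zero hL ha
  refine ⟨ha0, ?_⟩
  obtain ⟨D, hF, hA, hfin, π, hπ, hker, hdeg, hcard⟩ := hI.exists_residue k
  have h1 : a • isoClass I = isoClass (⨁ fun _ : Fin a => I) := by
    rw [isoClass_biproduct_fin]; simp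
  obtain ⟨e⟩ := isoClass_eq_iff.1 (ha.trans h1)
  let φ₁ : End L →+* End (S.res.obj L) :=
    { toFun := fun f => S.res.map f
      map_one' := S.res.map_id L
      map_mul' := fun f g => S.res.map_comp g f
      map_zero' := S.res.map_zero L L
      map_add' := fun f g => S.res.map_add }
  let φ₂ : End (S.res.obj L) →+* End (⨁ fun _ : Fin a => I) :=
    { toFun := fun f => e.inv ≫ f ≫ e.hom
      map_one' := by
        change e.inv ≫ 𝟙 _ ≫ e.hom = 𝟙 _
        simp
      map_mul' := fun f g => by
        change e.inv ≫ (g ≫ f) ≫ e.hom = (e.inv ≫ g ≫ e.hom) ≫ (e.inv ≫ f ≫ e.hom)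
        simp
      map_zero' := by
        change e.inv ≫ 0 ≫ e.hom = 0
        simp
      map_add' := fun f g => by
        exact (congrArg (fun z => e.inv ≫ z) (Preadditive.add_comp _ _ _ f g e.hom)).trans
          (Preadditive.comp_add _ _ _ _ _ _) }
  let φ : K →+* Matrix (Fin a) (Fin a) D :=
    (π.toRingHom.mapMatrix.comp (endBiproductEquiv I a).toRingHom).comp
      ((φ₂.comp φ₁).comp (algebraMap K (End L)))
  have h2 := card_le_of_ringHom_matrix ha0 φ
  rw [hcard, Module.natCard_eq_pow_finrank (K := k) (V := K), ← pow_mul] at h2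
  exact (Nat.pow_le_pow_iff_right Finite.one_lt_card).1 h2

/-- The decomposition of the extension of an indecomposable object whose degree divides the degree
of the field extension. -/
theorem exists_decomposition [IsIdempotentComplete C'] {I : C} (hI : IsIndec I)
    (hd : residueDegree k I ∣ Module.finrank k K) :
    ∃ L : Fin (residueDegree k I) → C', (∀ j, IsAbsIndec K (L j)) ∧
      (∀ j, IsRetract (L j) (S.ext.obj I)) ∧
      (∀ i j, Nonempty (L i ≅ L j) → i = j) ∧
      (∀ Y : C', IsIndec Y → IsRetract Y (S.ext.obj I) → ∃ j, Nonempty (Y ≅ L j)) ∧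
      ∀ j, residueDegree k I • S.rank' (isoClass (L j)) = S.rank (isoClass I) := by
  obtain ⟨D, hF, hA, hfin, π, hπ, hker, hdeg, hcard⟩ := hI.exists_residue k
  obtain ⟨e, χ, he, hχ, hnil⟩ := ResidueTensor.exists_idempotents (K := K) hπ hker hdeg hd
  set Φ := S.endEquiv I with hΦ
  have hidem : ∀ j, ∃ (L : C') (i : L ⟶ S.ext.obj I) (r : S.ext.obj I ⟶ L),
      i ≫ r = 𝟙 L ∧ r ≫ i = Φ (e j) := fun j =>
    IsIdempotentComplete.idempotents_split _ (Φ (e j)) ((he.idem j).map Φ)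
  choose L i r hir hri using hidem
  have hchar : ∀ (a : Fin (residueDegree k I)) (f g : End (S.ext.obj I)),
      χ a (Φ.symm (show End (S.ext.obj I) from f ≫ g)) = χ a (Φ.symm f) * χ a (Φ.symm g) := by
    intro a f g
    rw [mul_comm, ← map_mul, ← map_mul]; rfl
  have hchar' : ∀ a b, χ a (Φ.symm (show End (S.ext.obj I) from r b ≫ i b)) =
      if a = b then 1 else 0 := by
    intro a b
    rw [hri, ← hχ]
    exact congrArg (χ a) (Φ.symm_apply_apply (e b))
  have hLne : ∀ j, 𝟙 (L j) ≠ 0 := by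
    intro j h0
    have h1 : (show End (S.ext.obj I) from r j ≫ i j) = 0 := by
      change r j ≫ i j = 0
      rw [← Category.id_comp (i j), h0, zero_comp, comp_zero]
    have h2 := hchar' j j
    rw [h1, map_zero, map_zero, if_pos rfl] at h2
    exact zero_ne_one h2
  -- Extend `f` by zero to `g` and subtract its `j`-th character times `e j`. All characters vanish
  -- on the difference: for `a ≠ j` because `g` factors through `e j`. Hence it is nilpotent.
  have habs : ∀ j, IsAbsIndec K (L j) := by
    refine fun j => ⟨hLne j, fun f => ?_⟩
    set g : End (S.ext.obj I) := r j ≫ f ≫ i j with hg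
    refine ⟨χ j (Φ.symm g), isNilpotent_of_retract (hir j) _ ?_⟩
    have h1 : (show End (S.ext.obj I) from r j ≫ (f - χ j (Φ.symm g) • 𝟙 (L j)) ≫ i j) =
        Φ (Φ.symm g - χ j (Φ.symm g) • e j) := by
      rw [map_sub, map_smul, AlgEquiv.apply_symm_apply, ← hri j, hg]
      change _ = r j ≫ f ≫ i j - χ j (Φ.symm g) • (r j ≫ i j)
      simp [Preadditive.sub_comp, Preadditive.comp_sub, hg]
    rw [h1]
    refine IsNilpotent.map (hnil _ fun a => ?_) Φ
    rw [map_sub, map_smul, hχ]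
    by_cases h : a = j
    · subst h; simp
    · have h2 : g = (show End (S.ext.obj I) from (r j ≫ i j) ≫ g) := by
        change r j ≫ f ≫ i j = (r j ≫ i j) ≫ r j ≫ f ≫ i j
        rw [Category.assoc, reassoc_of% hir j]
      have h3 : χ a (Φ.symm g) = 0 := by
        rw [h2, hchar a (r j ≫ i j) g, hchar' a j, if_neg h, zero_mul]
      rw [h3, if_neg h]
      simp
  have htotal : ∑ j, r j ≫ i j = 𝟙 (S.ext.obj I) := by
    have h1 := congrArg Φ he.complete
    rw [map_sum, map_one] at h1
    rw [← End.one_def, ← h1]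
    exact Finset.sum_congr rfl fun j _ => hri j
  have hortho : ∀ a b, a ≠ b → i a ≫ r b = 0 := by
    intro a b hab
    have h1 : (r a ≫ i a) ≫ (r b ≫ i b) = 0 := by
      rw [hri, hri]
      change Φ (e b) * Φ (e a) = 0
      rw [← map_mul, he.ortho hab.symm, map_zero]
    calc i a ≫ r b = (i a ≫ r a) ≫ (i a ≫ r b) ≫ (i b ≫ r b) := by rw [hir, hir]; simp
      _ = i a ≫ ((r a ≫ i a) ≫ (r b ≫ i b)) ≫ r b := by simp only [Category.assoc]
      _ = 0 := by rw [h1]; simp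
  refine ⟨L, habs, fun j => ⟨i j, r j, hir j⟩, ?_, ?_, ?_⟩
  -- An isomorphism would write `e a` as a product passing through `e b`, which the character `χ a`
  -- kills although it maps `e a` to `1`.
  · rintro a b ⟨φ⟩
    by_contra hab
    have h1 : (r a ≫ φ.hom ≫ i b) ≫ (r b ≫ φ.inv ≫ i a) = r a ≫ i a := by
      simp [reassoc_of% hir b]
    have h2 := hchar' a a
    rw [if_pos rfl, ← h1, hchar a (r a ≫ φ.hom ≫ i b) (r b ≫ φ.inv ≫ i a)] at h2
    have h3 : r b ≫ φ.inv ≫ i a = (r b ≫ i b) ≫ (r b ≫ φ.inv ≫ i a) := by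
      rw [Category.assoc, reassoc_of% hir b]
    rw [h3, hchar a (r b ≫ i b) (r b ≫ φ.inv ≫ i a), hchar' a b, if_neg hab, zero_mul,
      mul_zero] at h2
    exact zero_ne_one h2
  · intro Y hY hYI
    obtain ⟨j, -, hj⟩ := hY.isRetract_of_sum hYI Finset.univ L r i htotal
    exact ⟨j, (habs j).isIndec.nonempty_iso_of_isRetract hY hj⟩
  · set N := Module.finrank k K with hN
    have hNpos : 0 < N := by
      have : Module.Finite k K := Module.Finite.of_finite
      exact Module.finrank_pos
    have hres : ∀ j, ∃ a : ℕ, isoClass (S.res.obj (L j)) = a • isoClass I := fun j =>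
      exists_eq_nsmul hI fun J hJ hJL => S.nonempty_iso_of_isRetract_res_ext hI hJ
        (hJL.trans (IsRetract.map S.res ⟨i j, r j, hir j⟩))
    choose a ha using hres
    have h1 : ∀ j, N • S.rank' (isoClass (L j)) = a j • S.rank (isoClass I) := by
      intro j
      rw [← S.rank_res, ha, map_nsmul]
    have h2 : ∀ j, N ≤ residueDegree k I * a j := fun j => (S.finrank_le hI (hLne j) (ha j)).2
    have h3 : ∑ j, S.rank' (isoClass (L j)) = S.rank (isoClass I) := by
      rw [← map_sum, ← isoClass_biproduct_fin, ← S.rank_ext]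
      congr 1
      refine isoClass_eq_iff.2 ⟨⟨biproduct.desc i, biproduct.lift r, ?_, ?_⟩⟩
      · ext a b
        by_cases hab : a = b
        · subst hab; simp [hir]
        · simp [hortho b a (Ne.symm hab), biproduct.ι_π_ne _ (Ne.symm hab)]
      · rw [biproduct.lift_desc, htotal]
    -- Adding the ranks of all `L j` gives the rank of `I`, which is nonzero and can be cancelled.
    have h4 : ∑ j, a j = N := by
      have h5 : (∑ j, a j) • S.rank (isoClass I) = N • S.rank (isoClass I) := by
        rw [Finset.sum_smul, ← Finset.sum_congr rfl (fun j _ => h1 j), ← Finset.smul_sum, h3]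
      obtain ⟨v, hv⟩ := Finsupp.ne_iff.1 (S.rank_ne_zero hI.1)
      have h6 := DFunLike.congr_fun h5 v
      rw [Finsupp.smul_apply, Finsupp.smul_apply, smul_eq_mul, smul_eq_mul] at h6
      exact Nat.eq_of_mul_eq_mul_right (Nat.pos_of_ne_zero hv) h6
    -- There are `residueDegree k I` inequalities `h2`, and by `h4` their two sides have equal sums,
    -- so each is an equality.
    have h5 : ∀ j, N = residueDegree k I * a j := by
      have h6 : ∑ _j : Fin (residueDegree k I), N = ∑ j, residueDegree k I * a j := by
        rw [← Finset.mul_sum, h4]; simp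
      intro j
      exact (Finset.sum_eq_sum_iff_of_le fun j _ => h2 j).1 h6 j (Finset.mem_univ j)
    intro j
    have h6 : N • (residueDegree k I • S.rank' (isoClass (L j))) =
        N • S.rank (isoClass I) := by
      rw [smul_comm, h1, smul_smul, ← h5 j]
    ext v
    have h7 := DFunLike.congr_fun h6 v
    rw [Finsupp.smul_apply, Finsupp.smul_apply, smul_eq_mul, smul_eq_mul] at h7
    exact Nat.eq_of_mul_eq_mul_left hNpos h7

end ScalarExtension

end KrullSchmidt

end

/-! ### Counting absolutely indecomposable objects over an extension -/

section

open CategoryTheory CategoryTheory.Limits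

namespace KrullSchmidt

section

universe w₁

variable {C : Type*} [Category.{w₁} C] [Preadditive C]

/-- The degree of the residue field of the endomorphism ring of an indecomposable object. -/
noncomputable def IndecClass.degree [HasFiniteBiproducts C] [HasBinaryBiproducts C]
    (k : Type*) [Field k] [Linear k C] (I : IndecClass C) : ℕ :=
  residueDegree k I.2.choose

theorem IsIndec.residueDegree_pos [∀ X Y : C, Finite (X ⟶ Y)] (k : Type*) [Field k] [Finite k]
    [Linear k C] {X : C} (h : IsIndec X) : 0 < residueDegree k X := by
  obtain ⟨D, hF, hA, hfin, π, -, -, hdeg, -⟩ := h.exists_residue k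
  rw [← hdeg]
  have : Module.Finite k D := Module.Finite.of_finite
  exact Module.finrank_pos

end

variable {k K : Type*} [Field k] [Field K] [Algebra k K]
  {C : Type*} [Category C] [Preadditive C] [Linear k C]
  {C' : Type*} [Category C'] [Preadditive C'] [Linear K C']
  [HasFiniteBiproducts C] [HasBinaryBiproducts C]
  [HasFiniteBiproducts C'] [HasBinaryBiproducts C']

theorem IndecClass.degree_pos [∀ X Y : C, Finite (X ⟶ Y)] [Finite k] (I : IndecClass C) :
    0 < I.degree k :=
  I.2.choose_spec.1.residueDegree_pos k

namespace ScalarExtension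

variable {V : Type*} (S : ScalarExtension k K C C' V)
variable [∀ X Y : C, Finite (X ⟶ Y)] [IsIdempotentComplete C]
variable [∀ X Y : C', Finite (X ⟶ Y)] [IsIdempotentComplete C'] [Finite k] [Finite K]

theorem exists_finset (I : IndecClass C) (hd : I.degree k ∣ Module.finrank k K) :
    ∃ P : Finset (IsoClass C'), P.card = I.degree k ∧
      (∀ c, c ∈ P ↔ ∃ L : C', IsAbsIndec K L ∧ isoClass L = c ∧
        IsRetract L (S.ext.obj I.2.choose)) ∧
      ∀ c ∈ P, I.degree k • S.rank' c = S.rank I.1 := by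
  classical
  obtain ⟨L, h1, h2, h3, h4, h5⟩ := S.exists_decomposition I.2.choose_spec.1 hd
  refine ⟨Finset.univ.image fun j => isoClass (L j), ?_, ?_, ?_⟩
  · rw [Finset.card_image_of_injective _ fun i j hij => h3 i j (isoClass_eq_iff.1 hij),
      Finset.card_univ, Fintype.card_fin]
    rfl
  · intro c
    simp only [Finset.mem_image, Finset.mem_univ, true_and]
    constructor
    · rintro ⟨j, rfl⟩
      exact ⟨L j, h1 j, rfl, h2 j⟩
    · rintro ⟨Y, hY, rfl, hYI⟩
      obtain ⟨j, hj⟩ := h4 Y hY.isIndec hYI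
      exact ⟨j, (isoClass_eq_iff.2 hj).symm⟩
  · intro c hc
    simp only [Finset.mem_image, Finset.mem_univ, true_and] at hc
    obtain ⟨j, rfl⟩ := hc
    rw [← I.2.choose_spec.2]
    exact h5 j

theorem exists_rank_eq_nsmul (I : IndecClass C) (hd : I.degree k ∣ Module.finrank k K) :
    ∃ s, S.rank I.1 = I.degree k • s := by
  obtain ⟨P, h1, -, h3⟩ := S.exists_finset I hd
  have : P.Nonempty := by rw [← Finset.card_pos, h1]; exact I.degree_pos
  obtain ⟨c, hc⟩ := this
  exact ⟨_, (h3 c hc).symm⟩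

/-- The number of absolutely indecomposable objects of rank `s` over the extension, in terms of
the indecomposable objects over the base field. -/
theorem ncard_isAbsIndec (hfin : ∀ r, {I : IndecClass C | S.rank I.1 = r}.Finite) (s : V →₀ ℕ) :
    Set.ncard {c : IsoClass C' | (∃ L : C', IsAbsIndec K L ∧ isoClass L = c) ∧ S.rank' c = s} =
      ∑ᶠ I ∈ {I : IndecClass C | I.degree k ∣ Module.finrank k K ∧
        S.rank I.1 = I.degree k • s}, I.degree k := by
  classical
  have : Module.Finite k K := Module.Finite.of_finite
  have hBfin : {I : IndecClass C | I.degree k ∣ Module.finrank k K ∧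
      S.rank I.1 = I.degree k • s}.Finite := by
    refine ((Module.finrank k K).divisors.finite_toSet.biUnion
      fun d _ => hfin (d • s)).subset ?_
    rintro I ⟨h1, h2⟩
    exact Set.mem_biUnion (x := I.degree k)
      (by simpa using ⟨h1, Module.finrank_pos.ne'⟩) h2
  have hP := S.exists_finset
  choose! P hcard hmem hrank using hP
  rw [finsum_mem_eq_finite_toFinset_sum _ hBfin]
  -- Every absolutely indecomposable object is a retract of the extension of one indecomposable `I`,
  -- whose degree must divide that of `K`; the sets `P I` are disjoint because `I` is unique.
  have hset : {c : IsoClass C' | (∃ L : C', IsAbsIndec K L ∧ isoClass L = c) ∧ S.rank' c = s} =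
      ↑(hBfin.toFinset.biUnion P) := by
    ext c
    simp only [Finset.coe_biUnion, Set.mem_iUnion, Set.Finite.coe_toFinset, Finset.mem_coe,
      exists_prop]
    constructor
    · rintro ⟨⟨L, hL, rfl⟩, hs⟩
      obtain ⟨J, hJ, hLJ⟩ := S.exists_isIndec_isRetract_ext hL.isIndec
      let I : IndecClass C := ⟨isoClass J, J, hJ, rfl⟩
      obtain ⟨e⟩ := isoClass_eq_iff.1 I.2.choose_spec.2
      have hLI : IsRetract L (S.ext.obj I.2.choose) :=
        hLJ.trans (IsRetract.of_iso (S.ext.mapIso e.symm))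
      have hd : I.degree k ∣ Module.finrank k K :=
        S.residueDegree_dvd I.2.choose_spec.1 hL hLI
      have hc : isoClass L ∈ P I := (hmem I hd _).2 ⟨L, hL, rfl, hLI⟩
      refine ⟨I, ⟨hd, ?_⟩, hc⟩
      rw [← hrank I hd _ hc, hs]
    · rintro ⟨I, ⟨hd, hI⟩, hc⟩
      obtain ⟨L, hL, hLc, -⟩ := (hmem I hd _).1 hc
      refine ⟨⟨L, hL, hLc⟩, ?_⟩
      have h1 := (hrank I hd c hc).trans hI
      ext v
      have h2 := DFunLike.congr_fun h1 v
      rw [Finsupp.smul_apply, Finsupp.smul_apply, smul_eq_mul, smul_eq_mul] at h2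
      exact Nat.eq_of_mul_eq_mul_left I.degree_pos h2
  rw [hset, Set.ncard_coe_finset, Finset.card_biUnion]
  · refine Finset.sum_congr rfl fun I hI => ?_
    rw [Set.Finite.mem_toFinset] at hI
    exact hcard I hI.1
  · intro I hI I' hI' hne
    rw [Finset.mem_coe, Set.Finite.mem_toFinset] at hI hI'
    change Disjoint (P I) (P I')
    rw [Finset.disjoint_left]
    intro c hc hc'
    apply hne
    obtain ⟨L, hL, rfl, hLI⟩ := (hmem I hI.1 c).1 hc
    obtain ⟨L', hL', hLL', hLI'⟩ := (hmem I' hI'.1 _).1 hc'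
    obtain ⟨e⟩ := isoClass_eq_iff.1 hLL'
    have h := S.nonempty_iso_of_isRetract_ext I.2.choose_spec.1 I'.2.choose_spec.1 hL.1 hLI
      ((IsRetract.of_iso e.symm).trans hLI')
    refine Subtype.ext ?_
    rw [← I.2.choose_spec.2, ← I'.2.choose_spec.2]
    exact isoClass_eq_iff.2 h

end ScalarExtension

end KrullSchmidt

end

/-! ### Regrouping the exponents by degrees of extensions -/

namespace GradedMultiset

/-- Regrouping of a sum over the elements of `ι` by the multiples of their degrees. -/
theorem sum_range_degree_eq {V ι : Type*} [Finite V] {ρ : ι → V →₀ ℕ}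
    (hfin : ∀ r, {I | ρ I = r}.Finite) {d : ι → ℕ} (hd : ∀ I, 0 < d I)
    (hdρ : ∀ I, ∃ s, ρ I = d I • s) {q : ℚ} {A : ℕ → (V →₀ ℕ) → ℕ}
    (hA : ∀ m s, m ≠ 0 → A m s = ∑ᶠ I ∈ {I | d I ∣ m ∧ ρ I = d I • s}, d I) (a : V →₀ ℕ) :
    ∑ j ∈ Finset.range a.degree, ∑ᶠ I ∈ {I | (j + 1) • ρ I = a},
      ((ρ I).degree : ℚ) * (1 - ((q ^ d I)⁻¹) ^ (j + 1))⁻¹ =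
    a.degree * ∑ j ∈ Finset.range a.degree, ∑ᶠ s ∈ {s | (j + 1) • s = a},
      ((j : ℚ) + 1)⁻¹ * (A (j + 1) s * (1 - (q ^ (j + 1))⁻¹)⁻¹) := by
  classical
  by_cases ha : a = 0
  · simp [ha]
  have hcancel : ∀ (n : ℕ) (x y : V →₀ ℕ), n ≠ 0 → n • x = n • y → x = y := by
    intro n x y hn h
    ext v
    have h2 := DFunLike.congr_fun h v
    rw [Finsupp.smul_apply, Finsupp.smul_apply, smul_eq_mul, smul_eq_mul] at h2
    exact Nat.eq_of_mul_eq_mul_left (Nat.pos_of_ne_zero hn) h2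
  have hTfin : {I | ∃ n : ℕ, n ≠ 0 ∧ n • ρ I = a}.Finite := by
    refine ((Finset.Iic a).finite_toSet.biUnion fun r _ => hfin r).subset ?_
    rintro I ⟨n, hn, h⟩
    refine Set.mem_biUnion (x := ρ I) ?_ rfl
    rw [Finset.mem_coe, Finset.mem_Iic, ← h]
    exact le_self_nsmul zero_le hn
  set T := hTfin.toFinset with hT
  have hmemT : ∀ I, I ∈ T ↔ ∃ n : ℕ, n ≠ 0 ∧ n • ρ I = a := fun I => by
    rw [hT, Set.Finite.mem_toFinset]; rfl
  have hL : ∀ j : ℕ, ∑ᶠ I ∈ {I | (j + 1) • ρ I = a},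
      ((ρ I).degree : ℚ) * (1 - ((q ^ d I)⁻¹) ^ (j + 1))⁻¹ =
      ∑ I ∈ T, if (j + 1) • ρ I = a then
        ((ρ I).degree : ℚ) * (1 - ((q ^ d I)⁻¹) ^ (j + 1))⁻¹ else 0 := by
    intro j
    rw [← Finset.sum_filter]
    refine finsum_mem_eq_sum_of_inter_support_eq _ ?_
    congr 1
    ext I
    simp only [Set.mem_ofPred_eq, Finset.coe_filter, hmemT]
    exact ⟨fun h => ⟨⟨_, j.succ_ne_zero, h⟩, h⟩, fun h => h.2⟩
  -- For `a = (j + 1) • s`, the factor `a.degree / (j + 1)` equals `s.degree`. It multiplies each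
  -- weight `d I` in the descent formula to `d I * s.degree`, the degree of `ρ I`.
  have hR : ∀ j : ℕ, (a.degree : ℚ) * ∑ᶠ s ∈ {s | (j + 1) • s = a},
      ((j : ℚ) + 1)⁻¹ * (A (j + 1) s * (1 - (q ^ (j + 1))⁻¹)⁻¹) =
      ∑ I ∈ T, if d I ∣ j + 1 ∧ ((j + 1) / d I) • ρ I = a then
        ((ρ I).degree : ℚ) * (1 - (q ^ (j + 1))⁻¹)⁻¹ else 0 := by
    intro j
    by_cases hs : ∃ s, (j + 1) • s = a
    · obtain ⟨s, rfl⟩ := hs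
      have h1 : {s' : V →₀ ℕ | (j + 1) • s' = (j + 1) • s} = {s} := by
        ext s'
        exact ⟨fun h => hcancel _ _ _ j.succ_ne_zero h, fun h => by rw [h]; rfl⟩
      have hiff : ∀ I, (d I ∣ j + 1 ∧ ((j + 1) / d I) • ρ I = (j + 1) • s) ↔
          (d I ∣ j + 1 ∧ ρ I = d I • s) := by
        intro I
        refine and_congr_right ?_
        rintro ⟨e, he⟩
        have he0 : e ≠ 0 := by rintro rfl; omega
        rw [he, Nat.mul_div_cancel_left _ (hd I), mul_comm, mul_smul]
        exact ⟨fun h => hcancel _ _ _ he0 h, fun h => by rw [h]⟩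
      rw [h1, finsum_mem_singleton, hA _ _ j.succ_ne_zero]
      have h2 : ∑ᶠ I ∈ {I | d I ∣ j + 1 ∧ ρ I = d I • s}, d I =
          ∑ I ∈ T, if d I ∣ j + 1 ∧ ρ I = d I • s then d I else 0 := by
        rw [← Finset.sum_filter]
        refine finsum_mem_eq_sum_of_inter_support_eq _ ?_
        congr 1
        ext I
        simp only [Set.mem_ofPred_eq, Finset.coe_filter, hmemT]
        refine ⟨fun h => ⟨⟨(j + 1) / d I, ?_, ((hiff I).2 h).2⟩, h⟩, fun h => h.2⟩
        exact (Nat.div_pos (Nat.le_of_dvd j.succ_pos h.1) (hd I)).ne'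
      rw [h2, map_nsmul]
      push_cast
      rw [Finset.sum_mul, Finset.mul_sum, Finset.mul_sum]
      refine Finset.sum_congr rfl fun I _ => ?_
      by_cases h : d I ∣ j + 1 ∧ ρ I = d I • s
      · rw [if_pos h, if_pos ((hiff I).2 h), h.2, map_nsmul]
        have : ((j : ℚ) + 1) ≠ 0 := by positivity
        simp only [smul_eq_mul]
        push_cast
        field_simp
      · rw [if_neg h, if_neg (fun h' => h ((hiff I).1 h'))]
        simp
    · have h1 : {s' : V →₀ ℕ | (j + 1) • s' = a} = ∅ := by
        ext s'
        exact ⟨fun h => hs ⟨s', h⟩, fun h => h.elim⟩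
      rw [h1, finsum_mem_empty, mul_zero]
      refine (Finset.sum_eq_zero fun I _ => if_neg ?_).symm
      rintro ⟨⟨e, he⟩, h⟩
      -- Divisibility of the rank by `d I` excludes contributions on the right when `a` is not a
      -- multiple of `j + 1`.
      obtain ⟨s, hs'⟩ := hdρ I
      rw [he, Nat.mul_div_cancel_left _ (hd I), hs', smul_smul, mul_comm, ← he] at h
      exact hs ⟨s, h⟩
  rw [Finset.sum_congr rfl fun j _ => hL j, Finset.mul_sum, Finset.sum_congr rfl fun j _ => hR j,
    Finset.sum_comm, Finset.sum_comm (t := T)]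
  refine Finset.sum_congr rfl fun I _ => ?_
  rw [← Finset.sum_filter, ← Finset.sum_filter]
  obtain ⟨s, hs⟩ := hdρ I
  -- The substitution is m = d I · (j + 1), shifted by one because the index `j` stands for `j + 1`.
  refine Finset.sum_bij (fun j _ => d I * (j + 1) - 1) ?_ ?_ ?_ ?_
  · intro j hj
    rw [Finset.mem_filter, Finset.mem_range] at hj ⊢
    have h1 : 0 < d I * (j + 1) := Nat.mul_pos (hd I) j.succ_pos
    rw [Nat.sub_add_cancel h1, Nat.mul_div_cancel_left _ (hd I)]
    refine ⟨?_, dvd_mul_right _ _, hj.2⟩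
    have h2 : a.degree = d I * (j + 1) * s.degree := by
      rw [← hj.2, hs, map_nsmul, map_nsmul, smul_eq_mul, smul_eq_mul]; ring
    have h3 : s.degree ≠ 0 := by
      intro h0
      rw [h0, mul_zero, Finsupp.degree_eq_zero_iff] at h2
      exact ha h2
    have h4 : d I * (j + 1) ≤ a.degree := by
      rw [h2]; exact Nat.le_mul_of_pos_right _ (Nat.pos_of_ne_zero h3)
    omega
  · intro j hj j' hj' h
    have h1 : 0 < d I * (j + 1) := Nat.mul_pos (hd I) j.succ_pos
    have h2 : 0 < d I * (j' + 1) := Nat.mul_pos (hd I) j'.succ_pos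
    have h3 : d I * (j + 1) = d I * (j' + 1) := by
      omega
    have := Nat.eq_of_mul_eq_mul_left (hd I) h3
    omega
  · intro m hm
    rw [Finset.mem_filter, Finset.mem_range] at hm
    obtain ⟨hm1, ⟨e, he⟩, hm2⟩ := hm
    rw [he, Nat.mul_div_cancel_left _ (hd I)] at hm2
    have he0 : e ≠ 0 := by rintro rfl; omega
    obtain ⟨e', rfl⟩ := Nat.exists_eq_succ_of_ne_zero he0
    refine ⟨e', ?_, ?_⟩
    · rw [Finset.mem_filter, Finset.mem_range]
      refine ⟨?_, hm2⟩
      have : e'.succ ≤ d I * e'.succ := Nat.le_mul_of_pos_left _ (hd I)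
      omega
    · change d I * e'.succ - 1 = m
      omega
  · intro j hj
    have h1 : 0 < d I * (j + 1) := Nat.mul_pos (hd I) j.succ_pos
    rw [Nat.sub_add_cancel h1, inv_pow, pow_mul]

end GradedMultiset

/-! ### The category of locally free representations -/

section

open CategoryTheory CategoryTheory.Limits

universe u v w

/-- Locally free representations of the quiver `V` over `R`. -/
structure LFRep (V : Type v) [Quiver.{w} V] (R : Type u) [CommRing R] where
  /-- the underlying representation -/
  toRep : QuiverRep V R
  isLocallyFree : toRep.IsLocallyFree

namespace LFRep

variable {V : Type v} [Quiver.{w} V] {R : Type u} [CommRing R]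

instance (M : LFRep V R) (i : V) : Module.Free R (M.toRep.obj i) := (M.isLocallyFree i).1

instance (M : LFRep V R) (i : V) : Module.Finite R (M.toRep.obj i) := (M.isLocallyFree i).2

/-- The module of morphisms of representations. -/
def homSubmodule (M N : QuiverRep V R) : Submodule R (∀ i, M.obj i →ₗ[R] N.obj i) where
  carrier := {f | ∀ (i j : V) (a : i ⟶ j), N.map a ∘ₗ f i = f j ∘ₗ M.map a}
  add_mem' hf hg i j a := by
    simp only [Pi.add_apply, LinearMap.comp_add, LinearMap.add_comp, hf i j a, hg i j a]
  zero_mem' i j a := by simp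
  smul_mem' c f hf i j a := by
    simp only [Pi.smul_apply, LinearMap.comp_smul, LinearMap.smul_comp, hf i j a]

instance : Category (LFRep V R) where
  Hom M N := homSubmodule M.toRep N.toRep
  id M := ⟨fun _ => LinearMap.id, fun _ _ _ => by rw [LinearMap.comp_id, LinearMap.id_comp]⟩
  comp f g := ⟨fun i => g.1 i ∘ₗ f.1 i, fun i j a => by
    rw [← LinearMap.comp_assoc, g.2 i j a, LinearMap.comp_assoc, f.2 i j a,
      LinearMap.comp_assoc]⟩

/-- The component of a morphism at a vertex. -/
def app {M N : LFRep V R} (f : M ⟶ N) (i : V) : M.toRep.obj i →ₗ[R] N.toRep.obj i :=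
  (show homSubmodule M.toRep N.toRep from f).1 i

/-- A morphism from its components. -/
def homMk {M N : LFRep V R} (f : ∀ i, M.toRep.obj i →ₗ[R] N.toRep.obj i)
    (hf : ∀ (i j : V) (a : i ⟶ j) (x : M.toRep.obj i), N.toRep.map a (f i x) =
      f j (M.toRep.map a x)) : M ⟶ N :=
  show homSubmodule M.toRep N.toRep from ⟨f, fun i j a => LinearMap.ext (hf i j a)⟩

theorem map_app {M N : LFRep V R} (f : M ⟶ N) {i j : V} (a : i ⟶ j) (x : M.toRep.obj i) :
    N.toRep.map a (app f i x) = app f j (M.toRep.map a x) :=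
  LinearMap.congr_fun ((show homSubmodule M.toRep N.toRep from f).2 i j a) x

theorem hom_ext {M N : LFRep V R} {f g : M ⟶ N} (h : ∀ i x, app f i x = app g i x) : f = g :=
  Subtype.ext (funext fun i => LinearMap.ext (h i))

@[simp]
theorem app_id (M : LFRep V R) (i : V) : app (𝟙 M) i = LinearMap.id := rfl

@[simp]
theorem app_comp {M N P : LFRep V R} (f : M ⟶ N) (g : N ⟶ P) (i : V) :
    app (f ≫ g) i = app g i ∘ₗ app f i := rfl

instance : Preadditive (LFRep V R) where
  homGroup M N := inferInstanceAs (AddCommGroup (homSubmodule M.toRep N.toRep))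
  add_comp _ _ _ f f' g := hom_ext fun i x => map_add (app g i) (app f i x) (app f' i x)
  comp_add _ _ _ _ _ _ := rfl

@[simp]
theorem app_add {M N : LFRep V R} (f g : M ⟶ N) (i : V) : app (f + g) i = app f i + app g i :=
  rfl

@[simp]
theorem app_zero {M N : LFRep V R} (i : V) : app (0 : M ⟶ N) i = 0 := rfl

@[simp]
theorem app_sum {M N : LFRep V R} {ι : Type*} (s : Finset ι) (f : ι → (M ⟶ N)) (i : V) :
    app (∑ j ∈ s, f j) i = ∑ j ∈ s, app (f j) i := by
  classical
  induction s using Finset.induction_on with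
  | empty => simp
  | insert a s ha ih => rw [Finset.sum_insert ha, Finset.sum_insert ha, app_add, ih]

instance {k : Type*} [CommRing k] [Algebra k R] : Linear k (LFRep V R) where
  homModule M N := Module.compHom (homSubmodule M.toRep N.toRep) (algebraMap k R)
  smul_comp _ _ _ c f g := hom_ext fun i x => map_smul (app g i) (algebraMap k R c) (app f i x)
  comp_smul _ _ _ _ _ _ := rfl

@[simp]
theorem app_smul {k : Type*} [CommRing k] [Algebra k R] {M N : LFRep V R} (c : k) (f : M ⟶ N)
    (i : V) : app (c • f) i = algebraMap k R c • app f i := rfl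

instance [Finite V] [Finite R] (M N : LFRep V R) : Finite (M ⟶ N) := by
  have h1 (i : V) : Finite (M.toRep.obj i) := Module.finite_of_finite R
  have h2 (i : V) : Finite (N.toRep.obj i) := Module.finite_of_finite R
  have h3 (i : V) : Finite (M.toRep.obj i →ₗ[R] N.toRep.obj i) := DFunLike.finite _
  exact inferInstanceAs (Finite (homSubmodule M.toRep N.toRep))

/-- The product of finitely many representations. -/
def pi {J : Type} [Finite J] (F : J → LFRep V R) : LFRep V R where
  toRep :=
    { obj := fun i => ∀ j, (F j).toRep.obj i
      map := fun a => LinearMap.pi fun j => (F j).toRep.map a ∘ₗ LinearMap.proj j }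
  isLocallyFree i :=
    ⟨inferInstanceAs (Module.Free R (∀ j, (F j).toRep.obj i)),
      inferInstanceAs (Module.Finite R (∀ j, (F j).toRep.obj i))⟩

/-- The projections from a product. -/
def piProj {J : Type} [Finite J] (F : J → LFRep V R) (j : J) : pi F ⟶ F j :=
  homMk (fun _ => LinearMap.proj j) fun _ _ _ _ => rfl

/-- The inclusions into a product. -/
def piSingle {J : Type} [Finite J] [DecidableEq J] (F : J → LFRep V R) (j : J) : F j ⟶ pi F :=
  homMk (fun i => LinearMap.single R (fun j => (F j).toRep.obj i) j) fun i i' a x => by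
    funext j'
    change (F j').toRep.map a ((Pi.single j x : ∀ j, (F j).toRep.obj i) j') = (Pi.single j ((F j).toRep.map a x) :
      ∀ j, (F j).toRep.obj i') j'
    by_cases h : j' = j
    · subst h; rw [Pi.single_eq_same, Pi.single_eq_same]
    · rw [Pi.single_eq_of_ne h, Pi.single_eq_of_ne h, map_zero]

instance : HasFiniteBiproducts (LFRep V R) where
  out n :=
    { has_biproduct := fun F => hasBiproduct_of_total
        { pt := pi F
          π := piProj F
          ι := piSingle F
          ι_π := fun j j' => by
            by_cases h : j = j'
            · subst h
              rw [dif_pos rfl]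
              exact hom_ext fun i x => Pi.single_eq_same (M := fun j => (F j).toRep.obj i) j x
            · rw [dif_neg h]
              exact hom_ext fun i x =>
                Pi.single_eq_of_ne (M := fun j => (F j).toRep.obj i) (Ne.symm h) x }
        (hom_ext fun i x => by
          rw [app_sum]
          exact (LinearMap.sum_apply _ _ _).trans
            (Finset.univ_sum_single (x : ∀ j, (F j).toRep.obj i))) }

instance : HasBinaryBiproducts (LFRep V R) := hasBinaryBiproducts_of_finite_biproducts _

/-- The image of an idempotent is a direct summand, hence finite and projective at each vertex, and
such modules are free over a local ring. -/
instance [IsLocalRing R] : IsIdempotentComplete (LFRep V R) where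
  idempotents_split M e he := by
    have he' : ∀ i x, app e i (app e i x) = app e i x := fun i x =>
      LinearMap.congr_fun (congrArg (fun f : M ⟶ M => app f i) he) x
    have hmem : ∀ i, ∀ y ∈ LinearMap.range (app e i), app e i y = y := by
      rintro i _ ⟨x, rfl⟩
      exact he' i x
    let L : LFRep V R :=
      { toRep :=
          { obj := fun i => LinearMap.range (app e i)
            map := fun {i j} a => (M.toRep.map a).restrict (by
              rintro _ ⟨x, rfl⟩
              exact ⟨M.toRep.map a x, (map_app e a x).symm⟩) }
        isLocallyFree := fun i => by
          have h1 : Module.Projective R (LinearMap.range (app e i)) :=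
            Module.Projective.of_split (LinearMap.range (app e i)).subtype
              (app e i).rangeRestrict (LinearMap.ext fun y => Subtype.ext (hmem i _ y.2))
          have h2 : Module.Finite R (LinearMap.range (app e i)) := inferInstance
          exact ⟨Module.free_of_flat_of_isLocalRing, h2⟩ }
    refine ⟨L, homMk (fun i => (LinearMap.range (app e i)).subtype) fun _ _ _ _ => rfl,
      homMk (fun i => (app e i).rangeRestrict) fun i j a x => Subtype.ext (map_app e a x), ?_, ?_⟩
    · exact hom_ext fun i y => Subtype.ext (hmem i _ y.2)
    · exact hom_ext fun i x => rfl

/-- An isomorphism of objects gives linear equivalences at all vertices. -/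
def isoApp {M N : LFRep V R} (e : M ≅ N) (i : V) : M.toRep.obj i ≃ₗ[R] N.toRep.obj i :=
  LinearEquiv.ofLinearMap (app e.hom i) (app e.inv i)
    (by rw [← app_comp, e.inv_hom_id, app_id]) (by rw [← app_comp, e.hom_inv_id, app_id])

theorem isIso_toRep_iff {M N : LFRep V R} : M.toRep.IsIso N.toRep ↔ Nonempty (M ≅ N) := by
  constructor
  · rintro ⟨φ, hφ⟩
    refine ⟨⟨homMk (fun i => (φ i).toLinearMap) fun i j a x => (hφ i j a x).symm,
      homMk (fun i => (φ i).symm.toLinearMap) fun i j a x => ?_, ?_, ?_⟩⟩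
    · exact (((φ j).symm_apply_eq).2 (by
        change N.toRep.map a x = φ j (M.toRep.map a ((φ i).symm x))
        rw [hφ, LinearEquiv.apply_symm_apply])).symm
    · exact hom_ext fun i x => (φ i).symm_apply_apply x
    · exact hom_ext fun i x => (φ i).apply_symm_apply x
  · rintro ⟨e⟩
    exact ⟨isoApp e, fun i j a x => (map_app e.hom a x).symm⟩

open KrullSchmidt

theorem finrank_biprod [Nontrivial R] (M N : LFRep V R) (i : V) :
    Module.finrank R ((M ⊞ N).toRep.obj i) =
      Module.finrank R (M.toRep.obj i) + Module.finrank R (N.toRep.obj i) := by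
  rw [← Module.finrank_prod]
  refine LinearEquiv.finrank_eq (LinearEquiv.ofLinearMap
    ((app (biprod.fst : M ⊞ N ⟶ M) i).prod (app (biprod.snd : M ⊞ N ⟶ N) i))
    ((app (biprod.inl : M ⟶ M ⊞ N) i).coprod (app (biprod.inr : N ⟶ M ⊞ N) i)) ?_ ?_)
  · have h1 : ∀ x, app (biprod.fst : M ⊞ N ⟶ M) i (app (biprod.inl : M ⟶ M ⊞ N) i x) = x :=
      fun x => LinearMap.congr_fun (congrArg (fun f : M ⟶ M => app f i) biprod.inl_fst) x
    have h2 : ∀ x, app (biprod.snd : M ⊞ N ⟶ N) i (app (biprod.inl : M ⟶ M ⊞ N) i x) = 0 :=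
      fun x => LinearMap.congr_fun (congrArg (fun f : M ⟶ N => app f i) biprod.inl_snd) x
    have h3 : ∀ x, app (biprod.fst : M ⊞ N ⟶ M) i (app (biprod.inr : N ⟶ M ⊞ N) i x) = 0 :=
      fun x => LinearMap.congr_fun (congrArg (fun f : N ⟶ M => app f i) biprod.inr_fst) x
    have h4 : ∀ x, app (biprod.snd : M ⊞ N ⟶ N) i (app (biprod.inr : N ⟶ M ⊞ N) i x) = x :=
      fun x => LinearMap.congr_fun (congrArg (fun f : N ⟶ N => app f i) biprod.inr_snd) x
    refine LinearMap.ext fun x => Prod.ext ?_ ?_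
    · simp [h1, h3]
    · simp [h2, h4]
  · exact LinearMap.ext fun x =>
      LinearMap.congr_fun (congrArg (fun f : M ⊞ N ⟶ M ⊞ N => app f i) biprod.total) x

section Rank

variable (V R) [Finite V]

/-- The rank vector as a function on isomorphism classes. -/
noncomputable def rankHom [Nontrivial R] : IsoClass (LFRep V R) →+ (V →₀ ℕ) where
  toFun := Quotient.lift (fun M => Finsupp.equivFunOnFinite.symm M.toRep.rank) (by
    rintro M N ⟨e⟩
    exact congrArg _ (funext fun i => (isoApp e i).finrank_eq))
  map_zero' := by
    obtain ⟨Z, hZ⟩ := Quotient.exists_rep (0 : IsoClass (LFRep V R))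
    rw [← hZ]
    have h1 : 𝟙 Z = 0 := isoClass_eq_zero.1 hZ
    ext i
    change Module.finrank R (Z.toRep.obj i) = 0
    have : Subsingleton (Z.toRep.obj i) := ⟨fun x y => by
      have h2 : ∀ z : Z.toRep.obj i, z = 0 := fun z =>
        LinearMap.congr_fun (congrArg (fun f : Z ⟶ Z => app f i) h1) z
      rw [h2 x, h2 y]⟩
    exact Module.finrank_zero_of_subsingleton
  map_add' c c' := by
    induction c using Quotient.inductionOn with | _ M
    induction c' using Quotient.inductionOn with | _ N
    have h1 : (Quotient.mk _ M : IsoClass (LFRep V R)) + Quotient.mk _ N = isoClass (M ⊞ N) :=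
      (isoClass_biprod M N).symm
    rw [h1]
    ext i
    exact finrank_biprod M N i

variable {V R}

theorem rankHom_eq_zero [Nontrivial R] (c : IsoClass (LFRep V R)) (h : rankHom V R c = 0) :
    c = 0 := by
  induction c using Quotient.inductionOn with | _ M
  refine isoClass_eq_zero.2 (hom_ext fun i x => ?_)
  have h1 : Module.finrank R (M.toRep.obj i) = 0 := DFunLike.congr_fun h i
  have : Subsingleton (M.toRep.obj i) := by
    rwa [Module.finrank_eq_zero_iff_of_free] at h1
  exact Subsingleton.elim _ _

/-- The representation given by a family of matrices. -/
def ofMatrix (r : V → ℕ) (x : RepSpace r R) : LFRep V R where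
  toRep :=
    { obj := fun i => Fin (r i) → R
      map := fun {i j} a => Matrix.toLin' (x i j a) }
  isLocallyFree i := ⟨inferInstanceAs (Module.Free R (Fin (r i) → R)),
    inferInstanceAs (Module.Finite R (Fin (r i) → R))⟩

theorem rankHom_ofMatrix [Nontrivial R] (r : V → ℕ) (x : RepSpace r R) :
    rankHom V R (isoClass (ofMatrix r x)) = Finsupp.equivFunOnFinite.symm r := by
  ext i
  exact Module.finrank_fin_fun R

omit [Finite V] in
theorem exists_ofMatrix [Nontrivial R] (M : LFRep V R) :
    ∃ x : RepSpace M.toRep.rank R, Nonempty (ofMatrix M.toRep.rank x ≅ M) := by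
  let b : ∀ i, Module.Basis (Fin (M.toRep.rank i)) R (M.toRep.obj i) := fun i =>
    Module.finBasis R (M.toRep.obj i)
  refine ⟨fun i j a => LinearMap.toMatrix (b i) (b j) (M.toRep.map a), isIso_toRep_iff.1
    (QuiverRep.IsIso.symm ⟨fun i => (b i).equivFun, fun i j a x => ?_⟩)⟩
  change (b j).equivFun (M.toRep.map a x) =
    (LinearMap.toMatrix (b i) (b j) (M.toRep.map a)).mulVec ((b i).repr x)
  rw [LinearMap.toMatrix_mulVec_repr]
  rfl

end Rank

end LFRep

end

/-! ### Extension of scalars and its effect on morphisms -/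

section

open CategoryTheory CategoryTheory.Limits

universe u v w

namespace LFRep

variable {V : Type v} [Quiver.{w} V] {R T : Type u} [CommRing R] [CommRing T] [Algebra R T]

section Ext

variable (V R T) in
/-- Extension of scalars. -/
noncomputable def extFunctor : LFRep V R ⥤ LFRep V T where
  obj M := ⟨M.toRep.baseChange T, fun i =>
    ⟨inferInstanceAs (Module.Free T (T ⊗[R] M.toRep.obj i)),
      inferInstanceAs (Module.Finite T (T ⊗[R] M.toRep.obj i))⟩⟩
  map {M N} f := homMk (fun i => (app f i).baseChange T) fun i j a x =>
    LinearMap.congr_fun (f := (N.toRep.map a).baseChange T ∘ₗ (app f i).baseChange T)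
      (g := (app f j).baseChange T ∘ₗ (M.toRep.map a).baseChange T) (by
        rw [← LinearMap.baseChange_comp, ← LinearMap.baseChange_comp]
        exact congrArg _ (LinearMap.ext (map_app f a))) x
  map_id M := hom_ext fun i x => LinearMap.congr_fun (LinearMap.baseChange_id (R := R) (A := T)
    (M := M.toRep.obj i)) x
  map_comp f g := hom_ext fun i x =>
    LinearMap.congr_fun (LinearMap.baseChange_comp (A := T) (app f i) (app g i)) x

/-- An element of an extension of scalars. -/
def tmul {M : LFRep V R} {i : V} (t : T) (m : M.toRep.obj i) :
    ((extFunctor V R T).obj M).toRep.obj i := t ⊗ₜ[R] m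

theorem map_tmul {M : LFRep V R} {i j : V} (a : i ⟶ j) (t : T) (m : M.toRep.obj i) :
    ((extFunctor V R T).obj M).toRep.map a (tmul t m) = tmul t (M.toRep.map a m) := rfl

theorem app_ext_tmul {M N : LFRep V R} (f : M ⟶ N) (i : V) (t : T) (m : M.toRep.obj i) :
    app ((extFunctor V R T).map f) i (tmul t m) = tmul t (app f i m) := rfl

theorem smul_tmul {M : LFRep V R} {i : V} (t t' : T) (m : M.toRep.obj i) :
    t • tmul t' m = tmul (t * t') m := rfl

theorem tmul_induction {M : LFRep V R} {i : V}
    {P : ((extFunctor V R T).obj M).toRep.obj i → Prop} (h0 : P 0)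
    (h1 : ∀ (t : T) (m : M.toRep.obj i), P (tmul t m))
    (h2 : ∀ x y, P x → P y → P (x + y)) (x) : P x :=
  TensorProduct.induction_on x h0 h1 h2

theorem ext_hom_ext {M : LFRep V R} {L : LFRep V T} {f g : (extFunctor V R T).obj M ⟶ L}
    (h : ∀ i (m : M.toRep.obj i), app f i (tmul 1 m) = app g i (tmul 1 m)) : f = g := by
  refine hom_ext fun i x => ?_
  refine tmul_induction (P := fun x => app f i x = app g i x) (by rw [map_zero, map_zero]) (fun t m => ?_) (fun x y hx hy => ?_) x
  · rw [← mul_one t, ← smul_tmul, map_smul, map_smul, h]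
  · rw [map_add, map_add, hx, hy]

instance : (extFunctor V R T).Additive where
  map_add {_ _ f g} := hom_ext fun i x =>
    LinearMap.congr_fun (LinearMap.baseChange_add (A := T) (app f i) (app g i)) x

section Coord

variable {ι : Type*} (b : Module.Basis ι R T)

open Classical in
/-- The coordinates of an element of an extension of scalars. -/
noncomputable def coord {M : LFRep V R} {i : V} :
    ((extFunctor V R T).obj M).toRep.obj i →+ (ι →₀ M.toRep.obj i) :=
  (TensorProduct.equivFinsuppOfBasisLeft (N := M.toRep.obj i) b).toAddMonoidHom

theorem coord_tmul {M : LFRep V R} {i : V} (t : T) (m : M.toRep.obj i) (j : ι) :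
    coord b (tmul t m) j = b.repr t j • m := by
  classical
  exact TensorProduct.equivFinsuppOfBasisLeft_apply_tmul_apply b t m j

theorem sum_coord {M : LFRep V R} {i : V} (z : ((extFunctor V R T).obj M).toRep.obj i)
    {s : Finset ι} (hs : (coord b z).support ⊆ s) : ∑ j ∈ s, tmul (b j) (coord b z j) = z := by
  classical
  have h1 := TensorProduct.equivFinsuppOfBasisLeft_symm_apply b (coord b z)
  rw [Finsupp.sum_of_support_subset _ hs _ fun j _ => TensorProduct.tmul_zero _ _] at h1
  exact h1.symm.trans
    ((TensorProduct.equivFinsuppOfBasisLeft (N := M.toRep.obj i) b).symm_apply_apply z)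

theorem coord_map {M N : LFRep V R} {i i' : V} (f : M.toRep.obj i →ₗ[R] N.toRep.obj i')
    (z : ((extFunctor V R T).obj M).toRep.obj i) (j : ι) :
    coord b (M := N) (i := i') (f.baseChange T z) j = f (coord b z j) := by
  refine tmul_induction (P := fun z => coord b (M := N) (i := i') (f.baseChange T z) j =
    f (coord b z j)) ?_ (fun t m => ?_) (fun x y hx hy => ?_) z
  · have h : f.baseChange T (0 : T ⊗[R] M.toRep.obj i) = 0 := map_zero _
    refine (congrArg (fun z => coord b (M := N) (i := i') z j) h).trans ?_
    rw [map_zero, Finsupp.zero_apply, map_zero]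
    exact congrArg (fun z : ι →₀ N.toRep.obj i' => z j) (map_zero (coord b (M := N) (i := i')))
  · refine (coord_tmul b t (f m) j).trans ?_
    rw [coord_tmul, map_smul]
  · have h := map_add (f.baseChange T) x y
    refine (congrArg (fun z => coord b (M := N) (i := i') z j) h).trans ?_
    refine (congrArg (fun z : ι →₀ N.toRep.obj i' => z j) (map_add (coord b (M := N) (i := i'))
      (f.baseChange T x) (f.baseChange T y))).trans ?_
    rw [map_add, Finsupp.add_apply, Finsupp.add_apply, map_add]
    exact congrArg₂ _ hx hy

theorem coord_smul {M : LFRep V R} {i : V} (r : R) (z : ((extFunctor V R T).obj M).toRep.obj i)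
    (j : ι) : coord b (algebraMap R T r • z) j = r • coord b z j := by
  refine tmul_induction (P := fun z => coord b (algebraMap R T r • z) j = r • coord b z j)
    (by simp) (fun t m => ?_) (fun x y hx hy => ?_) z
  · rw [smul_tmul, coord_tmul, coord_tmul, ← Algebra.smul_def, map_smul, Finsupp.smul_apply,
      smul_smul, smul_eq_mul]
  · rw [smul_add, map_add, map_add, Finsupp.add_apply, Finsupp.add_apply, smul_add, hx, hy]

theorem tmul_one_smul {M : LFRep V R} {i : V} (r : R) (m : M.toRep.obj i) :
    (tmul 1 (r • m) : ((extFunctor V R T).obj M).toRep.obj i) = algebraMap R T r • tmul 1 m := by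
  have : (1 : T) ⊗ₜ[R] (r • m) = (algebraMap R T r * 1) ⊗ₜ[R] m := by
    rw [TensorProduct.tmul_smul, TensorProduct.smul_tmul', Algebra.smul_def]
  exact this

/-- The coordinates of a morphism between extensions of scalars. -/
noncomputable def homCoord {M N : LFRep V R}
    (g : (extFunctor V R T).obj M ⟶ (extFunctor V R T).obj N) (j : ι) : M ⟶ N :=
  homMk (fun i =>
    { toFun := fun m => coord b (app g i (tmul 1 m)) j
      map_add' := fun x y => by
        have : (tmul 1 (x + y) : ((extFunctor V R T).obj M).toRep.obj i) = tmul 1 x + tmul 1 y :=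
          TensorProduct.tmul_add _ _ _
        rw [this, map_add, map_add, Finsupp.add_apply]
      map_smul' := fun r x => by
        rw [tmul_one_smul, map_smul, coord_smul, RingHom.id_apply] })
    fun i i' a m => by
      change N.toRep.map a (coord b (app g i (tmul 1 m)) j) =
        coord b (app g i' (tmul 1 (M.toRep.map a m))) j
      rw [← map_tmul, ← map_app, ← coord_map b (N.toRep.map a)]
      rfl

theorem app_homCoord {M N : LFRep V R}
    (g : (extFunctor V R T).obj M ⟶ (extFunctor V R T).obj N) (j : ι) (i : V)
    (m : M.toRep.obj i) : app (homCoord b g j) i m = coord b (app g i (tmul 1 m)) j := rfl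

/-- A morphism between extensions of scalars is a combination of extensions of morphisms. -/
theorem exists_sum_homCoord [Finite V] {M N : LFRep V R}
    (g : (extFunctor V R T).obj M ⟶ (extFunctor V R T).obj N) :
    ∃ s : Finset ι, ∑ j ∈ s, b j • (extFunctor V R T).map (homCoord b g j) = g := by
  classical
  have := Fintype.ofFinite V
  let bM : ∀ i, Module.Basis (Module.Free.ChooseBasisIndex R (M.toRep.obj i)) R
      (M.toRep.obj i) := fun i => Module.Free.chooseBasis R (M.toRep.obj i)
  let s : Finset ι := Finset.univ.biUnion fun i => Finset.univ.biUnion fun l =>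
    (coord b (app g i (tmul 1 (bM i l)))).support
  refine ⟨s, hom_ext fun i => LinearMap.congr_fun ?_⟩
  refine (Algebra.TensorProduct.basis T (bM i)).ext fun l => ?_
  rw [Algebra.TensorProduct.basis_apply]
  change app _ i (tmul 1 (bM i l)) = app _ i (tmul 1 (bM i l))
  rw [app_sum, LinearMap.sum_apply]
  refine Eq.trans (Finset.sum_congr rfl fun j _ => ?_) (sum_coord b (s := s)
    (app g i (tmul 1 (bM i l))) ?_)
  · rw [app_smul, LinearMap.smul_apply, app_ext_tmul, smul_tmul, app_homCoord]
    simp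
  · refine Finset.Subset.trans ?_ (Finset.subset_biUnion_of_mem _ (Finset.mem_univ i))
    exact Finset.subset_biUnion_of_mem (fun l => (coord b (app g i (tmul 1 (bM i l)))).support)
      (Finset.mem_univ l)

/-- Evaluation at 1 ⊗ m gives ∑ b_j ⊗ f_j(m), whose coordinates with respect to the basis are
unique. -/
theorem eq_zero_of_sum_smul_map_eq_zero {M N : LFRep V R} {s : Finset ι} {f : ι → (M ⟶ N)}
    (h : ∑ j ∈ s, b j • (extFunctor V R T).map (f j) = 0) : ∀ j ∈ s, f j = 0 := by
  classical
  intro j hj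
  refine hom_ext fun i m => ?_
  have h1 := congrArg (fun g => coord b (app g i (tmul 1 m)) j) h
  have h2 : app (∑ j ∈ s, b j • (extFunctor V R T).map (f j)) i (tmul 1 m) =
      ∑ j ∈ s, tmul (b j) (app (f j) i m) := by
    rw [app_sum, LinearMap.sum_apply]
    refine Finset.sum_congr rfl fun j _ => ?_
    rw [app_smul, LinearMap.smul_apply, app_ext_tmul, smul_tmul]
    simp
  simp only [h2, map_sum, Finsupp.finsetSum_apply, coord_tmul, Module.Basis.repr_self] at h1
  rw [Finset.sum_eq_single j] at h1
  · simpa using h1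
  · intro l _ hl
    rw [Finsupp.single_eq_of_ne (Ne.symm hl), zero_smul]
  · exact fun h => (h hj).elim

end Coord

end Ext

section End

variable {k K : Type*} [CommRing k] [CommRing K] [Algebra k K] [Algebra k R] [Algebra K T]
  [Algebra k T] [IsScalarTower k R T] [IsScalarTower k K T]

theorem ext_map_smul {M N : LFRep V R} (c : k) (f : M ⟶ N) :
    (extFunctor V R T).map (c • f) = c • (extFunctor V R T).map f := by
  refine ext_hom_ext fun i m => ?_
  rw [app_ext_tmul, app_smul, app_smul, LinearMap.smul_apply, LinearMap.smul_apply,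
    tmul_one_smul, ← IsScalarTower.algebraMap_apply, app_ext_tmul]

/-- Extension of scalars on endomorphisms. -/
noncomputable def extEnd (X : LFRep V R) : End X →ₐ[k] End ((extFunctor V R T).obj X) where
  toFun f := (extFunctor V R T).map f
  map_one' := (extFunctor V R T).map_id X
  map_mul' f g := (extFunctor V R T).map_comp g f
  map_zero' := (extFunctor V R T).map_zero X X
  map_add' _ _ := (extFunctor V R T).map_add
  commutes' c := by
    change (extFunctor V R T).map (c • 𝟙 X) = c • 𝟙 _
    rw [ext_map_smul, (extFunctor V R T).map_id]

instance (X : LFRep V T) : IsScalarTower k K (End X) := by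
  refine IsScalarTower.of_algebraMap_eq fun c => hom_ext fun i x => ?_
  change algebraMap k T c • x = algebraMap K T (algebraMap k K c) • x
  rw [← IsScalarTower.algebraMap_apply]

variable (K T) in
/-- Extension of scalars on endomorphisms. -/
noncomputable def extEndHom (X : LFRep V R) :
    K ⊗[k] End X →ₐ[K] End ((extFunctor V R T).obj X) :=
  Algebra.TensorProduct.lift (Algebra.ofId K _) (extEnd (k := k) X) fun c f =>
    Algebra.commutes c (extEnd (k := k) X f)

theorem extEndHom_tmul (X : LFRep V R) (c : K) (f : End X) :
    extEndHom (k := k) T K X (c ⊗ₜ f) = c • (extFunctor V R T).map f := by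
  refine (Algebra.TensorProduct.lift_tmul _ _ _ c f).trans ?_
  exact (Algebra.smul_def c (extEnd (k := k) (T := T) X f)).symm

theorem smul_of_eq_algebraMap {M N : LFRep V T} {t : T} {c : K} (h : t = algebraMap K T c)
    (f : M ⟶ N) : t • f = c • f := hom_ext fun i x => by
  rw [app_smul, app_smul, h]; rfl

variable {ι : Type*} (bK : Module.Basis ι k K) (bT : Module.Basis ι R T)
  (hb : ∀ j, bT j = algebraMap K T (bK j))
include hb

/-- A morphism expands in a basis of `T` over `R` with coefficients extended from `R`. By `hb` this
basis comes from `K`, so the expansion lies in the image of `K ⊗ End X`. -/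
theorem extEndHom_surjective [Finite V] (X : LFRep V R) :
    Function.Surjective (extEndHom (k := k) T K X) := fun g => by
  obtain ⟨s, hs⟩ := exists_sum_homCoord bT g
  refine ⟨∑ j ∈ s, bK j ⊗ₜ (show End X from homCoord bT g j), ?_⟩
  rw [map_sum]
  refine Eq.trans (Finset.sum_congr rfl fun j _ => ?_) hs
  rw [extEndHom_tmul, smul_of_eq_algebraMap (hb j)]

theorem extEndHom_injective (X : LFRep V R) :
    Function.Injective (extEndHom (k := k) T K X) := by
  classical
  rw [injective_iff_map_eq_zero]
  intro z hz
  obtain ⟨f, rfl⟩ := TensorProduct.eq_repr_basis_left bK z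
  rw [Finsupp.sum, map_sum] at hz
  have h1 : ∑ j ∈ f.support, bT j • (extFunctor V R T).map (show X ⟶ X from f j) = 0 := by
    refine Eq.trans (Finset.sum_congr rfl fun j _ => ?_) hz
    rw [extEndHom_tmul, smul_of_eq_algebraMap (hb j)]
  have h2 := eq_zero_of_sum_smul_map_eq_zero bT h1
  rw [Finsupp.sum]
  refine Finset.sum_eq_zero fun j hj => ?_
  rw [show f j = 0 from h2 j hj, TensorProduct.tmul_zero]

end End

end LFRep

end

/-! ### Restriction of scalars and separability -/

section

open CategoryTheory CategoryTheory.Limits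

universe u v w

/-- A separability idempotent for the base change of a finite separable field extension. -/
theorem exists_separabilityIdempotent {k K R T ι : Type*} [Field k] [Field K] [Algebra k K]
    [Module.Finite k K] [Algebra.IsSeparable k K] [CommRing R] [CommRing T] [Algebra R T]
    [Algebra k R] [Algebra K T] [Algebra k T] [IsScalarTower k R T] [IsScalarTower k K T]
    [Fintype ι] {x : ι → K} (bT : Module.Basis ι R T) (hb : ∀ j, bT j = algebraMap K T (x j)) :
    ∃ e : T ⊗[R] T, (∀ t : T, (1 ⊗ₜ t) * e = t • e) ∧ Algebra.TensorProduct.lmul' R e = 1 := by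
  have := Algebra.FormallyUnramified.of_isSeparable k K
  let f : K →ₐ[k] T ⊗[R] T :=
    ((Algebra.TensorProduct.includeLeft (R := R) (S := R) (A := T) (B := T)).restrictScalars
      k).comp (IsScalarTower.toAlgHom k K T)
  let g : K →ₐ[k] T ⊗[R] T :=
    ((Algebra.TensorProduct.includeRight (R := R) (A := T) (B := T)).restrictScalars
      k).comp (IsScalarTower.toAlgHom k K T)
  let Φ : K ⊗[k] K →ₐ[k] T ⊗[R] T :=
    Algebra.TensorProduct.lift f g fun _ _ => Commute.all _ _
  have hΦ : ∀ c c' : K, Φ (c ⊗ₜ c') = algebraMap K T c ⊗ₜ algebraMap K T c' := by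
    intro c c'
    refine (Algebra.TensorProduct.lift_tmul _ _ _ c c').trans ?_
    change (algebraMap K T c ⊗ₜ[R] (1 : T)) * ((1 : T) ⊗ₜ[R] algebraMap K T c') = _
    rw [Algebra.TensorProduct.tmul_mul_tmul, mul_one, one_mul]
  refine ⟨Φ (Algebra.FormallyUnramified.elem k K), fun t => ?_, ?_⟩
  -- The commutation relation holds for scalars from `K` by separability; it passes to `T` because
  -- elements of `K` form a basis of `T` over `R`.
  · have h1 : ∀ c : K, ((1 : T) ⊗ₜ[R] algebraMap K T c) *
        Φ (Algebra.FormallyUnramified.elem k K) =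
        algebraMap K T c • Φ (Algebra.FormallyUnramified.elem k K) := by
      intro c
      have h2 := congrArg Φ (Algebra.FormallyUnramified.one_tmul_mul_elem (R := k) c)
      rw [map_mul, map_mul, hΦ, hΦ, map_one] at h2
      rw [h2, Algebra.smul_def, Algebra.TensorProduct.algebraMap_apply]
      rfl
    rw [← bT.sum_repr t, TensorProduct.tmul_sum, Finset.sum_mul, Finset.sum_smul]
    refine Finset.sum_congr rfl fun j _ => ?_
    rw [hb, TensorProduct.tmul_smul, smul_mul_assoc, h1, smul_assoc]
  · have h1 : ∀ z : K ⊗[k] K, Algebra.TensorProduct.lmul' R (Φ z) =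
        algebraMap K T (Algebra.TensorProduct.lmul' k z) := by
      intro z
      induction z using TensorProduct.induction_on with
      | zero => simp
      | add y z hy hz => rw [map_add, map_add, map_add, map_add, hy, hz]
      | tmul c c' =>
        rw [hΦ, Algebra.TensorProduct.lmul'_apply_tmul, Algebra.TensorProduct.lmul'_apply_tmul,
          map_mul]
    rw [h1, Algebra.FormallyUnramified.lmul_elem, map_one]

/-- A module over `T`, regarded as a module over `R` as well. -/
def RestrictedModule (R T M : Type*) [CommRing R] [CommRing T] [Algebra R T] [AddCommGroup M]
    [Module T M] : Type _ := M

namespace RestrictedModule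

variable (R T M : Type*) [CommRing R] [CommRing T] [Algebra R T] [AddCommGroup M] [Module T M]

instance : AddCommGroup (RestrictedModule R T M) := inferInstanceAs (AddCommGroup M)

instance instModuleTop : Module T (RestrictedModule R T M) := inferInstanceAs (Module T M)

instance instModuleBase : Module R (RestrictedModule R T M) :=
  Module.compHom M (algebraMap R T)

instance : IsScalarTower R T (RestrictedModule R T M) where
  smul_assoc r t m := by
    rw [Algebra.smul_def, mul_smul]
    rfl

end RestrictedModule

namespace LFRep

variable {V : Type v} [Quiver.{w} V] {R T : Type u} [CommRing R] [CommRing T] [Algebra R T]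
  [Module.Free R T] [Module.Finite R T]

variable (V R T) in
/-- Restriction of scalars. -/
def resFunctor : LFRep V T ⥤ LFRep V R where
  obj L :=
    { toRep :=
        { obj := fun i => RestrictedModule R T (L.toRep.obj i)
          map := fun {i j} a => (show RestrictedModule R T (L.toRep.obj i) →ₗ[T]
            RestrictedModule R T (L.toRep.obj j) from L.toRep.map a).restrictScalars R }
      isLocallyFree := fun i => by
        have h1 : Module.Free T (RestrictedModule R T (L.toRep.obj i)) := (L.isLocallyFree i).1
        have h2 : Module.Finite T (RestrictedModule R T (L.toRep.obj i)) := (L.isLocallyFree i).2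
        exact ⟨Module.Free.trans (S := T), Module.Finite.trans T _⟩ }
  map {L L'} f := homMk (fun i => (show RestrictedModule R T (L.toRep.obj i) →ₗ[T]
    RestrictedModule R T (L'.toRep.obj i) from app f i).restrictScalars R)
    fun i j a x => map_app f a x
  map_id _ := rfl
  map_comp _ _ := rfl

instance : (resFunctor V R T).Additive where
  map_add := rfl

section ResExt

variable {ι : Type*} (b : Module.Basis ι R T)

/-- The coordinates as morphisms. -/
noncomputable def resExtProj (X : LFRep V R) (j : ι) :
    (resFunctor V R T).obj ((extFunctor V R T).obj X) ⟶ X :=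
  homMk (fun i =>
    { toFun := fun z => coord b (show ((extFunctor V R T).obj X).toRep.obj i from z) j
      map_add' := fun x y => by
        refine (congrArg (fun z : ι →₀ X.toRep.obj i => z j) (map_add (coord b)
          (show ((extFunctor V R T).obj X).toRep.obj i from x) y)).trans ?_
        rfl
      map_smul' := fun r x => coord_smul b r (show ((extFunctor V R T).obj X).toRep.obj i from x) j })
    fun i i' a z => (coord_map b (X.toRep.map a) z j).symm

/-- The embeddings attached to the elements of the extension. -/
noncomputable def resExtIncl (X : LFRep V R) (t : T) :
    X ⟶ (resFunctor V R T).obj ((extFunctor V R T).obj X) :=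
  homMk (fun i =>
    { toFun := fun m => (tmul t m : ((extFunctor V R T).obj X).toRep.obj i)
      map_add' := fun x y => TensorProduct.tmul_add t x y
      map_smul' := fun r x => by
        change t ⊗ₜ[R] (r • x) = algebraMap R T r • (t ⊗ₜ[R] x)
        rw [TensorProduct.tmul_smul, algebraMap_smul] })
    fun _ _ _ _ => rfl

theorem sum_resExt [Fintype ι] (X : LFRep V R) :
    ∑ j, resExtProj b X j ≫ resExtIncl X (b j) = 𝟙 _ := by
  refine hom_ext fun i z => ?_
  rw [app_sum, LinearMap.sum_apply]
  exact sum_coord b (s := Finset.univ) (show ((extFunctor V R T).obj X).toRep.obj i from z)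
    (Finset.subset_univ _)

end ResExt

section Retract

variable {M M' : Type*} [AddCommGroup M] [Module R M] [Module T M] [IsScalarTower R T M]
  [AddCommGroup M'] [Module R M'] [Module T M'] [IsScalarTower R T M']

omit [Module.Free R T] [Module.Finite R T] in
theorem one_tmul_mul_eq (c : T) (e : T ⊗[R] T) :
    ((1 : T) ⊗ₜ[R] c) * e = (LinearMap.mulLeft R c).baseChange T e := by
  induction e using TensorProduct.induction_on with
  | zero => simp
  | add x y hx hy => rw [mul_add, map_add, hx, hy]
  | tmul x y => simp

/-- The section of the action map given by an idempotent. -/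
noncomputable def actSection (e : T ⊗[R] T) (he : ∀ t : T, (1 ⊗ₜ t) * e = t • e) :
    M →ₗ[T] T ⊗[R] M where
  toFun l := ((LinearMap.toSpanSingleton T M l).restrictScalars R).baseChange T e
  map_add' x y := by
    rw [← LinearMap.add_apply, ← LinearMap.baseChange_add]
    congr 2
    ext t
    simp
  map_smul' c x := by
    -- Replacing `x` by `c • x` multiplies the right tensor factor by `c`, and `he` moves `c` to the
    -- left factor. This is what makes the section `T`-linear.
    have h1 : (LinearMap.toSpanSingleton T M (c • x)).restrictScalars R =
        (LinearMap.toSpanSingleton T M x).restrictScalars R ∘ₗ LinearMap.mulLeft R c := by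
      ext t
      simp [mul_comm c t, mul_smul]
    rw [h1, LinearMap.baseChange_comp, LinearMap.comp_apply, ← one_tmul_mul_eq, he, map_smul,
      RingHom.id_apply]

omit [Module.Free R T] [Module.Finite R T] in
theorem baseChange_actSection (e : T ⊗[R] T) (he : ∀ t : T, (1 ⊗ₜ t) * e = t • e)
    (f : M →ₗ[T] M') (x : M) :
    (f.restrictScalars R).baseChange T (actSection e he x) = actSection e he (f x) := by
  have h1 : (LinearMap.toSpanSingleton T M' (f x)).restrictScalars R =
      f.restrictScalars R ∘ₗ (LinearMap.toSpanSingleton T M x).restrictScalars R := by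
    ext t; simp
  change _ = ((LinearMap.toSpanSingleton T M' (f x)).restrictScalars R).baseChange T e
  rw [h1, LinearMap.baseChange_comp]
  rfl

-- Writing e = ∑ a ⊗ b, the action map sends ∑ a ⊗ bx to (∑ ab)x = x.
omit [Module.Free R T] [Module.Finite R T] in
theorem lift_actSection (e : T ⊗[R] T) (he : ∀ t : T, (1 ⊗ₜ t) * e = t • e)
    (he' : Algebra.TensorProduct.lmul' R e = 1) (x : M) :
    (LinearMap.id (R := R) (M := M)).liftBaseChange T (actSection e he x) = x := by
  have h1 : ∀ z : T ⊗[R] T, (LinearMap.id (R := R) (M := M)).liftBaseChange T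
      (((LinearMap.toSpanSingleton T M x).restrictScalars R).baseChange T z) =
      Algebra.TensorProduct.lmul' R z • x := by
    intro z
    induction z using TensorProduct.induction_on with
    | zero => simp
    | add y z hy hz => rw [map_add, map_add, map_add, hy, hz, add_smul]
    | tmul y z => simp [mul_smul]
  exact (h1 e).trans (by rw [he', one_smul])

omit [Module.Free R T] [Module.Finite R T] in
theorem map_liftBaseChange_id (f : M →ₗ[T] M') (z : T ⊗[R] M) :
    f ((LinearMap.id (R := R) (M := M)).liftBaseChange T z) =
      (LinearMap.id (R := R) (M := M')).liftBaseChange T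
        ((f.restrictScalars R).baseChange T z) := by
  induction z using TensorProduct.induction_on with
  | zero => simp
  | add y z hy hz => rw [map_add, map_add, map_add, map_add, hy, hz]
  | tmul y z => simp

open KrullSchmidt

/-- The section of the action map is natural in the module, so it commutes with the maps of the
arrows. -/
theorem isRetract_ext_res (e : T ⊗[R] T) (he : ∀ t : T, (1 ⊗ₜ t) * e = t • e)
    (he' : Algebra.TensorProduct.lmul' R e = 1) (L : LFRep V T) :
    IsRetract L ((extFunctor V R T).obj ((resFunctor V R T).obj L)) := by
  let f : ∀ {i j : V}, (i ⟶ j) → (RestrictedModule R T (L.toRep.obj i) →ₗ[T]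
    RestrictedModule R T (L.toRep.obj j)) := fun a => L.toRep.map a
  let s : ∀ i, RestrictedModule R T (L.toRep.obj i) →ₗ[T]
      T ⊗[R] RestrictedModule R T (L.toRep.obj i) := fun i => actSection e he
  let r : ∀ i, T ⊗[R] RestrictedModule R T (L.toRep.obj i) →ₗ[T]
      RestrictedModule R T (L.toRep.obj i) := fun i =>
    (LinearMap.id (R := R) (M := RestrictedModule R T (L.toRep.obj i))).liftBaseChange T
  have hrs : ∀ i x, r i (s i x) = x := fun i x => lift_actSection e he he' x
  have hr : ∀ (i j : V) (a : i ⟶ j) x,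
      f a (r i x) = r j (((f a).restrictScalars R).baseChange T x) :=
    fun i j a x => map_liftBaseChange_id (f a) x
  exact ⟨homMk s fun i j a x => baseChange_actSection e he (f a) x,
    homMk r hr,
    hom_ext hrs⟩

end Retract

section ScalarExtension

open KrullSchmidt

variable {k K : Type*} [Field k] [Field K] [Algebra k K] [Algebra k R] [Algebra K T]
  [Algebra k T] [IsScalarTower k R T] [IsScalarTower k K T]
  [Finite k] [Finite K] [Finite V] [Nontrivial R] [Nontrivial T]

/-- Extension and restriction of scalars of locally free representations. -/
noncomputable def scalarExtension (bK : Module.Basis (Fin (Module.finrank k K)) k K)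
    (bT : Module.Basis (Fin (Module.finrank k K)) R T) (hb : ∀ j, bT j = algebraMap K T (bK j)) :
    ScalarExtension k K (LFRep V R) (LFRep V T) V where
  ext := extFunctor V R T
  res := resFunctor V R T
  endEquiv X := AlgEquiv.ofBijective (extEndHom T K X)
    ⟨extEndHom_injective bK bT hb X, extEndHom_surjective bK bT hb X⟩
  exists_res_ext X := ⟨fun j => resExtProj bT X j, fun j => resExtIncl X (bT j), sum_resExt bT X⟩
  isRetract_ext_res L := by
    have : Module.Finite k K := Module.Finite.of_finite
    obtain ⟨e, he, he'⟩ := exists_separabilityIdempotent (k := k) bT hb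
    exact isRetract_ext_res e he he' L
  rank := rankHom V R
  rank' := rankHom V T
  rank_eq_zero := rankHom_eq_zero
  rank_ext X := by
    ext i
    exact Module.finrank_baseChange (R := T) (S := R) (M' := X.toRep.obj i)
  rank_res L := by
    ext i
    have h1 : Module.Free T (RestrictedModule R T (L.toRep.obj i)) := (L.isLocallyFree i).1
    have h := Module.finrank_mul_finrank R T (RestrictedModule R T (L.toRep.obj i))
    rw [Module.finrank_eq_card_basis bT, Fintype.card_fin] at h
    exact h.symm

end ScalarExtension

end LFRep

end

/-! ### Truncated polynomial rings -/

section

universe u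

namespace TruncPoly

section Field

variable (K : Type u) [Field K] (α : ℕ)

theorem isNilpotent_mk_X : IsNilpotent (Ideal.Quotient.mk (Ideal.span {(Polynomial.X : K[X]) ^ α})
    Polynomial.X) := by
  refine ⟨α, ?_⟩
  rw [← map_pow, Ideal.Quotient.eq_zero_iff_mem]
  exact Ideal.mem_span_singleton_self _

instance : Module.Finite K (TruncPoly K α) :=
  (AdjoinRoot.powerBasis' (Polynomial.monic_X_pow (R := K) α)).finite

theorem finrank : Module.finrank K (TruncPoly K α) = α :=
  (AdjoinRoot.powerBasis' (Polynomial.monic_X_pow (R := K) α)).finrank.trans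
    (Polynomial.natDegree_X_pow α)

instance [Finite K] : Finite (TruncPoly K α) := Module.finite_of_finite K

theorem natCard [Finite K] : Nat.card (TruncPoly K α) = Nat.card K ^ α := by
  rw [Module.natCard_eq_pow_finrank (K := K), finrank]

theorem exists_eq_algebraMap_add (x : TruncPoly K α) :
    ∃ (c : K) (y : TruncPoly K α), IsNilpotent y ∧ x = algebraMap K _ c + y := by
  obtain ⟨p, rfl⟩ := Ideal.Quotient.mk_surjective x
  refine ⟨p.coeff 0, Ideal.Quotient.mk _ (p.divX * Polynomial.X), ?_, ?_⟩
  · rw [map_mul]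
    exact (Commute.all _ _).isNilpotent_mul_left (isNilpotent_mk_X K α)
  · conv_lhs => rw [← Polynomial.divX_mul_X_add p]
    rw [map_add, add_comm]
    rfl

variable {α}

theorem nontrivial (hα : 1 ≤ α) : Nontrivial (TruncPoly K α) := by
  refine Module.nontrivial_of_finrank_pos (R := K) ?_
  rw [finrank]
  exact hα

theorem isLocalRing (hα : 1 ≤ α) : IsLocalRing (TruncPoly K α) := by
  have := nontrivial K hα
  refine IsLocalRing.of_isUnit_or_isUnit_one_sub_self fun x => ?_
  obtain ⟨c, y, hy, rfl⟩ := exists_eq_algebraMap_add K α x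
  by_cases hc : c = 0
  · right
    rw [hc, map_zero, zero_add]
    exact hy.isUnit_one_sub
  · left
    exact hy.isUnit_add_left_of_commute ((IsUnit.mk0 c hc).map _) (Commute.all _ _)

/-- The constant coefficient. -/
noncomputable def constCoeff (hα : 1 ≤ α) : TruncPoly K α →ₐ[K] K :=
  Ideal.Quotient.liftₐ _ (Polynomial.aeval (0 : K)) fun a ha => by
    obtain ⟨b, rfl⟩ := Ideal.mem_span_singleton.1 ha
    rw [map_mul, map_pow, Polynomial.aeval_X, zero_pow (by omega), zero_mul]

end Field

section Extension

variable (k K : Type u) [Field k] [Field K] [Algebra k K] (α : ℕ)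

/-- Truncated polynomials over an extension field as an algebra over those over the base field. -/
noncomputable abbrev algebra : Algebra (TruncPoly k α) (TruncPoly K α) :=
  (Ideal.quotientMap (Ideal.span {(Polynomial.X : K[X]) ^ α})
    (Polynomial.mapRingHom (algebraMap k K)) (by
      rw [Ideal.span_singleton_le_iff_mem, Ideal.mem_comap, map_pow, Polynomial.coe_mapRingHom,
        Polynomial.map_X]
      exact Ideal.mem_span_singleton_self _)).toAlgebra

attribute [local instance] algebra

theorem algebraMap_mk (p : k[X]) : algebraMap (TruncPoly k α) (TruncPoly K α)
    (Ideal.Quotient.mk _ p) = Ideal.Quotient.mk _ (p.map (algebraMap k K)) := rfl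

theorem isScalarTower : IsScalarTower k (TruncPoly k α) (TruncPoly K α) :=
  IsScalarTower.of_algebraMap_eq fun c => by
    change _ = algebraMap (TruncPoly k α) (TruncPoly K α)
      (Ideal.Quotient.mk _ (Polynomial.C c))
    rw [algebraMap_mk, Polynomial.map_C]
    rfl

variable {k K}

/-- Expanding the coefficients of polynomials in the basis of `K` gives generation. Both sides have
|k|^(α[K:k]) elements, so the surjection is bijective. -/
theorem exists_basis [Finite k] [Finite K] (bK : Module.Basis (Fin (Module.finrank k K)) k K) :
    ∃ bT : Module.Basis (Fin (Module.finrank k K)) (TruncPoly k α) (TruncPoly K α),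
      ∀ j, bT j = algebraMap K _ (bK j) := by
  let φ : (Fin (Module.finrank k K) → TruncPoly k α) →ₗ[TruncPoly k α] TruncPoly K α :=
    Fintype.linearCombination (TruncPoly k α) fun j => algebraMap K (TruncPoly K α) (bK j)
  have hsurj : Function.Surjective φ := by
    rw [← LinearMap.range_eq_top, eq_top_iff]
    rintro x -
    obtain ⟨p, rfl⟩ := Ideal.Quotient.mk_surjective x
    induction p using Polynomial.induction_on' with
    | add p q hp hq => rw [map_add]; exact Submodule.add_mem _ hp hq
    | monomial n a =>
      refine ⟨fun j => Ideal.Quotient.mk _ (Polynomial.monomial n (bK.repr a j)), ?_⟩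
      rw [Fintype.linearCombination_apply]
      conv_rhs => rw [← bK.sum_repr a, map_sum, map_sum]
      refine Finset.sum_congr rfl fun j _ => ?_
      rw [Algebra.smul_def, algebraMap_mk, Polynomial.map_monomial]
      change Ideal.Quotient.mk _ _ * Ideal.Quotient.mk _ (Polynomial.C (bK j)) = _
      rw [← map_mul, Polynomial.monomial_mul_C, Algebra.smul_def]
  have hcard : Nat.card (Fin (Module.finrank k K) → TruncPoly k α) ≤
      Nat.card (TruncPoly K α) := by
    rw [Nat.card_fun, Nat.card_fin, natCard, natCard, ← pow_mul,
      Module.natCard_eq_pow_finrank (K := k) (V := K), ← pow_mul, mul_comm]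
  have hbij := hsurj.bijective_of_nat_card_le hcard
  refine ⟨Module.Basis.ofEquivFun (LinearEquiv.ofBijective φ hbij).symm, fun j => ?_⟩
  rw [Module.Basis.coe_ofEquivFun, LinearEquiv.symm_symm]
  exact (Fintype.linearCombination_apply_single _ _ _ _).trans (one_smul _ _)

end Extension

end TruncPoly

end

/-! ### Absolute indecomposability in terms of endomorphisms -/

section

open CategoryTheory CategoryTheory.Limits

universe u v w

/-- In an algebra without nontrivial idempotents over an algebraically closed field, every integral
element is the sum of a scalar and a nilpotent. -/
theorem exists_isNilpotent_sub_algebraMap {L A : Type*} [Field L] [IsAlgClosed L] [Ring A]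
    [Nontrivial A] [Algebra L A] (hA : ∀ e : A, e * e = e → e = 0 ∨ e = 1) {x : A}
    (hx : IsIntegral L x) : ∃ c : L, IsNilpotent (x - algebraMap L A c) := by
  obtain ⟨c, hc⟩ := IsAlgClosed.exists_root (minpoly L x) (minpoly.degree_pos hx).ne'
  have hμ := minpoly.ne_zero hx
  obtain ⟨q, hq, hcq⟩ := Polynomial.exists_eq_pow_rootMultiplicity_mul_and_not_dvd
    (minpoly L x) hμ c
  have hm : 0 < Polynomial.rootMultiplicity c (minpoly L x) :=
    (Polynomial.rootMultiplicity_pos hμ).2 hc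
  set m := Polynomial.rootMultiplicity c (minpoly L x)
  set P : L[X] := (Polynomial.X - Polynomial.C c) ^ m with hP
  have hPq : Polynomial.aeval x (P * q) = 0 := by rw [← hq, minpoly.aeval]
  have hcop : IsCoprime P q :=
    (((Polynomial.irreducible_X_sub_C c).coprime_iff_not_dvd).2 hcq).pow_left
  obtain ⟨s, t, hst⟩ := hcop
  have hmul : ∀ z, Polynomial.aeval x (z * (P * q)) = 0 := fun z => by
    rw [map_mul, hPq, mul_zero]
  -- By the Bézout relation `s * P + t * q = 1`, the value of `t * q` at `x` is idempotent. If it is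
  -- `0`, then `q` kills `x`, against minimality; if it is `1`, a power of `X - c` kills `x`.
  rcases hA (Polynomial.aeval x (t * q)) (by
      have h1 : t * q * (t * q) = t * q - t * s * (P * q) := by
        linear_combination (t * q) * hst
      rw [← map_mul, h1, map_sub, hmul, sub_zero]) with h | h
  · exfalso
    have h1 : Polynomial.aeval x q = 0 := by
      have h2 : q = s * (P * q) + q * (t * q) := by linear_combination (-q) * hst
      rw [h2, map_add, hmul, map_mul, h, mul_zero, add_zero]
    have hq0 : q ≠ 0 := by
      rintro rfl
      exact hμ (by rw [hq, mul_zero])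
    have h3 := Polynomial.natDegree_le_natDegree (minpoly.degree_le_of_ne_zero L x hq0 h1)
    rw [hq, Polynomial.natDegree_mul (pow_ne_zero _ (Polynomial.X_sub_C_ne_zero c)) hq0,
      Polynomial.natDegree_pow, Polynomial.natDegree_X_sub_C] at h3
    omega
  · refine ⟨c, m, ?_⟩
    have h1 : Polynomial.aeval x P = 0 := by
      have h2 : Polynomial.aeval x P = Polynomial.aeval x P * Polynomial.aeval x (t * q) := by
        rw [h, mul_one]
      rw [h2, ← map_mul, show P * (t * q) = t * (P * q) by ring, hmul]
    rw [hP] at h1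
    simpa using h1

namespace LFRep

open KrullSchmidt

variable {V : Type v} [Quiver.{w} V]

/-- An idempotent decomposes the representation into image and kernel; conversely, the projection
along a decomposition is an idempotent morphism. -/
theorem isIndecomposable_iff {T : Type u} [CommRing T] (W : LFRep V T) :
    W.toRep.IsIndecomposable ↔ IsIndec W := by
  have h0 : (∃ i, Nontrivial (W.toRep.obj i)) ↔ 𝟙 W ≠ 0 := by
    constructor
    · rintro ⟨i, hi⟩ h
      obtain ⟨x, hx⟩ := exists_ne (0 : W.toRep.obj i)
      exact hx (LinearMap.congr_fun (congrArg (fun f : W ⟶ W => app f i) h) x)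
    · intro h
      by_contra! h1
      exact h (hom_ext fun i x => (h1 i).elim _ _)
  refine and_congr h0 ⟨fun h e he => ?_, fun h N P hN hP hNP => ?_⟩
  · have he' : ∀ i x, app e i (app e i x) = app e i x := fun i x =>
      LinearMap.congr_fun (congrArg (fun f : W ⟶ W => app f i) he) x
    have h1 : W.toRep.IsSubrep fun i => LinearMap.range (app e i) := by
      rintro i j a _ ⟨x, rfl⟩
      exact ⟨W.toRep.map a x, (map_app e a x).symm⟩
    have h2 : W.toRep.IsSubrep fun i => LinearMap.ker (app e i) := by
      intro i j a x hx
      rw [LinearMap.mem_ker] at hx ⊢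
      rw [← map_app, hx, map_zero]
    have h3 : ∀ i x, x - app e i x ∈ LinearMap.ker (app e i) := fun i x => by
      rw [LinearMap.mem_ker, map_sub, he', sub_self]
    have h4 : ∀ i, IsCompl (LinearMap.range (app e i)) (LinearMap.ker (app e i)) := by
      intro i
      refine ⟨Submodule.disjoint_def.2 ?_, codisjoint_iff.2 (eq_top_iff.2 fun x _ => ?_)⟩
      · rintro _ ⟨x, rfl⟩ hx
        rw [LinearMap.mem_ker, he'] at hx
        exact hx
      · rw [Submodule.mem_sup]
        exact ⟨app e i x, ⟨x, rfl⟩, x - app e i x, h3 i x, by abel⟩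
    rcases h _ _ h1 h2 h4 with h | h
    · left
      refine hom_ext fun i x => ?_
      have : app e i x ∈ LinearMap.range (app e i) := ⟨x, rfl⟩
      rwa [h i, Submodule.mem_bot] at this
    · right
      refine hom_ext fun i x => ?_
      have := h3 i x
      rw [h i, Submodule.mem_bot, sub_eq_zero] at this
      exact this.symm
  · have hl : ∀ i, ∀ x ∈ N i, (N i).projection (P i) (hNP i) x = x := fun i x hx =>
      Submodule.projection_apply_left (hNP i) ⟨x, hx⟩
    have hr : ∀ i, ∀ x ∈ P i, (N i).projection (P i) (hNP i) x = 0 := fun i x hx =>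
      (Submodule.projection_apply_eq_zero_iff (hNP i)).2 hx
    have hdec : ∀ i x, ∃ n ∈ N i, ∃ p ∈ P i, n + p = x := fun i x =>
      Submodule.mem_sup.1 (by rw [(hNP i).sup_eq_top]; trivial)
    let e : W ⟶ W := homMk (fun i => (N i).projection (P i) (hNP i)) fun i j a x => by
      obtain ⟨n, hn, p, hp, rfl⟩ := hdec i x
      rw [map_add, hl i n hn, hr i p hp, add_zero, map_add, map_add,
        hl j _ (hN i j a n hn), hr j _ (hP i j a p hp), add_zero]
    rcases h e (hom_ext fun i x => by
      change (N i).projection (P i) (hNP i) ((N i).projection (P i) (hNP i) x) =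
        (N i).projection (P i) (hNP i) x
      obtain ⟨n, hn, p, hp, rfl⟩ := hdec i x
      rw [map_add, hl i n hn, hr i p hp, add_zero, hl i n hn]) with h | h
    · left
      intro i
      rw [eq_bot_iff]
      intro x hx
      have h1 : (N i).projection (P i) (hNP i) x = 0 :=
        LinearMap.congr_fun (congrArg (fun f : W ⟶ W => app f i) h) x
      rw [hl i x hx] at h1
      exact h1
    · right
      intro i
      rw [eq_bot_iff]
      intro x hx
      have h1 : (N i).projection (P i) (hNP i) x = x :=
        LinearMap.congr_fun (congrArg (fun f : W ⟶ W => app f i) h) x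
      rw [hr i x hx] at h1
      exact h1.symm

section AbsIndec

variable {K : Type u} [Field K] {R : Type u} [CommRing R] [Algebra K R]

attribute [local instance] Algebra.TensorProduct.rightAlgebra

theorem tmul_one_injective [Nontrivial R] (M : LFRep V R) (i : V) :
    Function.Injective fun m : M.toRep.obj i =>
      (tmul 1 m : ((extFunctor V R (R ⊗[K] AlgebraicClosure K)).obj M).toRep.obj i) :=
  Module.FaithfullyFlat.tensorProduct_mk_injective (A := R)
    (B := R ⊗[K] AlgebraicClosure K) (M.toRep.obj i)

theorem ext_map_injective [Nontrivial R] {M N : LFRep V R} {f g : M ⟶ N}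
    (h : (extFunctor V R (R ⊗[K] AlgebraicClosure K)).map f =
      (extFunctor V R (R ⊗[K] AlgebraicClosure K)).map g) : f = g :=
  hom_ext fun i m => tmul_one_injective (K := K) N i
    (LinearMap.congr_fun (congrArg (fun z => app z i) h) (tmul 1 m))

theorem extEndHom_closure_surjective [Finite V] (M : LFRep V R) : Function.Surjective
    (extEndHom (k := K) (R ⊗[K] AlgebraicClosure K) (AlgebraicClosure K) M) := by
  let bK := Module.Free.chooseBasis K (AlgebraicClosure K)
  exact extEndHom_surjective bK (Algebra.TensorProduct.basis R bK)
    (fun j => Algebra.TensorProduct.basis_apply bK j) M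

/-- The residue map of `End M` takes values in `K`, so after tensoring its values are scalars of the
closure while its kernel stays nil. Every endomorphism of the extension comes from this tensor
product. -/
theorem isAbsIndec_ext [Finite K] [Finite R] [Nontrivial R] [Finite V] {M : LFRep V R}
    (h : IsAbsIndec K M) : IsAbsIndec (AlgebraicClosure K)
      ((extFunctor V R (R ⊗[K] AlgebraicClosure K)).obj M) := by
  refine ⟨fun h0 => h.1 ?_, fun g => ?_⟩
  · refine ext_map_injective (K := K) ?_
    rw [(extFunctor V R _).map_id, (extFunctor V R _).map_zero]
    exact h0
  · obtain ⟨D, hF, hA, hfin, π, hπ, hker, -, -⟩ := h.isIndec.exists_residue K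
    have hD : ∀ f : End M, ∃ c : K, π f = algebraMap K D c := by
      intro f
      obtain ⟨c, hc⟩ := h.2 f
      refine ⟨c, ?_⟩
      have h1 := hc.map π
      rw [isNilpotent_iff_eq_zero] at h1
      have h2 : π (show End M from (show M ⟶ M from f) - c • 𝟙 M) = π f - π (c • (1 : End M)) :=
        map_sub π _ _
      rw [h2, map_smul, map_one, sub_eq_zero] at h1
      rw [h1, Algebra.algebraMap_eq_smul_one]
    have hz : ∀ z : AlgebraicClosure K ⊗[K] End M, ∃ c : AlgebraicClosure K,
        ResidueTensor.mapResidue (AlgebraicClosure K) π z = c • 1 := by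
      intro z
      induction z using TensorProduct.induction_on with
      | zero => exact ⟨0, by rw [map_zero, zero_smul]⟩
      | add x y hx hy =>
        obtain ⟨c, hc⟩ := hx
        obtain ⟨d, hd⟩ := hy
        exact ⟨c + d, by rw [map_add, hc, hd, add_smul]⟩
      | tmul a f =>
        obtain ⟨c, hc⟩ := hD f
        refine ⟨c • a, ?_⟩
        have h1 : ResidueTensor.mapResidue (AlgebraicClosure K) π (a ⊗ₜ f) = a ⊗ₜ π f :=
          Algebra.TensorProduct.map_tmul _ _ _ _
        rw [h1, hc, Algebra.algebraMap_eq_smul_one, TensorProduct.tmul_smul,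
          TensorProduct.smul_tmul', Algebra.TensorProduct.one_def, TensorProduct.smul_tmul',
          smul_eq_mul, mul_one]
    obtain ⟨z, hzg⟩ := extEndHom_closure_surjective M g
    obtain ⟨c, hc⟩ := hz z
    refine ⟨c, ?_⟩
    have h1 : IsNilpotent (z - c • 1) :=
      ResidueTensor.isNilpotent_of_mapResidue_eq_zero hπ hker (by
        rw [map_sub, map_smul, map_one, hc, sub_self])
    have h2 := h1.map (extEndHom (k := K) (R ⊗[K] AlgebraicClosure K) (AlgebraicClosure K) M)
    rw [map_sub, map_smul, map_one, hzg] at h2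
    exact h2

/-- A diagonal coordinate of `y` in a basis is an element ρ of `R` with ρ ⊗ 1 = 1 ⊗ c. Applying `ε`
to the left factor exhibits `c` as an element of `K`; that `M` is nonzero provides a basis vector.
-/
theorem mem_range_algebraMap_of_ext_map_eq [Nontrivial R] (ε : R →ₐ[K] K) {M : LFRep V R}
    (hM : 𝟙 M ≠ 0) {y : M ⟶ M} {c : AlgebraicClosure K}
    (h : (extFunctor V R (R ⊗[K] AlgebraicClosure K)).map y = c • 𝟙 _) :
    ∃ a : K, algebraMap K (AlgebraicClosure K) a = c := by
  have h1 : ∃ i, Nontrivial (M.toRep.obj i) := by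
    by_contra! h1
    exact hM (hom_ext fun i x => (h1 i).elim _ _)
  obtain ⟨i, hi⟩ := h1
  let b := Module.Free.chooseBasis R (M.toRep.obj i)
  obtain ⟨l⟩ := b.index_nonempty
  let φ : M.toRep.obj i →ₗ[R] R ⊗[K] AlgebraicClosure K :=
    Algebra.linearMap R (R ⊗[K] AlgebraicClosure K) ∘ₗ b.coord l
  let Φ := φ.liftBaseChange (R ⊗[K] AlgebraicClosure K)
  have h2 : (1 : R ⊗[K] AlgebraicClosure K) ⊗ₜ[R] app y i (b l) =
      (algebraMap (AlgebraicClosure K) (R ⊗[K] AlgebraicClosure K) c) •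
        ((1 : R ⊗[K] AlgebraicClosure K) ⊗ₜ[R] b l) :=
    LinearMap.congr_fun (congrArg (fun z => app z i) h) (tmul 1 (b l))
  have h3 := congrArg Φ h2
  rw [map_smul, LinearMap.liftBaseChange_tmul, LinearMap.liftBaseChange_tmul, one_smul,
    one_smul] at h3
  have h4 : φ (b l) = 1 := by simp [φ, Algebra.TensorProduct.one_def]
  have h5 : φ (app y i (b l)) = (b.coord l (app y i (b l))) ⊗ₜ[K] (1 : AlgebraicClosure K) := rfl
  rw [h4, h5, smul_eq_mul, mul_one, Algebra.TensorProduct.right_algebraMap_apply] at h3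
  let Ψ : R ⊗[K] AlgebraicClosure K →ₐ[K] AlgebraicClosure K :=
    Algebra.TensorProduct.lift ((Algebra.ofId K (AlgebraicClosure K)).comp ε)
      (AlgHom.id K _) fun _ _ => Commute.all _ _
  have h6 := congrArg Ψ h3
  rw [Algebra.TensorProduct.lift_tmul, Algebra.TensorProduct.lift_tmul, map_one, map_one, mul_one,
    one_mul] at h6
  exact ⟨_, h6⟩

/-- Over the closure `x` is a scalar `c` plus a nilpotent. A large Frobenius power removes the
nilpotent part, so `c ^ p ^ n` lies in `K`; since finite fields are perfect it is `a' ^ p ^ n` with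
`a'` in `K`, and then `x - a'` is nilpotent. -/
theorem isAbsIndec_of_isIndec_ext [Finite K] [Finite R] [Nontrivial R] [Finite V]
    (ε : R →ₐ[K] K) {M : LFRep V R}
    (h : IsIndec ((extFunctor V R (R ⊗[K] AlgebraicClosure K)).obj M)) : IsAbsIndec K M := by
  set W := (extFunctor V R (R ⊗[K] AlgebraicClosure K)).obj M with hW
  have hM : 𝟙 M ≠ 0 := by
    intro h0
    apply h.1
    rw [hW, ← (extFunctor V R _).map_id, h0, (extFunctor V R _).map_zero]
  have hnt : Nontrivial (End W) := h.nontrivial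
  have hnt' : Nontrivial (End M) := ⟨𝟙 M, 0, hM⟩
  obtain ⟨p, hp⟩ := CharP.exists K
  have hp' : Fact p.Prime := ⟨CharP.char_is_prime K p⟩
  have : CharP (AlgebraicClosure K) p :=
    charP_of_injective_algebraMap (algebraMap K (AlgebraicClosure K)).injective p
  have : CharP (End W) p :=
    charP_of_injective_algebraMap (algebraMap (AlgebraicClosure K) (End W)).injective p
  have : CharP (End M) p := charP_of_injective_algebraMap (algebraMap K (End M)).injective p
  refine ⟨hM, fun x => ?_⟩
  have hfin : Finite (End M) := inferInstanceAs (Finite (M ⟶ M))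
  have hint : IsIntegral K (show End M from x) := by
    have : Module.Finite K (End M) := Module.Finite.of_finite
    exact IsIntegral.of_finite K _
  have hint' : IsIntegral (AlgebraicClosure K)
      (extEnd (k := K) (T := R ⊗[K] AlgebraicClosure K) M x) :=
    (hint.map (extEnd (k := K) (T := R ⊗[K] AlgebraicClosure K) M)).tower_top
  obtain ⟨c, n, hc⟩ := exists_isNilpotent_sub_algebraMap (A := End W)
    (fun e he => h.2 e he) hint'
  -- The nilpotency exponent is replaced by a power of `p`, for which taking powers is additive.
  have hn : n ≤ p ^ n := (Nat.lt_pow_self hp'.out.one_lt).le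
  have h1 := pow_eq_zero_of_le hn hc
  rw [sub_pow_char_pow_of_commute p n (Algebra.commutes c _).symm, sub_eq_zero, ← map_pow,
    ← map_pow] at h1
  obtain ⟨a, ha⟩ := mem_range_algebraMap_of_ext_map_eq ε hM (y := (show End M from x) ^ p ^ n)
    (c := c ^ p ^ n) h1
  obtain ⟨a', ha'⟩ := (bijective_iterateFrobenius K p n).2 a
  rw [iterateFrobenius_def] at ha'
  refine ⟨a', p ^ n, ?_⟩
  have h2 : (show End M from x - a' • 𝟙 M) = (show End M from x) - algebraMap K (End M) a' := rfl
  rw [h2, sub_pow_char_pow_of_commute p n (Algebra.commutes a' _).symm, sub_eq_zero, ← map_pow,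
    ha']
  refine ext_map_injective (K := K) ?_
  refine Eq.trans h1 ?_
  rw [← ha]
  change algebraMap K (AlgebraicClosure K) a • 𝟙 W = (extFunctor V R _).map (a • 𝟙 M)
  rw [ext_map_smul, (extFunctor V R _).map_id]
  exact algebraMap_smul (A := AlgebraicClosure K) (M := End W) a (1 : End W)

/-- Absolute indecomposability in terms of endomorphisms. -/
theorem isAbsIndecomposable_iff [Finite K] [Finite R] [Nontrivial R] [Finite V]
    (ε : R →ₐ[K] K) (M : LFRep V R) : M.toRep.IsAbsIndecomposable K ↔ IsAbsIndec K M :=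
  (isIndecomposable_iff ((extFunctor V R (R ⊗[K] AlgebraicClosure K)).obj M)).trans
    ⟨isAbsIndec_of_isIndec_ext ε, fun h => (isAbsIndec_ext h).isIndec⟩

end AbsIndec

end LFRep

end

/-! ### Counting isomorphism classes of representations -/

section

open CategoryTheory CategoryTheory.Limits

universe u v w

namespace LFRep

open KrullSchmidt

variable {V : Type v} [Quiver.{w} V]

/-- The isomorphism class of the underlying representation. -/
def isoClassToRep {R : Type u} [CommRing R] :
    IsoClass (LFRep V R) → Quotient (QuiverRep.isoSetoid V R) :=
  Quotient.map' toRep fun _ _ h => isIso_toRep_iff.2 h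

theorem isoClassToRep_injective {R : Type u} [CommRing R] :
    Function.Injective (isoClassToRep (V := V) (R := R)) := by
  intro c c' h
  induction c using Quotient.inductionOn with | _ M
  induction c' using Quotient.inductionOn with | _ N
  exact Quotient.sound (isIso_toRep_iff.1 (Quotient.exact h))

theorem exists_isoClass_ofMatrix [Finite V] {R : Type u} [CommRing R] [Nontrivial R]
    {c : IsoClass (LFRep V R)} {r : V →₀ ℕ} (h : rankHom V R c = r) :
    ∃ x : RepSpace (⇑r) R, isoClass (ofMatrix r x) = c := by
  subst h
  induction c using Quotient.inductionOn with | _ M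
  obtain ⟨x, hx⟩ := exists_ofMatrix M
  exact ⟨x, isoClass_eq_iff.2 hx⟩

theorem finite_setOf_rankHom_eq [Finite V] [∀ i j : V, Finite (i ⟶ j)] {R : Type u} [CommRing R]
    [Nontrivial R] [Finite R] (r : V →₀ ℕ) : {c : IsoClass (LFRep V R) | rankHom V R c = r}.Finite :=
  (Set.finite_range fun x : RepSpace (⇑r) R => isoClass (ofMatrix r x)).subset fun _ h =>
    exists_isoClass_ofMatrix h

theorem finite_setOf_rankHom_indecClass_eq [Finite V] [∀ i j : V, Finite (i ⟶ j)] {R : Type u}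
    [CommRing R] [Nontrivial R] [Finite R] (r : V →₀ ℕ) :
    {I : IndecClass (LFRep V R) | rankHom V R I.1 = r}.Finite :=
  (finite_setOf_rankHom_eq r).preimage Subtype.val_injective.injOn

/-- Bridges the count of the theorem and the categorical one: isomorphism classes of locally free
representations inject into those of all representations, and the two notions of absolute
indecomposability agree. -/
theorem absIndecCount_eq_ncard [Finite V] {K : Type u} [Field K] [Finite K] {α : ℕ} (hα : 1 ≤ α)
    [Nontrivial (TruncPoly K α)] (r : V →₀ ℕ) :
    QuiverRep.absIndecCount V K α r = Set.ncard {c : IsoClass (LFRep V (TruncPoly K α)) |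
      (∃ L, IsAbsIndec K L ∧ isoClass L = c) ∧ rankHom V _ c = r} := by
  rw [← Set.ncard_image_of_injective _ isoClassToRep_injective, QuiverRep.absIndecCount]
  congr 1
  ext c
  constructor
  · rintro ⟨M, ⟨h1, h2, h3⟩, rfl⟩
    let L : LFRep V (TruncPoly K α) := ⟨M, h1⟩
    refine ⟨isoClass L, ⟨⟨L, (isAbsIndecomposable_iff (TruncPoly.constCoeff K hα) L).1 h3, rfl⟩,
      ?_⟩, rfl⟩
    ext i
    exact congrFun h2 i
  · rintro ⟨_, ⟨⟨L, hL, rfl⟩, hr⟩, rfl⟩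
    refine ⟨L.toRep, ⟨L.isLocallyFree, funext fun i => DFunLike.congr_fun hr i,
      (isAbsIndecomposable_iff (TruncPoly.constCoeff K hα) L).2 hL⟩, rfl⟩

section Extension

variable [Finite V] [∀ i j : V, Finite (i ⟶ j)] {k K : Type u} [Field k] [Field K]
  [Algebra k K] [Finite k] [Finite K] {α : ℕ}

omit [∀ i j : V, Finite (i ⟶ j)] in
theorem exists_scalarExtension [Nontrivial (TruncPoly k α)] [Nontrivial (TruncPoly K α)] :
    ∃ S : ScalarExtension k K (LFRep V (TruncPoly k α)) (LFRep V (TruncPoly K α)) V,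
      S.rank = rankHom V _ ∧ S.rank' = rankHom V _ := by
  let : Algebra (TruncPoly k α) (TruncPoly K α) := TruncPoly.algebra k K α
  have : IsScalarTower k (TruncPoly k α) (TruncPoly K α) := TruncPoly.isScalarTower k K α
  obtain ⟨bT, hb⟩ := TruncPoly.exists_basis α (Module.finBasis k K)
  have : Module.Free (TruncPoly k α) (TruncPoly K α) := Module.Free.of_basis bT
  have : Module.Finite (TruncPoly k α) (TruncPoly K α) := Module.Finite.of_basis bT
  exact ⟨scalarExtension (Module.finBasis k K) bT hb, rfl, rfl⟩

variable [Nontrivial (TruncPoly k α)]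

/-- The number of absolutely indecomposable representations over an extension field in terms of
the indecomposable representations over the base field. -/
theorem absIndecCount_eq_finsum (hα : 1 ≤ α) (r : V →₀ ℕ) :
    QuiverRep.absIndecCount V K α r =
      ∑ᶠ I ∈ {I : IndecClass (LFRep V (TruncPoly k α)) | I.degree k ∣ Module.finrank k K ∧
        rankHom V _ I.1 = I.degree k • r}, I.degree k := by
  have := TruncPoly.nontrivial K hα
  have := TruncPoly.isLocalRing k hα
  have := TruncPoly.isLocalRing K hα
  obtain ⟨S, hS, hS'⟩ := exists_scalarExtension (V := V) (k := k) (K := K) (α := α)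
  rw [absIndecCount_eq_ncard hα, ← hS', ← hS]
  exact S.ncard_isAbsIndec (by rw [hS]; exact finite_setOf_rankHom_indecClass_eq) r

omit [∀ i j : V, Finite (i ⟶ j)] in
theorem exists_rankHom_eq_nsmul (hα : 1 ≤ α) (I : IndecClass (LFRep V (TruncPoly k α)))
    (hd : I.degree k ∣ Module.finrank k K) :
    ∃ s, rankHom V _ I.1 = I.degree k • s := by
  have := TruncPoly.nontrivial K hα
  have := TruncPoly.isLocalRing k hα
  have := TruncPoly.isLocalRing K hα
  obtain ⟨S, hS, -⟩ := exists_scalarExtension (V := V) (k := k) (K := K) (α := α)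
  rw [← hS]
  exact S.exists_rank_eq_nsmul I hd

end Extension

end LFRep

end

/-! ### Fibres of the moment map -/

section

universe u v w

theorem Fintype.eq_zero_of_forall_sum_eq_zero {ι S : Type*} [Fintype ι] [DecidableEq ι]
    [AddCommMonoid S] {M N : ι → Type*} [∀ i, Zero (M i)] [∀ i, Zero (N i)]
    (B : ∀ i, M i → N i → S) (h0 : ∀ i m, B i m 0 = 0)
    (h : ∀ i m, (∀ n, B i m n = 0) → m = 0) {m : ∀ i, M i}
    (hm : ∀ n : ∀ i, N i, ∑ i, B i (m i) (n i) = 0) : m = 0 := by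
  funext i
  refine h i (m i) fun n => ?_
  have h1 := hm (Pi.single i n)
  rw [Finset.sum_eq_single i] at h1
  · rwa [Pi.single_eq_same] at h1
  · intro j _ hj
    rw [Pi.single_eq_of_ne hj, h0]
  · simp

/-- Testing against matrices with a single nonzero entry isolates each entry of `y`, where
nondegeneracy of the form applies. -/
theorem Matrix.eq_zero_of_forall_trace_mul {m n R S : Type*} [Fintype m] [Fintype n]
    [DecidableEq m] [DecidableEq n] [CommRing R] [AddCommMonoid S] (l : R → S)
    (hl : ∀ r, (∀ s, l (r * s) = 0) → r = 0) {y : Matrix m n R}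
    (h : ∀ z : Matrix n m R, l (y * z).trace = 0) : y = 0 := by
  ext i j
  refine hl _ fun s => ?_
  have h1 := h (Matrix.single j i s)
  rwa [Matrix.trace_mul_single] at h1

/-- Truncated polynomials are a Frobenius algebra, with the form given by the top coefficient. -/
theorem TruncPoly.exists_nondegenerate_form (K : Type u) [Field K] (α : ℕ) :
    ∃ l : TruncPoly K α →ₗ[K] K, ∀ r, (∀ s, l (r * s) = 0) → r = 0 := by
  let I : Ideal K[X] := Ideal.span {(Polynomial.X : K[X]) ^ α}
  have hI : I.restrictScalars K ≤ LinearMap.ker (Polynomial.lcoeff K (α - 1)) ∨ α = 0 := by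
    by_cases hα : α = 0
    · exact Or.inr hα
    left
    intro p hp
    obtain ⟨q, rfl⟩ := Ideal.mem_span_singleton.1 (show p ∈ I from hp)
    rw [LinearMap.mem_ker, Polynomial.lcoeff_apply, Polynomial.coeff_X_pow_mul',
      if_neg (by omega)]
  rcases hI with hI | rfl
  · refine ⟨(I.restrictScalars K).liftQ (Polynomial.lcoeff K (α - 1)) hI ∘ₗ
      (Submodule.Quotient.restrictScalarsEquiv K I).symm.toLinearMap, fun r hr => ?_⟩
    obtain ⟨p, rfl⟩ := Ideal.Quotient.mk_surjective r
    rw [Ideal.Quotient.eq_zero_iff_mem, Ideal.mem_span_singleton, Polynomial.X_pow_dvd_iff]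
    intro d hd
    -- Multiplication by this power of `X` moves the coefficient of `X ^ d` to the top position `α -
    -- 1`.
    have h1 : (p * Polynomial.X ^ (α - 1 - d)).coeff (α - 1) = 0 :=
      hr (Ideal.Quotient.mk _ (Polynomial.X ^ (α - 1 - d)))
    rw [Polynomial.coeff_mul_X_pow', if_pos (by omega)] at h1
    rwa [show α - 1 - (α - 1 - d) = d by omega] at h1
  · refine ⟨0, fun r _ => ?_⟩
    obtain ⟨p, rfl⟩ := Ideal.Quotient.mk_surjective r
    rw [Ideal.Quotient.eq_zero_iff_mem, Ideal.mem_span_singleton, pow_zero]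
    exact one_dvd _

section MomentMap

variable {V : Type v} [Fintype V] [Quiver.{w} V] [∀ i j : V, Fintype (i ⟶ j)]
  {K : Type u} [Field K] {R : Type u} [CommRing R] [Algebra K R] (r : V → ℕ)

/-- The trace pairing between representations of a quiver and of its opposite, composed with a
linear form. -/
def tracePairing (l : R →ₗ[K] K) : OpRepSpace (V := V) r R →ₗ[K] Module.Dual K (RepSpace r R) :=
  LinearMap.mk₂ K (fun y x => ∑ i, ∑ j, ∑ a : i ⟶ j, l (y i j a * x i j a).trace)
    (fun y y' x => by
      simp only [Pi.add_apply, Matrix.add_mul, Matrix.trace_add, map_add, Finset.sum_add_distrib])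
    (fun c y x => by
      simp only [Pi.smul_apply, Matrix.smul_mul, Matrix.trace_smul, map_smul, Finset.smul_sum])
    (fun y x x' => by
      simp only [Pi.add_apply, Matrix.mul_add, Matrix.trace_add, map_add, Finset.sum_add_distrib])
    (fun c y x => by
      simp only [Pi.smul_apply, Matrix.mul_smul, Matrix.trace_smul, map_smul, Finset.smul_sum])

theorem tracePairing_apply (l : R →ₗ[K] K) (y : OpRepSpace (V := V) r R) (x : RepSpace r R) :
    tracePairing r l y x = ∑ i, ∑ j, ∑ a : i ⟶ j, l (y i j a * x i j a).trace := rfl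

theorem tracePairing_injective {l : R →ₗ[K] K} (hl : ∀ r, (∀ s, l (r * s) = 0) → r = 0) :
    Function.Injective (tracePairing (V := V) r l) := by
  classical
  rw [← LinearMap.ker_eq_bot, LinearMap.ker_eq_bot']
  intro y hy
  refine Fintype.eq_zero_of_forall_sum_eq_zero
    (M := fun i => ∀ j, (i ⟶ j) → Matrix (Fin (r i)) (Fin (r j)) R)
    (N := fun i => ∀ j, (i ⟶ j) → Matrix (Fin (r j)) (Fin (r i)) R)
    (fun i m n => ∑ j, ∑ a : i ⟶ j, l (m j a * n j a).trace) (by simp) (fun i m hm => ?_)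
    (fun x => LinearMap.congr_fun hy x)
  refine Fintype.eq_zero_of_forall_sum_eq_zero
    (M := fun j => (i ⟶ j) → Matrix (Fin (r i)) (Fin (r j)) R)
    (N := fun j => (i ⟶ j) → Matrix (Fin (r j)) (Fin (r i)) R)
    (fun j m n => ∑ a : i ⟶ j, l (m a * n a).trace) (by simp) (fun j m hm => ?_) hm
  refine Fintype.eq_zero_of_forall_sum_eq_zero
    (M := fun _ : i ⟶ j => Matrix (Fin (r i)) (Fin (r j)) R)
    (N := fun _ : i ⟶ j => Matrix (Fin (r j)) (Fin (r i)) R)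
    (fun a m n => l (m * n).trace) (by simp) (fun a m hm => ?_) hm
  exact Matrix.eq_zero_of_forall_trace_mul l hl hm

/-- The derivative of the action of the gauge group. -/
def gaugeDerivative (x : RepSpace r R) :
    (∀ i : V, Matrix (Fin (r i)) (Fin (r i)) R) →ₗ[K] RepSpace r R where
  toFun g := fun i j a => g j * x i j a - x i j a * g i
  map_add' g g' := by
    funext i j a
    simp only [Pi.add_apply, Matrix.add_mul, Matrix.mul_add]
    abel
  map_smul' c g := by
    funext i j a
    simp only [Pi.smul_apply, Matrix.smul_mul, Matrix.mul_smul, smul_sub, RingHom.id_apply]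

/-- By cyclicity, tr(y_a(g_j x_a − x_a g_i)) = tr(x_a y_a g_j) − tr(y_a x_a g_i); collecting the
terms at each vertex gives the moment map. In other words, μ(x, ·) is the transpose of the gauge
derivative. -/
theorem tracePairing_gaugeDerivative (l : R →ₗ[K] K) (x : RepSpace r R)
    (y : OpRepSpace (V := V) r R) (g : ∀ i : V, Matrix (Fin (r i)) (Fin (r i)) R) :
    tracePairing r l y (gaugeDerivative (K := K) r x g) =
      ∑ i, l (momentMap r R (x, y) i * g i).trace := by
  have h1 : ∀ i, l (momentMap r R (x, y) i * g i).trace =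
      ∑ j, ∑ a : j ⟶ i, l (x j i a * y j i a * g i).trace -
        ∑ j, ∑ a : i ⟶ j, l (y i j a * x i j a * g i).trace := by
    intro i
    simp only [momentMap, Matrix.sub_mul, Matrix.sum_mul, Matrix.trace_sub, Matrix.trace_sum,
      map_sub, map_sum]
  rw [Finset.sum_congr rfl fun i _ => h1 i, Finset.sum_sub_distrib,
    Finset.sum_comm (f := fun i j => ∑ a : j ⟶ i, l (x j i a * y j i a * g i).trace),
    ← Finset.sum_sub_distrib, tracePairing_apply]
  refine Finset.sum_congr rfl fun i _ => ?_
  rw [← Finset.sum_sub_distrib]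
  refine Finset.sum_congr rfl fun j _ => ?_
  rw [← Finset.sum_sub_distrib]
  refine Finset.sum_congr rfl fun a _ => ?_
  change l (y i j a * (g j * x i j a - x i j a * g i)).trace = _
  rw [Matrix.mul_sub, Matrix.trace_sub, map_sub, Matrix.trace_mul_comm, Matrix.mul_assoc (g j),
    Matrix.trace_mul_comm (g j), Matrix.mul_assoc (y i j a)]

theorem momentMap_eq_zero_iff {l : R →ₗ[K] K} (hl : ∀ r, (∀ s, l (r * s) = 0) → r = 0)
    (x : RepSpace r R) (y : OpRepSpace (V := V) r R) : momentMap r R (x, y) = 0 ↔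
      tracePairing r l y ∈ (LinearMap.range (gaugeDerivative (K := K) r x)).dualAnnihilator := by
  classical
  rw [Submodule.mem_dualAnnihilator]
  constructor
  · rintro h _ ⟨g, rfl⟩
    rw [tracePairing_gaugeDerivative, h]
    simp
  · intro h
    refine Fintype.eq_zero_of_forall_sum_eq_zero
      (M := fun i : V => Matrix (Fin (r i)) (Fin (r i)) R)
      (N := fun i : V => Matrix (Fin (r i)) (Fin (r i)) R)
      (fun i m n => l (m * n).trace) (by simp)
      (fun i m hm => Matrix.eq_zero_of_forall_trace_mul l hl hm) fun g => ?_
    rw [← tracePairing_gaugeDerivative]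
    exact h _ ⟨g, rfl⟩

/-- The fibre is the annihilator of the image of the gauge derivative. Its dimension is that of
`RepSpace` minus the rank, and the rank follows from rank–nullity. -/
theorem card_momentMap_fibre_mul [Finite K] [Finite R] {l : R →ₗ[K] K}
    (hl : ∀ r, (∀ s, l (r * s) = 0) → r = 0) (x : RepSpace r R) :
    Nat.card {y : OpRepSpace (V := V) r R // momentMap r R (x, y) = 0} *
      Nat.card (∀ i : V, Matrix (Fin (r i)) (Fin (r i)) R) =
    Nat.card (RepSpace (V := V) r R) * Nat.card (LinearMap.ker (gaugeDerivative (K := K) r x)) := by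
  have : Module.Finite K R := Module.Finite.of_finite
  have hdim : Module.finrank K (OpRepSpace (V := V) r R) =
      Module.finrank K (Module.Dual K (RepSpace (V := V) r R)) := by
    rw [Subspace.dual_finrank_eq]
    refine LinearEquiv.finrank_eq (LinearEquiv.piCongrRight fun i => LinearEquiv.piCongrRight
      fun j => LinearEquiv.piCongrRight fun a => Matrix.transposeLinearEquiv _ _ K R)
  have hbij : Function.Bijective (tracePairing (V := V) r l) :=
    ⟨tracePairing_injective r hl,
      (LinearMap.injective_iff_surjective_of_finrank_eq_finrank hdim).1
        (tracePairing_injective r hl)⟩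
  set A := gaugeDerivative (K := K) r x with hA
  have h1 : Nat.card {y : OpRepSpace (V := V) r R // momentMap r R (x, y) = 0} =
      Nat.card (LinearMap.range A).dualAnnihilator :=
    Nat.card_congr (Equiv.subtypeEquiv (Equiv.ofBijective _ hbij)
      fun y => momentMap_eq_zero_iff r hl x y)
  have h2 := Subspace.finrank_add_finrank_dualAnnihilator_eq (LinearMap.range A)
  have h3 := LinearMap.finrank_range_add_finrank_ker A
  rw [h1, Module.natCard_eq_pow_finrank (K := K) (V := (LinearMap.range A).dualAnnihilator),
    Module.natCard_eq_pow_finrank (K := K) (V := ∀ i : V, Matrix (Fin (r i)) (Fin (r i)) R),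
    Module.natCard_eq_pow_finrank (K := K) (V := RepSpace (V := V) r R),
    Module.natCard_eq_pow_finrank (K := K) (V := LinearMap.ker A), ← pow_add, ← pow_add]
  congr 1
  omega

end MomentMap

end

/-! ### Orbit counting -/

section

open CategoryTheory CategoryTheory.Limits

universe u v w

namespace LFRep

open KrullSchmidt

section HomMatrix

variable {V : Type v} [Quiver.{w} V] {R : Type u} [CommRing R] {r : V → ℕ}

/-- The matrices of a morphism between representations given by matrices. -/
noncomputable def homMatrix {x x' : RepSpace (V := V) r R} (f : ofMatrix r x ⟶ ofMatrix r x')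
    (i : V) : Matrix (Fin (r i)) (Fin (r i)) R :=
  LinearMap.toMatrix' (show (Fin (r i) → R) →ₗ[R] (Fin (r i) → R) from app f i)

theorem homMatrix_comp {x x' x'' : RepSpace (V := V) r R} (f : ofMatrix r x ⟶ ofMatrix r x')
    (g : ofMatrix r x' ⟶ ofMatrix r x'') (i : V) :
    homMatrix (f ≫ g) i = homMatrix g i * homMatrix f i :=
  LinearMap.toMatrix'_comp (show (Fin (r i) → R) →ₗ[R] (Fin (r i) → R) from app g i)
    (show (Fin (r i) → R) →ₗ[R] (Fin (r i) → R) from app f i)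

theorem homMatrix_id (x : RepSpace (V := V) r R) (i : V) : homMatrix (𝟙 (ofMatrix r x)) i = 1 :=
  LinearMap.toMatrix'_id

theorem homMatrix_injective {x x' : RepSpace (V := V) r R} :
    Function.Injective (homMatrix (x := x) (x' := x')) := fun f g h =>
  hom_ext fun i => LinearMap.congr_fun (f := (show (Fin (r i) → R) →ₗ[R] (Fin (r i) → R) from app f i))
    (g := app g i) (LinearMap.toMatrix'.injective (congrFun h i))

theorem homMatrix_comm {x x' : RepSpace (V := V) r R} (f : ofMatrix r x ⟶ ofMatrix r x')
    {i j : V} (a : i ⟶ j) : x' i j a * homMatrix f i = homMatrix f j * x i j a := by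
  have h : Matrix.toLin' (x' i j a) ∘ₗ
      (show (Fin (r i) → R) →ₗ[R] (Fin (r i) → R) from app f i) =
      (show (Fin (r j) → R) →ₗ[R] (Fin (r j) → R) from app f j) ∘ₗ Matrix.toLin' (x i j a) :=
    LinearMap.ext fun y => map_app f a y
  have h1 := congrArg LinearMap.toMatrix' h
  rw [LinearMap.toMatrix'_comp, LinearMap.toMatrix'_comp, LinearMap.toMatrix'_toLin',
    LinearMap.toMatrix'_toLin'] at h1
  exact h1

/-- The morphism with given matrices. -/
noncomputable def homOfMatrix {x x' : RepSpace (V := V) r R}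
    (g : ∀ i, Matrix (Fin (r i)) (Fin (r i)) R)
    (hg : ∀ (i j : V) (a : i ⟶ j), x' i j a * g i = g j * x i j a) :
    ofMatrix r x ⟶ ofMatrix r x' :=
  homMk (fun i => Matrix.toLin' (g i)) fun i j a y => by
    refine (Matrix.toLin'_mul_apply (x' i j a) (g i) y).symm.trans ?_
    rw [hg]
    exact Matrix.toLin'_mul_apply (g j) (x i j a) y

theorem homMatrix_homOfMatrix {x x' : RepSpace (V := V) r R}
    (g : ∀ i, Matrix (Fin (r i)) (Fin (r i)) R)
    (hg : ∀ (i j : V) (a : i ⟶ j), x' i j a * g i = g j * x i j a) :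
    homMatrix (homOfMatrix g hg) = g :=
  funext fun i => LinearMap.toMatrix'_toLin' (g i)

/-- The invertible matrices of an isomorphism. -/
noncomputable def isoMatrix {x x' : RepSpace (V := V) r R} (e : ofMatrix r x ≅ ofMatrix r x')
    (i : V) : GL (Fin (r i)) R where
  val := homMatrix e.hom i
  inv := homMatrix e.inv i
  val_inv := by rw [← homMatrix_comp, e.inv_hom_id, homMatrix_id]
  inv_val := by rw [← homMatrix_comp, e.hom_inv_id, homMatrix_id]

/-- The isomorphism given by invertible matrices. -/
noncomputable def isoOfMatrix {x x' : RepSpace (V := V) r R} (g : ∀ i, GL (Fin (r i)) R)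
    (hg : ∀ (i j : V) (a : i ⟶ j), x' i j a * (g i).1 = (g j).1 * x i j a) :
    ofMatrix r x ≅ ofMatrix r x' where
  hom := homOfMatrix (fun i => (g i).1) hg
  inv := homOfMatrix (fun i => ((g i)⁻¹).1) fun i j a => by
    have h1 : ((g j)⁻¹).1 * ((g j).1 * x i j a) * ((g i)⁻¹).1 =
        ((g j)⁻¹).1 * (x' i j a * (g i).1) * ((g i)⁻¹).1 := by rw [hg]
    have h2 : ((g j)⁻¹).1 * ((g j).1 * x i j a) = x i j a := by
      rw [← Matrix.mul_assoc, Units.inv_mul, Matrix.one_mul]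
    have h3 : x' i j a * (g i).1 * ((g i)⁻¹).1 = x' i j a := by
      rw [Matrix.mul_assoc, Units.mul_inv, Matrix.mul_one]
    rw [h2, Matrix.mul_assoc, h3] at h1
    exact h1
  hom_inv_id := homMatrix_injective (funext fun i => by
    rw [homMatrix_comp, homMatrix_homOfMatrix, homMatrix_homOfMatrix, homMatrix_id]
    exact Units.inv_mul _)
  inv_hom_id := homMatrix_injective (funext fun i => by
    rw [homMatrix_comp, homMatrix_homOfMatrix, homMatrix_homOfMatrix, homMatrix_id]
    exact Units.mul_inv _)

theorem isoMatrix_isoOfMatrix {x x' : RepSpace (V := V) r R} (g : ∀ i, GL (Fin (r i)) R)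
    (hg : ∀ (i j : V) (a : i ⟶ j), x' i j a * (g i).1 = (g j).1 * x i j a) :
    isoMatrix (isoOfMatrix g hg) = g :=
  funext fun i => Units.ext (congrFun (homMatrix_homOfMatrix (fun i => (g i).1) hg) i)

theorem isoMatrix_injective {x x' : RepSpace (V := V) r R} :
    Function.Injective (isoMatrix (x := x) (x' := x')) := fun _ _ h =>
  Iso.ext (homMatrix_injective (funext fun i => congrArg Units.val (congrFun h i)))

/-- The target is the transform of the source by the matrices, hence determined by them. -/
theorem eq_of_isoMatrix_eq {x x' x'' : RepSpace (V := V) r R} (e : ofMatrix r x ≅ ofMatrix r x')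
    (e' : ofMatrix r x ≅ ofMatrix r x'') (h : isoMatrix e = isoMatrix e') : x' = x'' := by
  funext i j a
  have h1 : ∀ i, homMatrix e.hom i = homMatrix e'.hom i := fun i =>
    congrArg Units.val (congrFun h i)
  have h2 : x' i j a * homMatrix e.hom i = x'' i j a * homMatrix e.hom i := by
    rw [homMatrix_comm e.hom a, h1 i, homMatrix_comm e'.hom a, h1]
  have h3 : homMatrix e.hom i * homMatrix e.inv i = 1 := (isoMatrix e i).val_inv
  have h4 := congrArg (· * homMatrix e.inv i) h2
  simpa only [Matrix.mul_assoc, h3, Matrix.mul_one] using h4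

/-- The orbit-stabilizer formula for representations given by matrices. -/
theorem card_fibre_mul (x₀ : RepSpace (V := V) r R) :
    Nat.card {x : RepSpace (V := V) r R // isoClass (ofMatrix r x) = isoClass (ofMatrix r x₀)} *
      Nat.card {f : ofMatrix r x₀ ⟶ ofMatrix r x₀ // IsIso f} =
    Nat.card (∀ i, GL (Fin (r i)) R) := by
  have he : ∀ x : {x : RepSpace (V := V) r R // isoClass (ofMatrix r x) =
      isoClass (ofMatrix r x₀)}, Nonempty (ofMatrix r x₀ ≅ ofMatrix r x.1) := fun x =>
    isoClass_eq_iff.1 x.2.symm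
  let e := fun x => (he x).some
  rw [← Nat.card_prod]
  -- With a chosen isomorphism from `x₀` to each point of its orbit, a tuple of invertible matrices
  -- is uniquely an automorphism of `x₀` followed by a chosen isomorphism.
  refine Nat.card_eq_of_bijective (fun z => isoMatrix
    ((have := z.2.2; asIso z.2.1) ≪≫ e z.1)) ⟨?_, fun g => ?_⟩
  · rintro ⟨x, f, hf⟩ ⟨x', f', hf'⟩ h
    obtain rfl : x = x' := Subtype.ext (eq_of_isoMatrix_eq _ _ h)
    have h1 := congrArg Iso.hom (isoMatrix_injective h)
    have h2 : f = f' := (cancel_mono (e x).hom).1 h1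
    subst h2
    rfl
  · let x : RepSpace (V := V) r R := fun i j a => (g j).1 * x₀ i j a * ((g i)⁻¹).1
    have hg : ∀ (i j : V) (a : i ⟶ j), x i j a * (g i).1 = (g j).1 * x₀ i j a := fun i j a => by
      rw [Matrix.mul_assoc, Units.inv_mul, Matrix.mul_one]
    let x' : {x : RepSpace (V := V) r R // isoClass (ofMatrix r x) = isoClass (ofMatrix r x₀)} :=
      ⟨x, isoClass_eq_iff.2 ⟨(isoOfMatrix g hg).symm⟩⟩
    refine ⟨⟨x', (isoOfMatrix g hg ≪≫ (e x').symm).hom, inferInstance⟩, ?_⟩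
    refine (congrArg isoMatrix (Iso.ext ?_)).trans (isoMatrix_isoOfMatrix g hg)
    change ((isoOfMatrix g hg).hom ≫ (e x').inv) ≫ (e x').hom = (isoOfMatrix g hg).hom
    rw [Category.assoc, Iso.inv_hom_id]
    exact Category.comp_id _

end HomMatrix

section Count

variable {V : Type v} [Fintype V] [Quiver.{w} V] [∀ i j : V, Fintype (i ⟶ j)]
  {K : Type u} [Field K] {R : Type u} [CommRing R] [Algebra K R] (r : V →₀ ℕ)

-- The kernel consists of the families of matrices commuting with `x`, which are the endomorphisms
-- of the representation.
omit [Fintype V] [∀ i j : V, Fintype (i ⟶ j)] in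
theorem card_ker_gaugeDerivative (x : RepSpace (⇑r) R) :
    Nat.card (LinearMap.ker (gaugeDerivative (K := K) r x)) =
      Nat.card (ofMatrix r x ⟶ ofMatrix r x) := by
  have hker : ∀ g : ∀ i, Matrix (Fin (r i)) (Fin (r i)) R,
      g ∈ LinearMap.ker (gaugeDerivative (K := K) r x) ↔
        ∀ (i j : V) (a : i ⟶ j), x i j a * g i = g j * x i j a := by
    intro g
    rw [LinearMap.mem_ker]
    constructor
    · intro h i j a
      exact (sub_eq_zero.1 (congrFun (congrFun (congrFun h i) j) a)).symm
    · intro h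
      funext i j a
      exact sub_eq_zero.2 (h i j a).symm
  refine (Nat.card_eq_of_bijective (fun f : ofMatrix r x ⟶ ofMatrix r x =>
    (⟨homMatrix f, (hker _).2 fun i j a => homMatrix_comm f a⟩ :
      LinearMap.ker (gaugeDerivative (K := K) r x))) ⟨fun f g h => ?_, fun g => ?_⟩).symm
  · exact homMatrix_injective (congrArg Subtype.val h)
  · exact ⟨homOfMatrix g.1 ((hker _).1 g.2), Subtype.ext (homMatrix_homOfMatrix _ _)⟩

omit [Quiver.{w} V] [∀ i j : V, Fintype (i ⟶ j)] [CommRing R] in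
theorem card_matrices : Nat.card (∀ i, Matrix (Fin (r i)) (Fin (r i)) R) =
    Nat.card R ^ ∑ i, r i * r i := by
  rw [Nat.card_pi, ← Finset.prod_pow_eq_pow_sum]
  refine Finset.prod_congr rfl fun i _ => ?_
  rw [Matrix, Nat.card_fun, Nat.card_fun, Nat.card_fin, pow_mul]

omit [CommRing R] in
theorem card_repSpace : Nat.card (RepSpace (⇑r) R) =
    Nat.card R ^ ∑ i, ∑ j, ∑ _a : i ⟶ j, r i * r j := by
  rw [Nat.card_pi, ← Finset.prod_pow_eq_pow_sum]
  refine Finset.prod_congr rfl fun i _ => ?_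
  rw [Nat.card_pi, ← Finset.prod_pow_eq_pow_sum]
  refine Finset.prod_congr rfl fun j _ => ?_
  rw [Nat.card_pi, ← Finset.prod_pow_eq_pow_sum]
  refine Finset.prod_congr rfl fun a _ => ?_
  rw [Matrix, Nat.card_fun, Nat.card_fun, Nat.card_fin, Nat.card_fin, pow_mul]

theorem card_momentMap_zero_mul [Finite K] [Finite R] {l : R →ₗ[K] K}
    (hl : ∀ r, (∀ s, l (r * s) = 0) → r = 0) :
    Nat.card {z : RepSpace (⇑r) R × OpRepSpace (⇑r) R // momentMap r R z = 0} *
      Nat.card R ^ (∑ i, r i * r i) =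
    Nat.card R ^ (∑ i, ∑ j, ∑ _a : i ⟶ j, r i * r j) *
      ∑ᶠ x : RepSpace (⇑r) R, Nat.card (ofMatrix r x ⟶ ofMatrix r x) := by
  have : Fintype (RepSpace (⇑r) R) := Fintype.ofFinite _
  rw [Nat.card_congr (Equiv.subtypeProdEquivSigmaSubtype fun x y => momentMap r R (x, y) = 0),
    Nat.card_sigma, finsum_eq_sum_of_fintype, Finset.sum_mul, Finset.mul_sum, ← card_matrices,
    ← card_repSpace]
  refine Finset.sum_congr rfl fun x _ => ?_
  rw [card_momentMap_fibre_mul _ hl, card_ker_gaugeDerivative]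

/-- The isomorphism class of M occurs for |GL|/|Aut M| of the points `x`, and |End| is constant on
it. -/
theorem finsum_card_end_div [Finite R] [Nontrivial R] :
    ((∑ᶠ x : RepSpace (⇑r) R, Nat.card (ofMatrix r x ⟶ ofMatrix r x) : ℕ) : ℚ) /
      Nat.card (∀ i, GL (Fin (r i)) R) =
    ∑ᶠ c ∈ {c : IsoClass (LFRep V R) | rankHom V R c = r}, classRatio c := by
  classical
  have : Fintype (RepSpace (⇑r) R) := Fintype.ofFinite _
  have hfin := finite_setOf_rankHom_eq (V := V) (R := R) r
  rw [finsum_eq_sum_of_fintype, finsum_mem_eq_finite_toFinset_sum _ hfin, Nat.cast_sum,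
    Finset.sum_div, ← Finset.sum_fiberwise_of_maps_to (s := Finset.univ) (t := hfin.toFinset)
      (g := fun x : RepSpace (⇑r) R => isoClass (ofMatrix r x)) fun x _ => by
        rw [Set.Finite.mem_toFinset]
        exact (rankHom_ofMatrix (⇑r) x).trans (Finsupp.equivFunOnFinite_symm_coe r)]
  refine Finset.sum_congr rfl fun c hc => ?_
  rw [Set.Finite.mem_toFinset] at hc
  obtain ⟨x₀, rfl⟩ := exists_isoClass_ofMatrix hc
  have h1 : ∀ x ∈ Finset.univ.filter fun x : RepSpace (⇑r) R =>
      isoClass (ofMatrix r x) = isoClass (ofMatrix r x₀),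
      (Nat.card (ofMatrix r x ⟶ ofMatrix r x) : ℚ) / Nat.card (∀ i, GL (Fin (r i)) R) =
      (Nat.card (ofMatrix r x₀ ⟶ ofMatrix r x₀) : ℚ) / Nat.card (∀ i, GL (Fin (r i)) R) := by
    intro x hx
    obtain ⟨e⟩ := isoClass_eq_iff.1 (Finset.mem_filter.1 hx).2
    rw [Nat.card_congr (e.homCongr e)]
  rw [Finset.sum_congr rfl h1, Finset.sum_const, nsmul_eq_mul, ← card_fibre_mul x₀,
    ← Fintype.card_subtype, Nat.card_eq_fintype_card (α := {x : RepSpace (⇑r) R // _})]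
  change _ = (Nat.card (ofMatrix r x₀ ⟶ ofMatrix r x₀) : ℚ) /
    Nat.card {f : ofMatrix r x₀ ⟶ ofMatrix r x₀ // IsIso f}
  have h2 : (Fintype.card {x : RepSpace (⇑r) R // isoClass (ofMatrix r x) =
      isoClass (ofMatrix r x₀)} : ℚ) ≠ 0 := by
    have : Nonempty {x : RepSpace (⇑r) R // isoClass (ofMatrix r x) =
      isoClass (ofMatrix r x₀)} := ⟨⟨x₀, rfl⟩⟩
    exact_mod_cast Fintype.card_ne_zero
  push_cast
  rw [← mul_div_assoc, mul_div_mul_left _ _ h2]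

end Count

end LFRep

end

/-! ### Assembly of the two sides -/

section

open CategoryTheory CategoryTheory.Limits

universe u v w

namespace LFRep

open KrullSchmidt GradedMultiset

variable {V : Type v} [Fintype V] [Quiver.{w} V] [∀ i j : V, Fintype (i ⟶ j)]
  {k : Type u} [Field k] [Finite k] {α : ℕ}

variable (V k α) in
/-- The rank of an indecomposable representation over truncated polynomials. -/
noncomputable def indecRank [Nontrivial (TruncPoly k α)]
    (I : IndecClass (LFRep V (TruncPoly k α))) : V →₀ ℕ := rankHom V _ I.1

variable (V k α) in
/-- The inverse of the order of the residue field of an indecomposable representation. -/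
noncomputable def residueWeight (I : IndecClass (LFRep V (TruncPoly k α))) : ℚ :=
  ((Nat.card k : ℚ) ^ I.degree k)⁻¹

omit [∀ i j : V, Fintype (i ⟶ j)] [Finite k] in
theorem indecRank_ne_zero [Nontrivial (TruncPoly k α)]
    (I : IndecClass (LFRep V (TruncPoly k α))) : indecRank V k α I ≠ 0 := fun h => by
  obtain ⟨c, J, hJ, rfl⟩ := I
  exact hJ.1 (isoClass_eq_zero.1 (rankHom_eq_zero _ h))

omit [∀ i j : V, Fintype (i ⟶ j)] in
theorem residueWeight_pow_ne_one (I : IndecClass (LFRep V (TruncPoly k α))) (n : ℕ) :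
    residueWeight V k α I ^ (n + 1) ≠ 1 := by
  have h1 : 1 < (Nat.card k : ℚ) := by exact_mod_cast Finite.one_lt_card
  have h2 : 1 < (Nat.card k : ℚ) ^ I.degree k := one_lt_pow₀ h1 I.degree_pos.ne'
  refine (pow_lt_one₀ ?_ ?_ n.succ_ne_zero).ne
  · rw [residueWeight]; positivity
  · exact inv_lt_one_of_one_lt₀ h2

-- By Krull–Schmidt, classes are multisets of indecomposables. Rank is additive and the ratio
-- multiplicative, each isotypic part contributing its q-product.
omit [∀ i j : V, Fintype (i ⟶ j)] in
theorem finsum_classRatio (hα : 1 ≤ α) [Nontrivial (TruncPoly k α)] (r : V →₀ ℕ) :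
    ∑ᶠ c ∈ {c : IsoClass (LFRep V (TruncPoly k α)) | rankHom V _ c = r}, classRatio c =
      weightedCount (indecRank V k α) (residueWeight V k α) r := by
  have := TruncPoly.isLocalRing k hα
  have h1 : ∀ m, rankHom V (TruncPoly k α) (sumClass m) = totalRank (indecRank V k α) m := by
    have : (rankHom V (TruncPoly k α)).comp sumClass = totalRank (indecRank V k α) := by
      refine Finsupp.addHom_ext fun I n => ?_
      rw [AddMonoidHom.comp_apply, sumClass_single, totalRank_single, map_nsmul]
      rfl
    exact DFunLike.congr_fun this
  refine (finsum_mem_eq_of_bijOn sumClass ⟨fun m hm => (h1 m).trans hm,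
    sumClass_injective.injOn, fun c hc => ?_⟩ fun m hm => ?_).symm
  · obtain ⟨m, rfl⟩ := sumClass_surjective c
    exact ⟨m, (h1 m).symm.trans hc, rfl⟩
  · rw [classRatio_sumClass]
    refine Finsupp.prod_congr fun I _ => ?_
    rw [← I.2.choose_spec.2, I.2.choose_spec.1.classRatio_nsmul, card_residue k, Nat.cast_pow]
    rfl

/-- As |R| = |k|^α, the twist by the Euler form is the number of gauge matrices divided by the
number of representations, which cancels the factor from the moment map fibres. -/
theorem card_momentMap_zero_div (hα : 1 ≤ α) [Nontrivial (TruncPoly k α)] (r : V →₀ ℕ) :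
    (Nat.card {z : RepSpace (⇑r) (TruncPoly k α) × OpRepSpace (⇑r) (TruncPoly k α) //
      momentMap r (TruncPoly k α) z = 0} : ℚ) /
      Nat.card (∀ i, GL (Fin (r i)) (TruncPoly k α)) *
      (Nat.card k : ℚ) ^ ((α : ℤ) * eulerForm (fun i => (r i : ℤ)) (fun i => (r i : ℤ))) =
    weightedCount (indecRank V k α) (residueWeight V k α) r := by
  rw [← finsum_classRatio hα, ← finsum_card_end_div]
  obtain ⟨l, hl⟩ := TruncPoly.exists_nondegenerate_form k α
  have h1 := card_momentMap_zero_mul r hl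
  rw [← Nat.cast_inj (R := ℚ)] at h1
  rw [Nat.cast_mul, Nat.cast_mul, Nat.cast_pow, Nat.cast_pow] at h1
  have hR : (Nat.card (TruncPoly k α) : ℚ) = (Nat.card k : ℚ) ^ α := by
    rw [TruncPoly.natCard, Nat.cast_pow]
  have hq : (Nat.card k : ℚ) ≠ 0 := Nat.cast_ne_zero.2 Nat.card_pos.ne'
  have h2 : (Nat.card k : ℚ) ^ ((α : ℤ) * eulerForm (fun i => (r i : ℤ)) (fun i => (r i : ℤ))) =
      (Nat.card (TruncPoly k α) : ℚ) ^ (∑ i, r i * r i) /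
        (Nat.card (TruncPoly k α) : ℚ) ^ (∑ i, ∑ j, ∑ _a : i ⟶ j, r i * r j) := by
    rw [hR, zpow_mul, zpow_natCast, eulerForm, zpow_sub₀ (pow_ne_zero _ hq)]
    have h3 : ∑ i, (r i : ℤ) * (r i : ℤ) = ((∑ i, r i * r i : ℕ) : ℤ) := by push_cast; rfl
    have h4 : ∑ i, ∑ j, ∑ _a : i ⟶ j, (r i : ℤ) * (r j : ℤ) =
        ((∑ i, ∑ j, ∑ _a : i ⟶ j, r i * r j : ℕ) : ℤ) := by push_cast; rfl
    rw [h3, h4, zpow_natCast, zpow_natCast]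
  have h3 : (Nat.card (TruncPoly k α) : ℚ) ^ (∑ i, ∑ j, ∑ _a : i ⟶ j, r i * r j) ≠ 0 :=
    pow_ne_zero _ (by rw [hR]; exact pow_ne_zero _ hq)
  rw [h2, div_mul_div_comm, h1, mul_comm (Nat.card (∀ i, GL (Fin (r i)) (TruncPoly k α)) : ℚ),
    mul_div_mul_left _ _ h3]

end LFRep

/-- The two extensions of `F` are constructed separately, so an embedding is chosen over the prime
field; only its degree matters, and that is found from the cardinalities. -/
theorem FiniteField.exists_algebra_extension (F : Type*) [Field F] [Finite F] (p : ℕ)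
    [Fact p.Prime] [CharP F p] (n m : ℕ+) :
    ∃ _ : Algebra (FiniteField.Extension F p n) (FiniteField.Extension F p (m * n : ℕ+)),
      Module.finrank (FiniteField.Extension F p n) (FiniteField.Extension F p (m * n : ℕ+)) =
        m := by
  let := ZMod.algebra F p
  obtain ⟨f⟩ := FiniteField.nonempty_algHom_of_finrank_dvd (F := ZMod p)
    (K := FiniteField.Extension F p n) (L := FiniteField.Extension F p (m * n : ℕ+)) (by
      rw [FiniteField.finrank_zmod_extension, FiniteField.finrank_zmod_extension, PNat.mul_coe]
      exact mul_dvd_mul_left _ (dvd_mul_left _ _))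
  let := f.toRingHom.toAlgebra
  refine ⟨this, ?_⟩
  have h1 := Module.natCard_eq_pow_finrank (K := FiniteField.Extension F p n)
    (V := FiniteField.Extension F p (m * n : ℕ+))
  rw [FiniteField.natCard_extension, FiniteField.natCard_extension, ← pow_mul] at h1
  have h2 := Nat.pow_right_injective (Finite.one_lt_card (α := F)) h1
  exact (Nat.eq_of_mul_eq_mul_left n.pos
    ((mul_comm _ _).trans ((PNat.mul_coe m n).symm.trans h2))).symm

section Count

open GradedMultiset LFRep

variable {V : Type v} [Fintype V] [Quiver.{w} V] [∀ i j : V, Fintype (i ⟶ j)]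
  (F : Type*) [Field F] [Finite F] (p : ℕ) [Fact p.Prime] [CharP F p] {α : ℕ}

/-- The logarithmic derivative of the plethystic exponential of the count of absolutely
indecomposable representations. -/
theorem degree_mul_coeff_adamsSeries_sum_countAbsIndec (hα : 1 ≤ α) (n : ℕ+)
    [Nontrivial (ExtTruncPoly F p α n)] {f : MvPowerSeries V CountingFn}
    (hf0 : MvPowerSeries.constantCoeff f = 0)
    (hf : ∀ r ≠ 0, MvPowerSeries.coeff r f = countAbsIndec F p α r / (1 - (countQ F)⁻¹)) (a : V →₀ ℕ) :
    (a.degree : ℚ) * (∑ᶠ m : ℕ+, (m : ℚ)⁻¹ • MvPowerSeries.coeff a (adamsSeries m f)) n =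
      ∑ j ∈ Finset.range a.degree,
        ∑ᶠ I ∈ {I | (j + 1) • indecRank V (FiniteField.Extension F p n) α I = a},
          ((indecRank V (FiniteField.Extension F p n) α I).degree : ℚ) *
            (1 - residueWeight V (FiniteField.Extension F p n) α I ^ (j + 1))⁻¹ := by
  -- `(m - 1).succPNat` is `m` for positive `m`; the value at `m = 0` is irrelevant.
  let A : ℕ → (V →₀ ℕ) → ℕ := fun m s =>
    QuiverRep.absIndecCount V (FiniteField.Extension F p ((m - 1).succPNat * n : ℕ+)) α s
  have hA : ∀ m s, m ≠ 0 → A m s = ∑ᶠ I ∈ {I | I.degree (FiniteField.Extension F p n) ∣ m ∧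
      indecRank V (FiniteField.Extension F p n) α I =
        I.degree (FiniteField.Extension F p n) • s},
      I.degree (FiniteField.Extension F p n) := by
    intro m s hm
    obtain ⟨hAlg, hfin⟩ := FiniteField.exists_algebra_extension F p n (m - 1).succPNat
    have h1 := absIndecCount_eq_finsum (V := V) (k := FiniteField.Extension F p n)
      (K := FiniteField.Extension F p ((m - 1).succPNat * n : ℕ+)) hα s
    rw [hfin, Nat.succPNat_coe, Nat.succ_eq_add_one, Nat.sub_add_cancel
      (Nat.one_le_iff_ne_zero.2 hm)] at h1
    exact h1
  have hdρ : ∀ I, ∃ s, indecRank V (FiniteField.Extension F p n) α I =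
      I.degree (FiniteField.Extension F p n) • s := by
    intro I
    -- The extension of degree equal to that of `I` already splits `I`, which gives the divisibility
    -- of its rank.
    obtain ⟨hAlg, hfin⟩ := FiniteField.exists_algebra_extension F p n
      ⟨I.degree (FiniteField.Extension F p n), I.degree_pos⟩
    exact exists_rankHom_eq_nsmul (K := FiniteField.Extension F p (⟨I.degree _, _⟩ * n : ℕ+)) hα I
      (by rw [hfin]; rfl)
  have h1 := sum_range_degree_eq (V := V) (ρ := indecRank V (FiniteField.Extension F p n) α)
    finite_setOf_rankHom_indecClass_eq (fun I => I.degree_pos) hdρ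
    (q := (Nat.card (FiniteField.Extension F p n) : ℚ)) hA a
  refine Eq.trans ?_ h1.symm
  rw [coeff_adamsSeries_sum f hf0]
  congr 1
  refine Finset.sum_congr rfl fun j hj => ?_
  refine finsum_mem_congr rfl fun s hs => ?_
  have hs0 : s ≠ 0 := by
    rintro rfl
    have : (0 : V →₀ ℕ) = a := (smul_zero (j + 1)).symm.trans hs
    rw [← this, map_zero, Finset.range_zero] at hj
    exact Finset.notMem_empty _ hj
  rw [hf s hs0, FiniteField.natCard_extension, Nat.cast_pow, ← pow_mul, mul_comm (n : ℕ)]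
  congr 1

end Count

end

theorem theorem3p1 {V : Type*} [Fintype V] [DecidableEq V] [Quiver V]
    [∀ i j : V, Fintype (i ⟶ j)]
    (F : Type*) [Field F] [Finite F] (p : ℕ) [Fact p.Prime] [CharP F p]
    (α : ℕ) (hα : 1 ≤ α) :
    (fun r : V →₀ ℕ => countMomentZero F p α r / countGL F p α r *
        countQ F ^ ((α : ℤ) * eulerForm (fun i => (r i : ℤ)) (fun i => (r i : ℤ))) :
      MvPowerSeries V CountingFn) =
    plethysticExp (fun r : V →₀ ℕ =>
      if r = 0 then 0 else countAbsIndec F p α r / (1 - (countQ F)⁻¹)) := by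
  set f : MvPowerSeries V CountingFn := fun r : V →₀ ℕ =>
    if r = 0 then 0 else countAbsIndec F p α r / (1 - (countQ F)⁻¹) with hf
  have hf0 : MvPowerSeries.constantCoeff f = 0 := by
    change f 0 = 0
    exact if_pos rfl
  let g : MvPowerSeries V CountingFn :=
    fun r => ∑ᶠ m : ℕ+, (m : ℚ)⁻¹ • MvPowerSeries.coeff r (adamsSeries m f)
  have hg0 : MvPowerSeries.constantCoeff g = 0 := by
    funext n
    refine (coeff_adamsSeries_sum f hf0 0 n).trans ?_
    rw [map_zero, Finset.range_zero, Finset.sum_empty]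
    rfl
  funext r
  funext n
  have hnt := TruncPoly.nontrivial (FiniteField.Extension F p n) hα
  have hL : ∀ r : V →₀ ℕ, (countMomentZero F p α r / countGL F p α r *
      countQ F ^ ((α : ℤ) * eulerForm (fun i => (r i : ℤ)) (fun i => (r i : ℤ)))) n =
      GradedMultiset.weightedCount (LFRep.indecRank V (FiniteField.Extension F p n) α)
        (LFRep.residueWeight V (FiniteField.Extension F p n) α) r := by
    intro r
    rw [← LFRep.card_momentMap_zero_div hα, FiniteField.natCard_extension, Nat.cast_pow]
    rfl
  rw [hL r]
  -- Both coefficient families obey the recursion whose kernel is the exponent weighted by degree.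
  refine eq_of_degree_mul_eq_sum (h := fun r => MvPowerSeries.coeff r (plethysticExp f) n)
    (G := fun a => (a.degree : ℚ) * g a n) (by simp) ?_ ?_ ?_ r
  · rw [GradedMultiset.weightedCount_zero LFRep.indecRank_ne_zero]
    exact (congrFun (MvPowerSeries.coeff_zero_subst_exp hg0) n).symm
  · intro r
    rw [GradedMultiset.degree_mul_weightedCount LFRep.indecRank_ne_zero
      LFRep.finite_setOf_rankHom_indecClass_eq LFRep.residueWeight_pow_ne_one]
    refine Finset.sum_congr rfl fun q _ => ?_
    rw [← degree_mul_coeff_adamsSeries_sum_countAbsIndec F p hα n hf0 fun r hr => if_neg hr]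
  · intro r
    have h1 := congrFun (MvPowerSeries.degree_mul_coeff_subst_exp hg0 r) n
    rw [Finset.sum_apply] at h1
    exact h1
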